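/- Fix an odd prime $\ell$ and an integer $n\ge 1$. For an abelian group $G$ and an integer $N$ write $G[N]=\{x\in G: Nx=0\}$; let $G^\vee=\mathrm{Hom}(G,\mathbb Q/\mathbb Z)$, and let $\wedge^2G\subseteq G\otimes G$ be the subgroup spanned by the elements $x\wedge y:=x\otimes y-y\otimes x$. **Bilinearly enhanced groups.** An *$\ell^n$-bilinearly enhanced group* is a triple $(G,\omega,\psi)$ where $G$ is a finite abelian $\ell$-group, $\omega\in(\wedge^2G)[\ell^n]$, and $\psi:G^\vee[\ell^n]\to G[\ell^n]$ is a homomorphism such that for all $r\ge 0$ and all $\alpha,\beta\in G^\vee[\ell^{n+r}]$ $$\beta(\psi(\ell^r\alpha))=\alpha(\psi(\ell^r\beta))+2\,\omega_{n+r}(\alpha,\beta).$$ Here, if $\alpha=\ell^{-m}a$ and $\beta=\ell^{-m}b$ with $a,b\in\mathrm{Hom}(G,\mathbb Z/\ell^m)$, then $\omega_m(\alpha,\beta)=\ell^{-m}(a\otimes b)(\omega)\in\frac1{\ell^m}\mathbb Z/\mathbb Z$, where $a\otimes b$ is the map $G\otimes G\to\mathbb Z/\ell^m$, $x\otimes y\mapsto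 a(x)b(y)$. A morphism $(G,\omega_G,\psi_G)\to(H,\omega_H,\psi_H)$ is a homomorphism $f:G\to H$ with $f_*\omega_G=\omega_H$ and $f\circ\psi_G\circ f^\vee=\psi_H$ on $H^\vee[\ell^n]$. $\mathrm{Surj}$ denotes the set of surjective morphisms and $\mathrm{Aut}$ the automorphism group. Let $\mathcal C_{\ell,n}$ be the (countable, discrete) set of isomorphism classes. **The random matrix model.** For $g\ge0$ let $\langle\cdot,\cdot\rangle$ be the standard symplectic form on $\mathbb Z_\ell^{2g}$ with symplectic basis $e_1,\dots,e_g,f_1,\dots,f_g$, $\langle e_i,f_i\rangle=1$. Let $M$ be random for the Haar probability measure on the additive group of skew-symplectic $2g\times 2g$ matrices over $\mathbb Z_\ell$ (those with $\langle Mv,w\rangle=-\langle v,Mw\rangle$ for all $v,w$). Let $G_M$ be the cokernel of $M+\ell^n$ on $\mathbb Z_\ell^{2g}$, which is almost surely finite. Let $\omega_M$ be the image of $\sum_i e_i\wedge f_i$ in $\wedge^2G_M$. For $\alpha\in G_M^\vee[\ell^n]$, write the pullback of $\alpha$ to $\mathbb Z_\ell^{2g}$ as $x\mapsto\langle x,\alpha'\rangle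 \bmod \mathbb Z_\ell$ with $\alpha'\in\ell^{-n}\mathbb Z_\ell^{2g}$, and let $\psi_M(\alpha)$ be the class of $(M+\ell^n)\alpha'$ in $G_M[\ell^n]$. Then $(G_M,\omega_M,\psi_M)$ is an $\ell^n$-bilinearly enhanced group; let $\mu_g$ be the probability measure on $\mathcal C_{\ell,n}$ that is its law. **Theorem.** There is a probability measure $\mu$ on $\mathcal C_{\ell,n}$ with $$\mathbb E_\mu\,\#\mathrm{Surj}(*,(G,\omega,\psi))=\frac1{|(\mathrm{Sym}^2G)[\ell^n]|}\qquad\text{for every }\ell^n\text{-bilinearly enhanced group }(G,\omega,\psi),$$ and $\mu$ is the only measure on $\mathcal C_{\ell,n}$ with these moments. As $g\to\infty$, $\mu_g$ converges to $\mu$ weakly (that is, $\int f\,d\mu_g\to\int f\,d\mu$ for every bounded function $f$ on $\mathcal C_{\ell,n}$; in particular $\mu_g(c)\to\mu(c)$ for every class $c$), and $\mathbb E_{\mu_g}\#\mathrm{Surj}(*,(G,\omega,\psi))\to 1/|(\mathrm{Sym}^2G)[\ell^n]|$ for every $(G,\omega,\psi)$. Moreover $\mu(G,\omega,\psi)\ne0$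 if and only if $\psi$ is an isomorphism, and in that case $$\mu(G,\omega,\psi)=\frac{c_\ell}{|\mathrm{Aut}(G,\omega,\psi)|\cdot|(\mathrm{Sym}^2G)[\ell^n]|},\qquad c_\ell=\prod_{i=0}^\infty\bigl(1-\ell^{-(2i+1)}\bigr).$$ -/

import Mathlib

open scoped TensorProduct ENNReal Topology
open Filter MeasureTheory

noncomputable section

namespace BilinEnh

/-- The Pontryagin dual `Hom(G, ℚ/ℤ)`. -/
abbrev Dual (G : Type*) [AddCommGroup G] : Type _ := G →+ AddCircle (1 : ℚ)

/-- `∧²G`, as the subgroup of `G ⊗ G` spanned by the elements `x ⊗ y - y ⊗ x`. -/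
def wedgeSq (G : Type*) [AddCommGroup G] : AddSubgroup (G ⊗[ℤ] G) :=
  AddSubgroup.closure {t | ∃ x y : G, t = x ⊗ₜ[ℤ] y - y ⊗ₜ[ℤ] x}

/-- The embedding `ℤ/N → ℚ/ℤ`, `x ↦ x/N`, whose image is `(1/N)ℤ/ℤ`. -/
def toQZ (N : ℕ) : ZMod N →+ AddCircle (1 : ℚ) :=
  ZMod.lift N ⟨zmultiplesHom _ ((((N : ℚ)⁻¹ : ℚ)) : AddCircle (1 : ℚ)), by
    rcases Nat.eq_zero_or_pos N with rfl | h
    · simp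
    · have h' : (N : ℚ) ≠ 0 := by positivity
      rw [zmultiplesHom_apply, ← AddCircle.coe_zsmul, AddCircle.coe_eq_zero_iff]
      exact ⟨1, by simp [h']⟩⟩

theorem toQZ_intCast (N : ℕ) (k : ℤ) :
    toQZ N (k : ZMod N) = (((k : ℚ) * (N : ℚ)⁻¹ : ℚ) : AddCircle (1 : ℚ)) := by
  rw [toQZ, ZMod.lift_coe, zmultiplesHom_apply, ← AddCircle.coe_zsmul, zsmul_eq_mul]

theorem toQZ_injective (N : ℕ) (hN : 0 < N) : Function.Injective (toQZ N) := by
  rw [injective_iff_map_eq_zero]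
  intro z hz
  obtain ⟨k, rfl⟩ := ZMod.intCast_surjective z
  rw [toQZ_intCast, AddCircle.coe_eq_zero_iff] at hz
  obtain ⟨m, hm⟩ := hz
  have h' : (N : ℚ) ≠ 0 := by positivity
  have : (k : ℚ) = m * N := by
    rw [zsmul_eq_mul, mul_one] at hm
    rw [hm]; field_simp
  have : k = m * N := by exact_mod_cast this
  rw [this]; simp

theorem exists_toQZ_eq (N : ℕ) (hN : 0 < N) (q : AddCircle (1 : ℚ)) (hq : N • q = 0) :
    ∃ z : ZMod N, toQZ N z = q := by
  induction q using QuotientAddGroup.induction_on with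
  | H x =>
    have h' : (N : ℚ) ≠ 0 := by positivity
    have hq' : ((N • x : ℚ) : AddCircle (1 : ℚ)) = 0 := hq
    rw [AddCircle.coe_eq_zero_iff] at hq'
    obtain ⟨k, hk⟩ := hq'
    refine ⟨(k : ZMod N), ?_⟩
    rw [toQZ_intCast]
    rw [zsmul_eq_mul, mul_one, nsmul_eq_mul] at hk
    rw [hk]
    congr 1
    field_simp

/-- Every `N`-torsion character of `G` comes from a homomorphism `G → ℤ/N`. -/
theorem exists_hom_zmod {G : Type*} [AddCommGroup G] (N : ℕ) (hN : 0 < N) (γ : Dual G)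
    (hγ : ∀ x, N • γ x = 0) : ∃ a : G →+ ZMod N, (toQZ N).comp a = γ := by
  choose a ha using fun x => exists_toQZ_eq N hN (γ x) (hγ x)
  refine ⟨⟨⟨a, ?_⟩, ?_⟩, ?_⟩
  · apply toQZ_injective N hN; rw [ha]; simp
  · intro x y; apply toQZ_injective N hN; simp [ha]
  · ext x; exact ha x

/-- The value `(a ⊗ b)(t) ∈ ℤ/N` of a pair of homomorphisms `a, b : G → ℤ/N` on `t ∈ G ⊗ G`. -/
def evalPair {G : Type*} [AddCommGroup G] {N : ℕ} (a b : G →+ ZMod N) : G ⊗[ℤ] G →ₗ[ℤ] ZMod N :=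
  LinearMap.mul' ℤ (ZMod N) ∘ₗ TensorProduct.map a.toIntLinearMap b.toIntLinearMap

/-- For `a : G → ℤ/ℓ^(n+r)`, with associated character `α ∈ G^∨[ℓ^(n+r)]`, the element
`ℓ^r α` of `G^∨[ℓ^n]`. -/
def scaledDual (ℓ n r : ℕ) {G : Type*} [AddCommGroup G] (a : G →+ ZMod (ℓ ^ (n + r))) :
    AddSubgroup.torsionBy (Dual G) ((ℓ ^ n : ℕ) : ℤ) :=
  ⟨ℓ ^ r • (toQZ (ℓ ^ (n + r))).comp a, by
    change ((ℓ ^ n : ℕ) : ℤ) • (ℓ ^ r • (toQZ (ℓ ^ (n + r))).comp a) = 0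
    rw [natCast_zsmul, smul_smul, ← pow_add]
    ext x
    change ℓ ^ (n + r) • toQZ _ (a x) = 0
    rw [← map_nsmul, nsmul_eq_mul, ZMod.natCast_self, zero_mul, map_zero]⟩

/-- Pullback of `N`-torsion characters along a homomorphism. -/
def pullDual {G H : Type*} [AddCommGroup G] [AddCommGroup H] {N : ℕ} (f : G →+ H)
    (γ : AddSubgroup.torsionBy (Dual H) (N : ℤ)) : AddSubgroup.torsionBy (Dual G) (N : ℤ) :=
  ⟨(γ : Dual H).comp f, by
    have h : (N : ℤ) • (γ : Dual H) = 0 := γ.2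
    change (N : ℤ) • ((γ : Dual H).comp f) = 0
    ext x
    exact DFunLike.congr_fun h (f x)⟩

/-- An `ℓ^n`-bilinearly enhanced group `(G, ω, ψ)`: a finite abelian `ℓ`-group `G`, an element
`ω ∈ (∧²G)[ℓ^n]` and a homomorphism `ψ : G^∨[ℓ^n] → G[ℓ^n]` such that
`⟨ℓ^r α, β⟩ = ⟨ℓ^r β, α⟩ + 2 ω_{n+r}(α, β)` for all `r ≥ 0` and `α, β ∈ G^∨[ℓ^(n+r)]`, where
`⟨γ, δ⟩ = δ(ψ(γ))`.  Here `α = a/ℓ^(n+r)` and `β = b/ℓ^(n+r)` run over `G^∨[ℓ^(n+r)]` as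
`a, b` run over `Hom(G, ℤ/ℓ^(n+r))`, and `ω_{n+r}(α, β) = (a ⊗ b)(ω)/ℓ^(n+r)`. -/
structure BEG (ℓ n : ℕ) where
  carrier : Type
  [addCommGroup : AddCommGroup carrier]
  [finite : Finite carrier]
  isPrimary : ∀ x : carrier, ∃ k : ℕ, ℓ ^ k • x = 0
  ω : carrier ⊗[ℤ] carrier
  ω_mem : ω ∈ wedgeSq carrier
  ω_torsion : ℓ ^ n • ω = 0
  ψ : AddSubgroup.torsionBy (Dual carrier) ((ℓ ^ n : ℕ) : ℤ) →+
    AddSubgroup.torsionBy carrier ((ℓ ^ n : ℕ) : ℤ)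
  compat : ∀ (r : ℕ) (a b : carrier →+ ZMod (ℓ ^ (n + r))),
    toQZ (ℓ ^ (n + r)) (b (ψ (scaledDual ℓ n r a))) =
      toQZ (ℓ ^ (n + r)) (a (ψ (scaledDual ℓ n r b))) +
        2 • toQZ (ℓ ^ (n + r)) (evalPair a b ω)

attribute [instance] BEG.addCommGroup BEG.finite

variable {ℓ n : ℕ}

/-- `f : G → H` is a morphism of bilinearly enhanced groups: `f_* ω_G = ω_H` and
`f_* ψ_G = ψ_H`, where `f_* ψ_G` is the composite
`H^∨[ℓ^n] → G^∨[ℓ^n] → G[ℓ^n] → H[ℓ^n]`. -/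
def IsMor (X Y : BEG ℓ n) (f : X.carrier →+ Y.carrier) : Prop :=
  TensorProduct.map f.toIntLinearMap f.toIntLinearMap X.ω = Y.ω ∧
    ∀ γ : AddSubgroup.torsionBy (Dual Y.carrier) ((ℓ ^ n : ℕ) : ℤ),
      f (X.ψ (pullDual f γ)) = (Y.ψ γ : Y.carrier)

/-- Surjective morphisms. -/
def Surj (X Y : BEG ℓ n) : Type :=
  {f : X.carrier →+ Y.carrier // IsMor X Y f ∧ Function.Surjective f}

/-- Isomorphisms. -/
def Iso (X Y : BEG ℓ n) : Type :=
  {e : X.carrier ≃+ Y.carrier // IsMor X Y e.toAddMonoidHom}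

theorem IsMor.comp {X Y Z : BEG ℓ n} {f : X.carrier →+ Y.carrier} {g : Y.carrier →+ Z.carrier}
    (hg : IsMor Y Z g) (hf : IsMor X Y f) : IsMor X Z (g.comp f) := by
  refine ⟨?_, fun γ => ?_⟩
  · rw [← hg.1, ← hf.1, ← LinearMap.comp_apply, ← TensorProduct.map_comp]
    rfl
  · rw [← hg.2 γ, ← hf.2]
    rfl

/-- The identity isomorphism. -/
def Iso.refl (X : BEG ℓ n) : Iso X X :=
  ⟨AddEquiv.refl _, by
    refine ⟨?_, fun γ => rfl⟩
    change TensorProduct.map LinearMap.id LinearMap.id X.ω = X.ω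
    rw [TensorProduct.map_id]; rfl⟩

/-- The inverse isomorphism. -/
def Iso.symm {X Y : BEG ℓ n} (e : Iso X Y) : Iso Y X :=
  ⟨e.1.symm, by
    refine ⟨?_, fun γ => ?_⟩
    · rw [← e.2.1, ← LinearMap.comp_apply, ← TensorProduct.map_comp]
      have : e.1.symm.toAddMonoidHom.toIntLinearMap ∘ₗ e.1.toAddMonoidHom.toIntLinearMap
          = LinearMap.id := by ext x; simp
      rw [this, TensorProduct.map_id]; rfl
    · have h := e.2.2 (pullDual e.1.symm.toAddMonoidHom γ)
      rw [← h]
      have h2 : pullDual e.1.toAddMonoidHom (pullDual e.1.symm.toAddMonoidHom γ) = γ := by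
        apply Subtype.ext
        ext x
        simp [pullDual]
      rw [h2]
      simp⟩

/-- Composition of isomorphisms. -/
def Iso.trans {X Y Z : BEG ℓ n} (e : Iso X Y) (e' : Iso Y Z) : Iso X Z :=
  ⟨AddEquiv.trans e.1 e'.1, by
    have h := IsMor.comp e'.2 e.2
    exact h⟩

/-- Being isomorphic. -/
instance begSetoid (ℓ n : ℕ) : Setoid (BEG ℓ n) where
  r X Y := Nonempty (Iso X Y)
  iseqv :=
    { refl := fun X => Nonempty.intro (Iso.refl X)
      symm := fun h => h.elim fun e => Nonempty.intro (Iso.symm e)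
      trans := fun h h' => h.elim fun e => h'.elim fun e' => Nonempty.intro (Iso.trans e e') }

/-- The set of isomorphism classes of `ℓ^n`-bilinearly enhanced groups. -/
def BEGClass (ℓ n : ℕ) : Type 1 := Quotient (begSetoid ℓ n)

/-- The isomorphism class of a bilinearly enhanced group. -/
def BEG.cls (X : BEG ℓ n) : BEGClass ℓ n := Quotient.mk _ X

/-- All sets of isomorphism classes are measurable (there are countably many classes). -/
instance (ℓ n : ℕ) : MeasurableSpace (BEGClass ℓ n) := ⊤

theorem card_surj_congr {X X' : BEG ℓ n} (e : Iso X X') (Y : BEG ℓ n) :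
    Nat.card (Surj X Y) = Nat.card (Surj X' Y) := by
  refine Nat.card_congr ⟨fun f => ⟨f.1.comp e.symm.1.toAddMonoidHom, f.2.1.comp e.symm.2, ?_⟩,
    fun f => ⟨f.1.comp e.1.toAddMonoidHom, f.2.1.comp e.2, ?_⟩, fun f => ?_, fun f => ?_⟩
  · exact f.2.2.comp e.1.symm.surjective
  · exact f.2.2.comp e.1.surjective
  · apply Subtype.ext; ext x; simp [Iso.symm]
  · apply Subtype.ext; ext x; simp [Iso.symm]

/-- `#Surj(c, Y)`, the number of surjective morphisms from (any representative of) the class `c`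
to `Y`. -/
def surjCount (c : BEGClass ℓ n) (Y : BEG ℓ n) : ℕ :=
  Quotient.lift (fun X => Nat.card (Surj X Y)) (fun _ _ h => Nonempty.elim h fun e => card_surj_congr e Y) c

/-- The moment `E_ν #Surj(*, Y)`. -/
def moment (ν : Measure (BEGClass ℓ n)) (Y : BEG ℓ n) : ℝ≥0∞ :=
  ∫⁻ c, (surjCount c Y : ℝ≥0∞) ∂ν

/-- The order of `(Sym²G)[ℓ^n]`. -/
def cardSymSq (Y : BEG ℓ n) : ℕ :=
  Nat.card (AddSubgroup.torsionBy (SymmetricPower ℤ (Fin 2) Y.carrier) ((ℓ ^ n : ℕ) : ℤ))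

/-- The order of the automorphism group `Aut(G, ω, ψ)`. -/
def cardAut (Y : BEG ℓ n) : ℕ := Nat.card (Iso Y Y)

/-- `c_ℓ = ∏_{i ≥ 0} (1 - ℓ^{-(2i+1)})`. -/
def cConst (ℓ : ℕ) : ℝ := ∏' i : ℕ, (1 - ((ℓ : ℝ) ^ (2 * i + 1))⁻¹)

theorem multipliable_cConst (ℓ : ℕ) (hℓ : 1 < ℓ) :
    Multipliable fun i : ℕ => (1 - ((ℓ : ℝ) ^ (2 * i + 1))⁻¹) := by
  have h1 : (1 : ℝ) < ℓ := by exact_mod_cast hℓ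
  have h : Summable fun i : ℕ => -((ℓ : ℝ) ^ (2 * i + 1))⁻¹ := by
    apply Summable.neg
    have h2 : Summable fun k : ℕ => ((ℓ : ℝ)⁻¹) ^ k :=
      summable_geometric_of_lt_one (by positivity) (inv_lt_one_of_one_lt₀ h1)
    have := h2.comp_injective (i := fun i : ℕ => 2 * i + 1) (fun a b h => by simpa using h)
    simpa [Function.comp_def] using this
  simpa [sub_eq_add_neg] using Real.multipliable_one_add_of_summable h

/-! The linear random matrix model. -/

section Linear

variable [Fact ℓ.Prime] {g : ℕ}

/-- `ℤ_ℓ^{2g}`, with basis `e_1, …, e_g, f_1, …, f_g`. -/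
abbrev Lattice (ℓ g : ℕ) [Fact ℓ.Prime] : Type := Fin g ⊕ Fin g → ℤ_[ℓ]

/-- `2g × 2g` matrices over `ℤ_ℓ`. -/
abbrev Mat (ℓ g : ℕ) [Fact ℓ.Prime] : Type := Matrix (Fin g ⊕ Fin g) (Fin g ⊕ Fin g) ℤ_[ℓ]

/-- The basis vector `e_i`. -/
def eVec (i : Fin g) : Lattice ℓ g := Pi.single (Sum.inl i) 1

/-- The basis vector `f_i`. -/
def fVec (i : Fin g) : Lattice ℓ g := Pi.single (Sum.inr i) 1

/-- The standard symplectic form, with `⟨e_i, f_j⟩ = δ_{ij}` and `⟨e_i, e_j⟩ = ⟨f_i, f_j⟩ = 0`. -/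
def sympForm (v w : Lattice ℓ g) : ℤ_[ℓ] :=
  ∑ i, (v (Sum.inl i) * w (Sum.inr i) - v (Sum.inr i) * w (Sum.inl i))

theorem sympForm_add_left (v v' w : Lattice ℓ g) :
    sympForm (v + v') w = sympForm v w + sympForm v' w := by
  simp only [sympForm, Pi.add_apply, ← Finset.sum_add_distrib]
  exact Finset.sum_congr rfl fun i _ => by ring

theorem sympForm_add_right (v w w' : Lattice ℓ g) :
    sympForm v (w + w') = sympForm v w + sympForm v w' := by
  simp only [sympForm, Pi.add_apply, ← Finset.sum_add_distrib]
  exact Finset.sum_congr rfl fun i _ => by ring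

theorem sympForm_smul_left (c : ℤ_[ℓ]) (v w : Lattice ℓ g) :
    sympForm (c • v) w = c * sympForm v w := by
  simp only [sympForm, Pi.smul_apply, smul_eq_mul, Finset.mul_sum]
  exact Finset.sum_congr rfl fun i _ => by ring

theorem sympForm_smul_right (c : ℤ_[ℓ]) (v w : Lattice ℓ g) :
    sympForm v (c • w) = c * sympForm v w := by
  simp only [sympForm, Pi.smul_apply, smul_eq_mul, Finset.mul_sum]
  exact Finset.sum_congr rfl fun i _ => by ring

theorem sympForm_swap (v w : Lattice ℓ g) : sympForm v w = - sympForm w v := by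
  simp only [sympForm, ← Finset.sum_neg_distrib]
  exact Finset.sum_congr rfl fun i _ => by ring

theorem sympForm_eVec (i : Fin g) (w : Lattice ℓ g) : sympForm (eVec i) w = w (Sum.inr i) := by
  simp [sympForm, eVec, Pi.single_apply]

theorem sympForm_fVec (i : Fin g) (w : Lattice ℓ g) :
    sympForm (fVec i) w = - w (Sum.inl i) := by
  simp [sympForm, fVec, Pi.single_apply]

theorem lattice_eq_sum (x : Lattice ℓ g) :
    x = ∑ i, (x (Sum.inl i) • eVec i + x (Sum.inr i) • fVec i) := by
  ext j
  simp only [Finset.sum_apply, Pi.add_apply, Pi.smul_apply, smul_eq_mul, eVec, fVec,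
    Pi.single_apply]
  rcases j with j | j <;> simp

/-- The additive group of skew-symplectic matrices: `⟨M v, w⟩ = -⟨v, M w⟩` for all `v, w`. -/
def skewSymplectic (ℓ g : ℕ) [Fact ℓ.Prime] : AddSubgroup (Mat ℓ g) where
  carrier := {M | ∀ v w, sympForm (M.mulVec v) w = - sympForm v (M.mulVec w)}
  zero_mem' v w := by simp [sympForm]
  add_mem' {M M'} h h' v w := by
    rw [Matrix.add_mulVec, Matrix.add_mulVec, sympForm_add_left, sympForm_add_right, h, h']
    ring
  neg_mem' {M} h v w := by
    have e : ∀ u : Lattice ℓ g, (-M).mulVec u = (-1 : ℤ_[ℓ]) • M.mulVec u := by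
      intro u; rw [Matrix.neg_mulVec, neg_one_smul]
    rw [e, e, sympForm_smul_left, sympForm_smul_right, h]
    ring

instance : CompactSpace (Mat ℓ g) :=
  inferInstanceAs (CompactSpace (Fin g ⊕ Fin g → Fin g ⊕ Fin g → ℤ_[ℓ]))

theorem isClosed_skewSymplectic : IsClosed (skewSymplectic ℓ g : Set (Mat ℓ g)) := by
  have : (skewSymplectic ℓ g : Set (Mat ℓ g)) =
      ⋂ v, ⋂ w, {M | sympForm (M.mulVec v) w = - sympForm v (M.mulVec w)} := by
    ext M; simp [skewSymplectic]
  rw [this]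
  refine isClosed_iInter fun v => isClosed_iInter fun w => isClosed_eq ?_ ?_
  · unfold sympForm Matrix.mulVec dotProduct
    fun_prop
  · unfold sympForm Matrix.mulVec dotProduct
    fun_prop

instance : CompactSpace (skewSymplectic ℓ g) :=
  isCompact_iff_compactSpace.mp isClosed_skewSymplectic.isCompact

instance : MeasurableSpace (skewSymplectic ℓ g) := borel _

instance : BorelSpace (skewSymplectic ℓ g) := ⟨rfl⟩

/-- The Haar measure on skew-symplectic matrices, of total mass `1`. -/
def haarSkew (ℓ g : ℕ) [Fact ℓ.Prime] : Measure (skewSymplectic ℓ g) :=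
  Measure.addHaarMeasure ⊤

/-- The endomorphism `M + ℓ^n` of `ℤ_ℓ^{2g}`. -/
def shift (n : ℕ) (M : Mat ℓ g) : Lattice ℓ g →ₗ[ℤ_[ℓ]] Lattice ℓ g :=
  M.mulVecLin + ((ℓ : ℤ_[ℓ]) ^ n) • LinearMap.id

theorem shift_apply (n : ℕ) (M : Mat ℓ g) (v : Lattice ℓ g) :
    shift n M v = M.mulVec v + (ℓ : ℤ_[ℓ]) ^ n • v := rfl

/-- `G_M`, the cokernel of `M + ℓ^n`. -/
abbrev Coker (n : ℕ) (M : Mat ℓ g) : Type := Lattice ℓ g ⧸ LinearMap.range (shift n M)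

/-- The projection `ℤ_ℓ^{2g} → G_M`. -/
abbrev proj (n : ℕ) (M : Mat ℓ g) : Lattice ℓ g →ₗ[ℤ_[ℓ]] Coker n M :=
  (LinearMap.range (shift n M)).mkQ

/-- `ω_M`, the image of `∑ e_i ∧ f_i` in `∧² G_M`. -/
def omegaM (n : ℕ) (M : Mat ℓ g) : Coker n M ⊗[ℤ] Coker n M :=
  ∑ i, (proj n M (eVec i) ⊗ₜ[ℤ] proj n M (fVec i) - proj n M (fVec i) ⊗ₜ[ℤ] proj n M (eVec i))

theorem omegaM_mem (M : Mat ℓ g) : omegaM n M ∈ wedgeSq (Coker n M) :=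
  sum_mem fun _ _ => AddSubgroup.subset_closure ⟨_, _, rfl⟩

theorem exists_pow_smul_eq_zero (G : Type*) [AddCommGroup G] [Module ℤ_[ℓ] G] [Finite G] :
    ∃ k : ℕ, ∀ x : G, ℓ ^ k • x = 0 := by
  have h0 : (Nat.card G : ℤ_[ℓ]) ≠ 0 := by exact_mod_cast Nat.card_pos.ne'
  refine ⟨(Nat.card G : ℤ_[ℓ]).valuation, fun x => ?_⟩
  have h1 : (Nat.card G : ℤ_[ℓ]) • x = 0 := by
    rw [Nat.cast_smul_eq_nsmul, card_nsmul_eq_zero']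
  rw [PadicInt.unitCoeff_spec h0, mul_smul] at h1
  have h2 : (ℓ : ℤ_[ℓ]) ^ (Nat.card G : ℤ_[ℓ]).valuation • x = 0 :=
    (PadicInt.unitCoeff h0).isUnit.smul_eq_zero.mp h1
  rw [← Nat.cast_smul_eq_nsmul ℤ_[ℓ], Nat.cast_pow, h2]

theorem exists_natCast_add (k : ℕ) (c : ℤ_[ℓ]) :
    ∃ (m : ℕ) (d : ℤ_[ℓ]), c = m + (ℓ : ℤ_[ℓ]) ^ k * d := by
  have h := PadicInt.appr_spec k c
  rw [Ideal.mem_span_singleton] at h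
  obtain ⟨d, hd⟩ := h
  exact ⟨c.appr k, d, by rw [← hd]; ring⟩

theorem smul_tmul_padic (G : Type*) [AddCommGroup G] [Module ℤ_[ℓ] G] [Finite G]
    (c : ℤ_[ℓ]) (x y : G) : (c • x) ⊗ₜ[ℤ] y = x ⊗ₜ[ℤ] (c • y) := by
  obtain ⟨k, hk⟩ := exists_pow_smul_eq_zero (ℓ := ℓ) G
  obtain ⟨m, d, rfl⟩ := exists_natCast_add k c
  have h : ∀ z : G, ((m : ℤ_[ℓ]) + (ℓ : ℤ_[ℓ]) ^ k * d) • z = m • z := by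
    intro z
    rw [add_smul, mul_smul, Nat.cast_smul_eq_nsmul, ← Nat.cast_pow, Nat.cast_smul_eq_nsmul, hk,
      add_zero]
  rw [h, h, ← natCast_zsmul, ← natCast_zsmul, TensorProduct.smul_tmul]

theorem sympForm_eVec_right (i : Fin g) (w : Lattice ℓ g) :
    sympForm w (eVec i) = - w (Sum.inr i) := by
  rw [sympForm_swap, sympForm_eVec]

theorem sympForm_fVec_right (i : Fin g) (w : Lattice ℓ g) :
    sympForm w (fVec i) = w (Sum.inl i) := by
  rw [sympForm_swap, sympForm_fVec, neg_neg]

theorem mulVec_eVec (M : Mat ℓ g) (i : Fin g) (k : Fin g ⊕ Fin g) :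
    M.mulVec (eVec i) k = M k (Sum.inl i) := by
  simp [eVec]

theorem mulVec_fVec (M : Mat ℓ g) (i : Fin g) (k : Fin g ⊕ Fin g) :
    M.mulVec (fVec i) k = M k (Sum.inr i) := by
  simp [fVec]

theorem omegaM_torsion (hℓ : ℓ ≠ 2) {M : Mat ℓ g} (hM : M ∈ skewSymplectic ℓ g)
    [Finite (Coker n M)] : ℓ ^ n • omegaM n M = 0 := by
  have hM' : ∀ v w, sympForm (M.mulVec v) w = - sympForm v (M.mulVec w) := hM
  -- the bilinear map `u(x, y) = x ⊗ y` over `ℤ_ℓ`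
  let P := proj n M
  have smulR : ∀ (c : ℤ_[ℓ]) (x y : Coker n M), x ⊗ₜ[ℤ] (c • y) = c • (x ⊗ₜ[ℤ] y) := by
    intro c x y
    rw [← smul_tmul_padic, TensorProduct.smul_tmul']
  have smulL : ∀ (c : ℤ_[ℓ]) (x y : Coker n M), (c • x) ⊗ₜ[ℤ] y = c • (x ⊗ₜ[ℤ] y) := by
    intro c x y
    rw [TensorProduct.smul_tmul']
  have expE : ∀ i, P (M.mulVec (eVec i)) =
      ∑ j, (M (Sum.inl j) (Sum.inl i) • P (eVec j) + M (Sum.inr j) (Sum.inl i) • P (fVec j)) := by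
    intro i
    conv_lhs => rw [lattice_eq_sum (M.mulVec (eVec i))]
    simp [mulVec_eVec]
  have expF : ∀ i, P (M.mulVec (fVec i)) =
      ∑ j, (M (Sum.inl j) (Sum.inr i) • P (eVec j) + M (Sum.inr j) (Sum.inr i) • P (fVec j)) := by
    intro i
    conv_lhs => rw [lattice_eq_sum (M.mulVec (fVec i))]
    simp [mulVec_fVec]
  have relC : ∀ i j, M (Sum.inr j) (Sum.inl i) = M (Sum.inr i) (Sum.inl j) := by
    intro i j
    have := hM' (eVec i) (eVec j)
    rw [sympForm_eVec_right, sympForm_eVec, mulVec_eVec, mulVec_eVec] at this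
    simpa using this
  have relB : ∀ i j, M (Sum.inl j) (Sum.inr i) = M (Sum.inl i) (Sum.inr j) := by
    intro i j
    have := hM' (fVec i) (fVec j)
    rw [sympForm_fVec_right, sympForm_fVec, mulVec_fVec, mulVec_fVec] at this
    simpa using this
  have relD : ∀ i j, M (Sum.inr j) (Sum.inr i) = - M (Sum.inl i) (Sum.inl j) := by
    intro i j
    have := hM' (fVec i) (eVec j)
    rw [sympForm_eVec_right, sympForm_fVec, mulVec_eVec, mulVec_fVec] at this
    simpa [neg_eq_iff_eq_neg] using this
  have hP : ∀ x, P (M.mulVec x) = - ((ℓ : ℤ_[ℓ]) ^ n • P x) := by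
    intro x
    have : P (shift n M x) = 0 := (Submodule.Quotient.mk_eq_zero _).mpr ⟨x, rfl⟩
    rw [shift_apply, map_add, map_smul] at this
    exact eq_neg_of_add_eq_zero_left this
  have key : ∑ i, ((P (M.mulVec (eVec i)) ⊗ₜ[ℤ] P (fVec i)
        - P (fVec i) ⊗ₜ[ℤ] P (M.mulVec (eVec i)))
      + (P (eVec i) ⊗ₜ[ℤ] P (M.mulVec (fVec i))
        - P (M.mulVec (fVec i)) ⊗ₜ[ℤ] P (eVec i))) = 0 := by
    simp only [expE, expF, TensorProduct.sum_tmul, TensorProduct.tmul_sum, TensorProduct.add_tmul,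
      TensorProduct.tmul_add, smulL, smulR, Finset.sum_add_distrib, Finset.sum_sub_distrib, relD]
    have c1 : ∑ i, ∑ j, M (Sum.inr j) (Sum.inl i) • (P (fVec j) ⊗ₜ[ℤ] P (fVec i)) =
        ∑ i, ∑ j, M (Sum.inr j) (Sum.inl i) • (P (fVec i) ⊗ₜ[ℤ] P (fVec j)) := by
      rw [Finset.sum_comm]
      exact Finset.sum_congr rfl fun i _ => Finset.sum_congr rfl fun j _ => by rw [relC]
    have c2 : ∑ i, ∑ j, M (Sum.inl j) (Sum.inr i) • (P (eVec j) ⊗ₜ[ℤ] P (eVec i)) =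
        ∑ i, ∑ j, M (Sum.inl j) (Sum.inr i) • (P (eVec i) ⊗ₜ[ℤ] P (eVec j)) := by
      rw [Finset.sum_comm]
      exact Finset.sum_congr rfl fun i _ => Finset.sum_congr rfl fun j _ => by rw [relB]
    have c3 : ∑ i, ∑ j, M (Sum.inl j) (Sum.inl i) • (P (eVec j) ⊗ₜ[ℤ] P (fVec i)) =
        ∑ i, ∑ j, M (Sum.inl i) (Sum.inl j) • (P (eVec i) ⊗ₜ[ℤ] P (fVec j)) :=
      Finset.sum_comm
    have c4 : ∑ i, ∑ j, M (Sum.inl j) (Sum.inl i) • (P (fVec i) ⊗ₜ[ℤ] P (eVec j)) =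
        ∑ i, ∑ j, M (Sum.inl i) (Sum.inl j) • (P (fVec j) ⊗ₜ[ℤ] P (eVec i)) :=
      Finset.sum_comm
    simp only [neg_smul, Finset.sum_neg_distrib]
    rw [c1, c2, c3, c4]
    abel
  have h2 : (2 * ℓ ^ n) • omegaM n M = 0 := by
    simp only [hP, TensorProduct.neg_tmul, TensorProduct.tmul_neg, smulL, smulR] at key
    have e : -((2 * ℓ ^ n) • omegaM n M) = 0 := by
      rw [← key, omegaM, Finset.smul_sum, ← Finset.sum_neg_distrib]
      refine Finset.sum_congr rfl fun i _ => ?_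
      rw [← Nat.cast_smul_eq_nsmul ℤ_[ℓ]]
      push_cast
      change _ = (-((ℓ : ℤ_[ℓ]) ^ n • (proj n M (eVec i) ⊗ₜ[ℤ] proj n M (fVec i))) -
        -((ℓ : ℤ_[ℓ]) ^ n • (proj n M (fVec i) ⊗ₜ[ℤ] proj n M (eVec i)))) +
        (-((ℓ : ℤ_[ℓ]) ^ n • (proj n M (eVec i) ⊗ₜ[ℤ] proj n M (fVec i))) -
        -((ℓ : ℤ_[ℓ]) ^ n • (proj n M (fVec i) ⊗ₜ[ℤ] proj n M (eVec i))))
      module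
    exact neg_eq_zero.mp e
  obtain ⟨k, hk⟩ := exists_pow_smul_eq_zero (ℓ := ℓ) (Coker n M)
  have h3 : ℓ ^ k • (ℓ ^ n • omegaM n M) = 0 := by
    rw [smul_comm]
    have : ℓ ^ k • omegaM n M = 0 := by
      rw [omegaM, Finset.smul_sum]
      refine Finset.sum_eq_zero fun i _ => ?_
      rw [smul_sub, TensorProduct.smul_tmul', TensorProduct.smul_tmul', hk, hk]
      simp
    rw [this, smul_zero]
  have h4 : 2 • (ℓ ^ n • omegaM n M) = 0 := by rw [smul_smul]; exact h2
  have hcop : Nat.Coprime (ℓ ^ k) 2 :=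
    Nat.Coprime.pow_left _ ((Nat.coprime_primes Fact.out Nat.prime_two).mpr hℓ)
  have h5 := Nat.dvd_gcd (addOrderOf_dvd_iff_nsmul_eq_zero.mpr h3)
    (addOrderOf_dvd_iff_nsmul_eq_zero.mpr h4)
  rw [hcop.gcd_eq_one, Nat.dvd_one, AddMonoid.addOrderOf_eq_one_iff] at h5
  exact h5

/-- Every homomorphism `ℤ_ℓ^{2g} → ℤ/ℓ^m` is of the form `⟨•, s⟩ mod ℓ^m`. -/
theorem exists_sympForm_eq (m : ℕ) (a : Lattice ℓ g →+ ZMod (ℓ ^ m)) :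
    ∃ s : Lattice ℓ g, ∀ x, a x = PadicInt.toZModPow m (sympForm x s) := by
  have hsm : ∀ (c : ℤ_[ℓ]) (x : Lattice ℓ g), a (c • x) = PadicInt.toZModPow m c * a x := by
    intro c x
    obtain ⟨k, d, rfl⟩ := exists_natCast_add m c
    have hz : ((ℓ : ZMod (ℓ ^ m)) ^ m) = 0 := by
      rw [← Nat.cast_pow, ZMod.natCast_self]
    rw [add_smul, mul_smul, Nat.cast_smul_eq_nsmul, ← Nat.cast_pow, Nat.cast_smul_eq_nsmul,
      map_add, map_nsmul, map_nsmul]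
    simp [hz]
  have hsurj : ∀ z : ZMod (ℓ ^ m), ∃ c : ℤ_[ℓ], PadicInt.toZModPow m c = z :=
    ZMod.ringHom_surjective _
  choose c hc using hsurj
  refine ⟨Sum.elim (fun i => - c (a (fVec i))) (fun i => c (a (eVec i))), fun x => ?_⟩
  conv_lhs => rw [lattice_eq_sum x]
  simp only [map_sum, map_add, hsm, sympForm, Sum.elim_inl, Sum.elim_inr, map_sub, map_mul,
    map_neg, hc]
  exact Finset.sum_congr rfl fun i _ => by ring

theorem toZModPow_eq_zero (m : ℕ) (c : ℤ_[ℓ]) :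
    PadicInt.toZModPow m c = 0 ↔ (ℓ : ℤ_[ℓ]) ^ m ∣ c := by
  rw [← RingHom.mem_ker, PadicInt.ker_toZModPow, Ideal.mem_span_singleton]

/-- A vector pairing to `ℓ^m ℤ_ℓ` with everything is divisible by `ℓ^m`. -/
theorem exists_eq_smul (m : ℕ) (s : Lattice ℓ g)
    (h : ∀ x, PadicInt.toZModPow m (sympForm x s) = 0) : ∃ u, s = (ℓ : ℤ_[ℓ]) ^ m • u := by
  have h' : ∀ k, (ℓ : ℤ_[ℓ]) ^ m ∣ s k := by
    rintro (i | i)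
    · have := (toZModPow_eq_zero m _).mp (h (fVec i))
      rwa [sympForm_fVec, dvd_neg] at this
    · have := (toZModPow_eq_zero m _).mp (h (eVec i))
      rwa [sympForm_eVec] at this
  choose u hu using h'
  exact ⟨u, funext hu⟩

theorem sympForm_shift {M : Mat ℓ g} (hM : M ∈ skewSymplectic ℓ g) (s t : Lattice ℓ g) :
    sympForm (shift n M s) t + sympForm s (shift n M t) = 2 * (ℓ : ℤ_[ℓ]) ^ n * sympForm s t := by
  have hM' : ∀ v w, sympForm (M.mulVec v) w = - sympForm v (M.mulVec w) := hM
  rw [shift_apply, shift_apply, sympForm_add_left, sympForm_add_right, sympForm_smul_left,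
    sympForm_smul_right, hM']
  ring

/-- If `⟨•, s⟩ mod ℓ^n` vanishes on the image of `M + ℓ^n`, then `ℓ^n` divides `(M + ℓ^n) s`. -/
theorem shift_divisible {M : Mat ℓ g} (hM : M ∈ skewSymplectic ℓ g) (s : Lattice ℓ g)
    (h : ∀ x, PadicInt.toZModPow n (sympForm (shift n M x) s) = 0) :
    ∃ u, shift n M s = (ℓ : ℤ_[ℓ]) ^ n • u := by
  apply exists_eq_smul
  intro x
  have e := sympForm_shift (n := n) hM x s
  have h1 := h x
  rw [toZModPow_eq_zero] at h1 ⊢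
  have : sympForm x (shift n M s) = (ℓ : ℤ_[ℓ]) ^ n * (2 * sympForm x s)
      - sympForm (shift n M x) s := by linear_combination e
  rw [this]
  exact dvd_sub (Dvd.intro _ rfl) h1

theorem toZModPow_add_smul (n r : ℕ) (c : ℤ_[ℓ]) :
    ℓ ^ r • toQZ (ℓ ^ (n + r)) (PadicInt.toZModPow (n + r) c) =
      toQZ (ℓ ^ n) (PadicInt.toZModPow n c) := by
  obtain ⟨m, d, rfl⟩ := exists_natCast_add (n + r) c
  have hz : ∀ k ≤ n + r, PadicInt.toZModPow k ((m : ℤ_[ℓ]) + (ℓ : ℤ_[ℓ]) ^ (n + r) * d) =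
      ((m : ℤ) : ZMod (ℓ ^ k)) := by
    intro k hk
    have : PadicInt.toZModPow k ((ℓ : ℤ_[ℓ]) ^ (n + r) * d) = 0 :=
      (toZModPow_eq_zero k _).mpr (Dvd.dvd.mul_right (pow_dvd_pow _ hk) d)
    rw [map_add, this]
    simp
  have hl : (ℓ : ℚ) ≠ 0 := by exact_mod_cast (Fact.out : ℓ.Prime).ne_zero
  rw [hz _ le_rfl, hz _ (Nat.le_add_right n r), toQZ_intCast, toQZ_intCast, ← AddCircle.coe_nsmul]
  congr 1
  rw [nsmul_eq_mul]
  push_cast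
  field_simp
  ring

/-- `(s, u)` computes `ψ_M` at the character `γ ∈ G_M^∨[ℓ^n]`: the pullback of `γ` to `ℤ_ℓ^{2g}` is
`⟨•, s/ℓ^n⟩ mod ℤ_ℓ`, and `(M + ℓ^n)(s/ℓ^n) = u`. -/
def PsiRel (n : ℕ) (M : Mat ℓ g) (γ : Dual (Coker n M)) (s u : Lattice ℓ g) : Prop :=
  (∀ x, γ (proj n M x) = toQZ (ℓ ^ n) (PadicInt.toZModPow n (sympForm x s))) ∧
    shift n M s = (ℓ : ℤ_[ℓ]) ^ n • u

theorem pow_pos_of_prime (k : ℕ) : 0 < ℓ ^ k := pow_pos (Fact.out : ℓ.Prime).pos k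

theorem PsiRel.exists {M : Mat ℓ g} (hM : M ∈ skewSymplectic ℓ g) (γ : Dual (Coker n M))
    (hγ : ((ℓ ^ n : ℕ) : ℤ) • γ = 0) : ∃ s u, PsiRel n M γ s u := by
  obtain ⟨a, ha⟩ := exists_hom_zmod (ℓ ^ n) (pow_pos_of_prime n) γ (fun x => by
    have := DFunLike.congr_fun hγ x
    rwa [natCast_zsmul] at this)
  obtain ⟨s, hs⟩ := exists_sympForm_eq n (a.comp (proj n M).toAddMonoidHom)
  have hs' : ∀ x, a (proj n M x) = PadicInt.toZModPow n (sympForm x s) := hs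
  obtain ⟨u, hu⟩ := shift_divisible hM s (fun x => by
    rw [← hs']
    have : proj n M (shift n M x) = 0 := (Submodule.Quotient.mk_eq_zero _).mpr ⟨x, rfl⟩
    rw [this, map_zero])
  refine ⟨s, u, fun x => ?_, hu⟩
  rw [← ha, ← hs']
  rfl

theorem PsiRel.unique {M : Mat ℓ g} {γ : Dual (Coker n M)} {s u s' u' : Lattice ℓ g}
    (h : PsiRel n M γ s u) (h' : PsiRel n M γ s' u') : proj n M u = proj n M u' := by
  have hl : (ℓ : ℤ_[ℓ]) ^ n ≠ 0 :=
    pow_ne_zero _ (by exact_mod_cast (Fact.out : ℓ.Prime).ne_zero)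
  obtain ⟨t, ht⟩ := exists_eq_smul n (s - s') (fun x => by
    have := toQZ_injective _ (pow_pos_of_prime n) ((h.1 x).symm.trans (h'.1 x))
    have e : sympForm x (s - s') = sympForm x s - sympForm x s' := by
      rw [sub_eq_add_neg, ← neg_one_smul ℤ_[ℓ] s', sympForm_add_right, sympForm_smul_right]
      ring
    rw [e, map_sub, this, sub_self])
  have e : (ℓ : ℤ_[ℓ]) ^ n • (u - u') = (ℓ : ℤ_[ℓ]) ^ n • shift n M t := by
    rw [smul_sub, ← h.2, ← h'.2, ← map_sub, ht, map_smul]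
  have e' : u - u' = shift n M t := by
    funext k
    exact mul_left_cancel₀ hl (congrFun e k)
  rw [← sub_eq_zero, ← map_sub, e']
  exact (Submodule.Quotient.mk_eq_zero _).mpr ⟨t, rfl⟩

theorem PsiRel.add {M : Mat ℓ g} {γ γ' : Dual (Coker n M)} {s u s' u' : Lattice ℓ g}
    (h : PsiRel n M γ s u) (h' : PsiRel n M γ' s' u') :
    PsiRel n M (γ + γ') (s + s') (u + u') := by
  refine ⟨fun x => ?_, ?_⟩
  · rw [AddMonoidHom.add_apply, h.1, h'.1, sympForm_add_right, map_add, map_add]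
  · rw [map_add, h.2, h'.2, smul_add]

/-- `ψ_M : G_M^∨[ℓ^n] → G_M[ℓ^n]`: a character `α = ⟨•, α'⟩` with `α' = s/ℓ^n` a vector over `ℚ_ℓ` is
sent to the class of `(M + ℓ^n) α'`. -/
def psiM (n : ℕ) {M : Mat ℓ g} (hM : M ∈ skewSymplectic ℓ g) :
    AddSubgroup.torsionBy (Dual (Coker n M)) ((ℓ ^ n : ℕ) : ℤ) →+
      AddSubgroup.torsionBy (Coker n M) ((ℓ ^ n : ℕ) : ℤ) :=
  AddMonoidHom.mk' (fun γ => ⟨proj n M (PsiRel.exists hM γ.1 γ.2).choose_spec.choose, by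
      have h := (PsiRel.exists hM γ.1 γ.2).choose_spec.choose_spec
      change ((ℓ ^ n : ℕ) : ℤ) • proj n M _ = 0
      rw [natCast_zsmul, ← Nat.cast_smul_eq_nsmul ℤ_[ℓ], Nat.cast_pow, ← map_smul, ← h.2]
      exact (Submodule.Quotient.mk_eq_zero _).mpr ⟨_, rfl⟩⟩) (by
    intro γ γ'
    apply Subtype.ext
    have h := (PsiRel.exists hM γ.1 γ.2).choose_spec.choose_spec
    have h' := (PsiRel.exists hM γ'.1 γ'.2).choose_spec.choose_spec
    have h'' := (PsiRel.exists hM (γ + γ').1 (γ + γ').2).choose_spec.choose_spec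
    exact (PsiRel.unique h'' (h.add h')).trans (map_add _ _ _))

theorem psiM_eq {M : Mat ℓ g} (hM : M ∈ skewSymplectic ℓ g)
    (γ : AddSubgroup.torsionBy (Dual (Coker n M)) ((ℓ ^ n : ℕ) : ℤ)) {s u : Lattice ℓ g}
    (h : PsiRel n M γ.1 s u) : (psiM n hM γ : Coker n M) = proj n M u :=
  PsiRel.unique (PsiRel.exists hM γ.1 γ.2).choose_spec.choose_spec h

theorem evalPair_omegaM {M : Mat ℓ g} {m : ℕ} {a b : Coker n M →+ ZMod (ℓ ^ m)}
    {s t : Lattice ℓ g} (ha : ∀ x, a (proj n M x) = PadicInt.toZModPow m (sympForm x s))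
    (hb : ∀ x, b (proj n M x) = PadicInt.toZModPow m (sympForm x t)) :
    evalPair a b (omegaM n M) = PadicInt.toZModPow m (sympForm s t) := by
  have e : ∀ x y, evalPair a b (x ⊗ₜ[ℤ] y) = a x * b y := fun x y => rfl
  rw [omegaM, map_sum, sympForm, map_sum]
  refine Finset.sum_congr rfl fun i _ => ?_
  rw [map_sub, e, e, ha, ha, hb, hb, sympForm_eVec, sympForm_eVec, sympForm_fVec, sympForm_fVec,
    ← map_mul, ← map_mul, ← map_sub]
  congr 1
  ring

theorem psiM_compat {M : Mat ℓ g} (hM : M ∈ skewSymplectic ℓ g) (r : ℕ)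
    (a b : Coker n M →+ ZMod (ℓ ^ (n + r))) :
    toQZ (ℓ ^ (n + r)) (b (psiM n hM (scaledDual ℓ n r a))) =
      toQZ (ℓ ^ (n + r)) (a (psiM n hM (scaledDual ℓ n r b))) +
        2 • toQZ (ℓ ^ (n + r)) (evalPair a b (omegaM n M)) := by
  have hl : (ℓ : ℤ_[ℓ]) ^ n ≠ 0 :=
    pow_ne_zero _ (by exact_mod_cast (Fact.out : ℓ.Prime).ne_zero)
  have main : ∀ a : Coker n M →+ ZMod (ℓ ^ (n + r)), ∃ s u : Lattice ℓ g,
      (∀ x, a (proj n M x) = PadicInt.toZModPow (n + r) (sympForm x s)) ∧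
      PsiRel n M (scaledDual ℓ n r a).1 s u := by
    intro a
    obtain ⟨s, hs⟩ := exists_sympForm_eq (n + r) (a.comp (proj n M).toAddMonoidHom)
    have hs' : ∀ x, a (proj n M x) = PadicInt.toZModPow (n + r) (sympForm x s) := hs
    obtain ⟨u, hu⟩ := shift_divisible (n := n) hM s (fun x => by
      have h0 : proj n M (shift n M x) = 0 := (Submodule.Quotient.mk_eq_zero _).mpr ⟨x, rfl⟩
      have h1 := hs' (shift n M x)
      rw [h0, map_zero] at h1
      rw [toZModPow_eq_zero]
      exact (pow_dvd_pow _ (Nat.le_add_right n r)).trans ((toZModPow_eq_zero _ _).mp h1.symm))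
    refine ⟨s, u, hs', fun x => ?_, hu⟩
    rw [← toZModPow_add_smul n r, ← hs']
    rfl
  obtain ⟨s, u, hs, hu⟩ := main a
  obtain ⟨t, v, ht, hv⟩ := main b
  rw [psiM_eq hM _ hu, psiM_eq hM _ hv, evalPair_omegaM hs ht, hs, ht, ← map_nsmul, ← map_add]
  congr 1
  rw [nsmul_eq_mul, Nat.cast_two]
  have e := sympForm_shift (n := n) hM s t
  rw [hu.2, hv.2, sympForm_smul_left, sympForm_smul_right] at e
  have e' : sympForm u t = sympForm v s + 2 * sympForm s t := by
    apply mul_left_cancel₀ hl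
    rw [sympForm_swap v s]
    linear_combination e
  rw [e', map_add, map_mul, map_ofNat]

/-- The bilinearly enhanced group `(G_M, ω_M, ψ_M)` of a skew-symplectic matrix `M` for which
`G_M` is finite. -/
def linearBEG (n : ℕ) (hℓ : ℓ ≠ 2) (M : skewSymplectic ℓ g) (hfin : Finite (Coker n M.1)) :
    BEG ℓ n where
  carrier := Coker n M.1
  isPrimary x := (exists_pow_smul_eq_zero (ℓ := ℓ) (Coker n M.1)).imp fun _ h => h x
  ω := omegaM n M.1
  ω_mem := omegaM_mem M.1
  ω_torsion := omegaM_torsion hℓ M.2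
  ψ := psiM n M.2
  compat := psiM_compat M.2

/-- The trivial bilinearly enhanced group. -/
def trivialBEG (ℓ n : ℕ) : BEG ℓ n where
  carrier := PUnit
  isPrimary x := ⟨0, rfl⟩
  ω := 0
  ω_mem := zero_mem _
  ω_torsion := smul_zero _
  ψ := 0
  compat r a b := by
    have h : ∀ c : PUnit.{1} →+ ZMod (ℓ ^ (n + r)), c PUnit.unit = 0 := fun c => map_zero c
    simp [h]

open Classical in
/-- The isomorphism class of `(G_M, ω_M, ψ_M)`. On the set of `M` with `G_M` infinite, which is
null for the Haar measure, the value is irrelevant and set to the trivial class. -/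
def linearClass (n : ℕ) (hℓ : ℓ ≠ 2) (M : skewSymplectic ℓ g) : BEGClass ℓ n :=
  if h : Finite (Coker n M.1) then (linearBEG n hℓ M h).cls else (trivialBEG ℓ n).cls

/-- The measure `μ_g` on isomorphism classes: the law of `(G_M, ω_M, ψ_M)` for a Haar-random
skew-symplectic `2g × 2g` matrix `M`. -/
def linearMeasure (n : ℕ) (hℓ : ℓ ≠ 2) (g : ℕ) : Measure (BEGClass ℓ n) :=
  Measure.map (linearClass (g := g) n hℓ) (haarSkew ℓ g)

end Linear

end BilinEnh
end

open BilinEnh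

open scoped TensorProduct ENNReal Topology
open Filter MeasureTheory
open BilinEnh

set_option linter.unusedSectionVars false

noncomputable section

/-! A surjective morphism from G_M to Y = (G, ω, ψ) is a surjection F from the lattice ℤ_ℓ^{2g} to G
that carries ∑ e_i ∧ f_i to ω, kills the image of M + ℓ^n and matches ψ. Fix F with the first
property. Smith normal form gives a lattice basis v_i for which the ℓ^{λ_i} v_i span ker F; let b_i
be the basis dual to it under the symplectic form. A skew-symplectic M is the same as a symmetric
bilinear form ⟨M·,·⟩, so the entries ⟨M b_j, b_i⟩ with i ≤ j are independent and Haar distributed in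
ℤ_ℓ. With μ_i = min(λ_i, n), the conditions on F prescribe ⟨M b_j, b_i⟩ modulo ℓ^(λ_i+μ_j)
(`liftsMor_iff_dvd`). The axiom relating ψ and ω makes the prescriptions at (i, j) and (j, i) agree
modulo the smaller modulus (`dvd_target_sub`), so only the larger one counts. Hence F is a morphism
with probability |∧²G| / (|G|^{2g} |(Sym²G)[ℓ^n]|) (`prod_pow_expo`), while a character sum shows
that the number of such F is asymptotic to |G|^{2g} / |∧²G| (`tendsto_omegaRatio`). The product is
the limiting moment.

The entries with λ_i = λ_j = 0 remain free. Modulo ℓ they form a uniform symmetric matrix over 𝔽_ℓ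
whose corank is rank G_M - rank G (`homCard_coker`), so the moments can be refined by rank. Since
ψ_M is bijective, and a surjective morphism of equal rank between groups with bijective ψ is an
isomorphism (`injective_of_homCard_eq`), the part of the moment of Y with equal rank is |Aut Y|
times the mass of Y. A large symmetric matrix over 𝔽_ℓ is invertible with probability tending to
c_ℓ, by Möbius inversion over subspaces and an identity of Euler. This gives the limiting point
masses.

Uniqueness: a product #Surj(X, Z) · #Hom(X, 𝔽_ℓ)^d is a finite sum of numbers #Surj(X, W), so the
moments determine the mean of #Surj(X, Z) times any polynomial in ℓ^(rank X). Möbius inversion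
writes the indicator of rank X = rank Z as a series of such polynomials which converges absolutely
in mean (`integral_surjCount_rank_eq`). Among the finitely many classes of given rank killed by
ℓ^(k+1), the resulting linear system for the law of X/ℓ^(k+1) is triangular with respect to the
order of the group, hence has one solution.

Existence: the pointwise limits of the masses must keep the moments. No mass or moment escapes
(`exists_finset_setIntegral_le`): large rank is controlled by a further moment, and ℓ^k fails to
kill G_M with probability at most ℓ^(-k), uniformly in g, because of a first moment bound for
eigenvectors of M modulo ℓ^(k+1). Weak convergence then follows from Scheffé's argument. -/

namespace BilinEnh

/-! ### Torsion, duals and ranks of finite abelian groups -/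

section FiniteGroups

/-- Complex characters of a group of exponent dividing N take values in the N-th roots of unity,
which the standard character identifies with ℤ/N. So the count is that of the complex dual. -/
theorem card_hom_zmod_of_nsmul_eq_zero {B : Type*} [AddCommGroup B] [Finite B] (N : ℕ) [NeZero N]
    (h : ∀ x : B, N • x = 0) : Nat.card (B →+ ZMod N) = Nat.card B := by
  have := Fintype.ofFinite B
  rw [Nat.card_eq_fintype_card (α := B), ← AddChar.card_eq (α := B), ← Nat.card_eq_fintype_card]
  refine Nat.card_eq_of_bijective
    (fun a : B →+ ZMod N => (ZMod.stdAddChar (N := N)).compAddMonoidHom a) ⟨fun a b hab => ?_, fun χ => ?_⟩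
  · ext x
    have := DFunLike.congr_fun hab x
    exact ZMod.injective_stdAddChar this
  · have hx : ∀ x, ∃ z : ZMod N, ZMod.stdAddChar z = χ x := by
      intro x
      have h1 : χ x ^ N = 1 := by rw [← AddChar.map_nsmul_eq_pow, h, AddChar.map_zero_eq_one]
      obtain ⟨i, -, hi⟩ := (Complex.isPrimitiveRoot_exp N (NeZero.ne N)).eq_pow_of_pow_eq_one h1
      refine ⟨(i : ZMod N), ?_⟩
      rw [← hi, ← Complex.exp_nat_mul]
      have := ZMod.stdAddChar_coe (N := N) (i : ℤ)
      rw [Int.cast_natCast] at this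
      rw [this]
      congr 1
      push_cast
      ring
    choose z hz using hx
    refine ⟨⟨⟨z, ?_⟩, fun x y => ?_⟩, ?_⟩
    · apply ZMod.injective_stdAddChar
      rw [hz, AddChar.map_zero_eq_one, AddChar.map_zero_eq_one]
    · apply ZMod.injective_stdAddChar
      change ZMod.stdAddChar (z (x + y)) = ZMod.stdAddChar (z x + z y)
      rw [hz, AddChar.map_add_eq_mul, AddChar.map_add_eq_mul, hz, hz]
    · ext x
      exact hz x

theorem mem_torsionBy_natCast {B : Type*} [AddCommGroup B] {N : ℕ} {x : B} :
    x ∈ AddSubgroup.torsionBy B (N : ℤ) ↔ N • x = 0 := by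
  change (N : ℤ) • x = 0 ↔ _
  rw [natCast_zsmul]

/-- The kernel and the cokernel of multiplication by N have the same order, and homomorphisms to ℤ/N
are those of the cokernel. -/
theorem card_torsionBy_eq_card_hom (B : Type*) [AddCommGroup B] [Finite B] (N : ℕ) [NeZero N] :
    Nat.card (AddSubgroup.torsionBy B (N : ℤ)) = Nat.card (B →+ ZMod N) := by
  let f : B →+ B := nsmulAddMonoidHom N
  have hker : f.ker = AddSubgroup.torsionBy B (N : ℤ) := by
    ext x
    rw [mem_torsionBy_natCast]
    rfl
  have h1 : Nat.card (B ⧸ f.range) = Nat.card f.ker := by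
    have e1 := AddSubgroup.card_eq_card_quotient_mul_card_addSubgroup f.range
    have e2 := AddSubgroup.card_eq_card_quotient_mul_card_addSubgroup f.ker
    rw [Nat.card_congr (QuotientAddGroup.quotientKerEquivRange f).toEquiv] at e2
    have : 0 < Nat.card f.range := Nat.card_pos
    have e3 := e1.symm.trans e2
    rw [mul_comm] at e3
    exact Nat.eq_of_mul_eq_mul_left this e3
  rw [← hker, ← h1, ← card_hom_zmod_of_nsmul_eq_zero N]
  · refine Nat.card_congr ⟨fun a => a.comp (QuotientAddGroup.mk' _), fun a =>
      QuotientAddGroup.lift _ a ?_, fun a => ?_, fun a => ?_⟩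
    · rintro _ ⟨y, rfl⟩
      change a (N • y) = 0
      rw [map_nsmul, nsmul_eq_mul, ZMod.natCast_self, zero_mul]
    · ext x; rfl
    · ext x; rfl
  · intro x
    induction x using QuotientAddGroup.induction_on with
    | H x =>
      rw [← QuotientAddGroup.mk_nsmul, QuotientAddGroup.eq_zero_iff]
      exact ⟨x, rfl⟩

/-- The number of homomorphisms `X → 𝔽_ℓ`, that is, `ℓ` to the rank of `X`. -/
def homCard (ℓ : ℕ) (X : Type*) [AddCommGroup X] : ℕ := Nat.card (X →+ ZMod ℓ)

variable {ℓ : ℕ} [Fact ℓ.Prime]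

theorem prime_pos : 0 < ℓ := (Fact.out : ℓ.Prime).pos

instance finite_hom {X B : Type*} [AddCommGroup X] [AddCommGroup B] [Finite X] [Finite B] :
    Finite (X →+ B) := DFunLike.finite _

theorem homCard_pos (X : Type*) [AddCommGroup X] [Finite X] : 0 < homCard ℓ X := Nat.card_pos

theorem exists_homCard_eq_pow (X : Type*) [AddCommGroup X] [Finite X] : ∃ w, homCard ℓ X = ℓ ^ w := by
  have h : IsPGroup ℓ (Multiplicative (X →+ ZMod ℓ)) := by
    intro a
    refine ⟨1, ?_⟩
    rw [pow_one]
    apply Multiplicative.toAdd.injective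
    ext x
    change ℓ • (Multiplicative.toAdd a) x = 0
    rw [nsmul_eq_mul, ZMod.natCast_self, zero_mul]
  obtain ⟨w, hw⟩ := IsPGroup.iff_card.mp h
  exact ⟨w, hw⟩

theorem comp_injective_of_surjective {X Y B : Type*} [AddCommGroup X] [AddCommGroup Y]
    [AddCommGroup B] (f : X →+ Y) (hf : Function.Surjective f) :
    Function.Injective (fun a : Y →+ B => a.comp f) := by
  intro a b h
  ext y
  obtain ⟨x, rfl⟩ := hf y
  exact DFunLike.congr_fun h x

theorem homCard_le {X Y : Type*} [AddCommGroup X] [AddCommGroup Y] [Finite X] (f : X →+ Y)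
    (hf : Function.Surjective f) : homCard ℓ Y ≤ homCard ℓ X :=
  Nat.card_le_card_of_injective _ (comp_injective_of_surjective f hf)

theorem exists_comp_eq_of_homCard_eq {X Y : Type*} [AddCommGroup X] [AddCommGroup Y] [Finite X]
    [Finite Y] (f : X →+ Y) (hf : Function.Surjective f) (h : homCard ℓ X = homCard ℓ Y)
    (a : X →+ ZMod ℓ) : ∃ b : Y →+ ZMod ℓ, b.comp f = a := by
  have := Fintype.ofFinite (X →+ ZMod ℓ)
  have := Fintype.ofFinite (Y →+ ZMod ℓ)
  exact ((Fintype.bijective_iff_injective_and_card _).mpr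
    ⟨comp_injective_of_surjective (B := ZMod ℓ) f hf, by
      simpa [homCard, Nat.card_eq_fintype_card] using h.symm⟩).2 a

/-- Multiplication by ℓ^k maps X[ℓ^(k+1)] to X[ℓ] with kernel X[ℓ^k]; induct on k. -/
theorem card_torsionBy_pow_le (X : Type*) [AddCommGroup X] [Finite X] (k : ℕ) :
    Nat.card (AddSubgroup.torsionBy X ((ℓ ^ k : ℕ) : ℤ)) ≤ homCard ℓ X ^ k := by
  induction k with
  | zero =>
    have : Subsingleton (AddSubgroup.torsionBy X ((ℓ ^ 0 : ℕ) : ℤ)) := by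
      refine ⟨fun x y => Subtype.ext ?_⟩
      have h : ∀ z : X, ℓ ^ 0 • z = z := fun z => by rw [pow_zero, one_nsmul]
      rw [← h x, ← h y, mem_torsionBy_natCast.mp x.2, mem_torsionBy_natCast.mp y.2]
    simp
  | succ k ih =>
    let f : AddSubgroup.torsionBy X ((ℓ ^ (k + 1) : ℕ) : ℤ) →+ AddSubgroup.torsionBy X (ℓ : ℤ) :=
      AddMonoidHom.codRestrict ((nsmulAddMonoidHom (ℓ ^ k)).comp (AddSubgroup.subtype _)) _ (by
        intro x
        rw [mem_torsionBy_natCast]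
        change ℓ • (ℓ ^ k • (x : X)) = 0
        rw [smul_smul, ← pow_succ']
        exact mem_torsionBy_natCast.mp x.2)
    have hk : Nat.card f.ker ≤ Nat.card (AddSubgroup.torsionBy X ((ℓ ^ k : ℕ) : ℤ)) := by
      refine Nat.card_le_card_of_injective
        (fun x => (⟨(x.1 : X), ?_⟩ : AddSubgroup.torsionBy X ((ℓ ^ k : ℕ) : ℤ))) ?_
      · rw [mem_torsionBy_natCast]
        have := x.2
        rw [AddMonoidHom.mem_ker] at this
        exact congrArg Subtype.val this
      · intro x y h
        apply Subtype.ext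
        apply Subtype.ext
        exact congrArg (fun z => (z.1 : X)) h
    refine (AddSubgroup.card_eq_card_quotient_mul_card_addSubgroup f.ker).trans_le ?_
    rw [pow_succ' (homCard ℓ X),
      Nat.card_congr (QuotientAddGroup.quotientKerEquivRange f).toEquiv]
    refine Nat.mul_le_mul ?_ (hk.trans ih)
    refine (Nat.card_le_card_of_injective _ (AddSubgroup.subtype_injective f.range)).trans ?_
    rw [card_torsionBy_eq_card_hom X ℓ]
    rfl

theorem card_le_homCard_pow (X : Type*) [AddCommGroup X] [Finite X] (k : ℕ)
    (h : ∀ x : X, ℓ ^ k • x = 0) : Nat.card X ≤ homCard ℓ X ^ k := by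
  refine le_trans (Nat.card_le_card_of_injective (fun x => (⟨x, mem_torsionBy_natCast.mpr (h x)⟩ :
    AddSubgroup.torsionBy X ((ℓ ^ k : ℕ) : ℤ))) ?_) (card_torsionBy_pow_le X k)
  intro x y h
  exact congrArg Subtype.val h

theorem homCard_pow (X : Type*) [AddCommGroup X] (d : ℕ) :
    Nat.card (X →+ (Fin d → ZMod ℓ)) = homCard ℓ X ^ d := by
  rw [Nat.card_congr (β := Fin d → (X →+ ZMod ℓ))
    ⟨fun a i => (Pi.evalAddMonoidHom _ i).comp a, fun a => AddMonoidHom.pi a, fun a => rfl,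
      fun a => rfl⟩, Nat.card_fun, Nat.card_fin, homCard]

/-- In a finite abelian `ℓ`-group, `ℓ^k X ⊆ ℓ^(k+1) X` forces `ℓ^k X = 0`. -/
theorem pow_smul_eq_zero_of_forall_exists {X : Type*} [AddCommGroup X] [Finite X]
    (hX : ∀ x : X, ∃ k : ℕ, ℓ ^ k • x = 0) (k : ℕ) (h : ∀ x : X, ∃ y : X, ℓ ^ k • x = ℓ ^ (k + 1) • y)
    (x : X) : ℓ ^ k • x = 0 := by
  have step : ∀ j (x : X), ∃ y : X, ℓ ^ k • x = ℓ ^ (k + j) • y := by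
    intro j
    induction j with
    | zero => exact fun x => ⟨x, rfl⟩
    | succ j ih =>
      intro x
      obtain ⟨y, hy⟩ := ih x
      obtain ⟨z, hz⟩ := h y
      refine ⟨z, ?_⟩
      rw [hy, pow_add, mul_comm, mul_smul, hz, smul_smul]
      congr 1
      ring
  have := Fintype.ofFinite X
  choose e he using hX
  obtain ⟨y, hy⟩ := step (Finset.univ.sup e) x
  rw [hy, add_comm, pow_add, mul_comm, mul_smul]
  have hle : e y ≤ Finset.univ.sup e := Finset.le_sup (Finset.mem_univ y)
  have : ℓ ^ (Finset.univ.sup e) • y = 0 := by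
    rw [← Nat.sub_add_cancel hle, pow_add, mul_smul, he, smul_zero]
  rw [this, smul_zero]

theorem exists_uniform_pow_smul {X : Type*} [AddCommGroup X] [Finite X]
    (hX : ∀ x : X, ∃ k : ℕ, ℓ ^ k • x = 0) : ∃ k : ℕ, ∀ x : X, ℓ ^ k • x = 0 := by
  have := Fintype.ofFinite X
  choose e he using hX
  refine ⟨Finset.univ.sup e, fun y => ?_⟩
  have hle : e y ≤ Finset.univ.sup e := Finset.le_sup (Finset.mem_univ y)
  rw [← Nat.sub_add_cancel hle, pow_add, mul_smul, he, smul_zero]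

end FiniteGroups

/-! ### Push-forward of enhancements, counts of surjections, products of moments -/

section Structures

variable {ℓ n : ℕ}

/-- The enhancements `(ω, ψ)` of a fixed group. -/
@[ext]
structure Enh (ℓ n : ℕ) (A : Type) [AddCommGroup A] where
  ω : A ⊗[ℤ] A
  ψ : AddSubgroup.torsionBy (Dual A) ((ℓ ^ n : ℕ) : ℤ) →+
    AddSubgroup.torsionBy A ((ℓ ^ n : ℕ) : ℤ)
  ω_mem : ω ∈ wedgeSq A
  ω_torsion : ℓ ^ n • ω = 0
  compat : ∀ (r : ℕ) (a b : A →+ ZMod (ℓ ^ (n + r))),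
    toQZ (ℓ ^ (n + r)) (b (ψ (scaledDual ℓ n r a))) =
      toQZ (ℓ ^ (n + r)) (a (ψ (scaledDual ℓ n r b))) +
        2 • toQZ (ℓ ^ (n + r)) (evalPair a b ω)

/-- `A` with a given enhancement. -/
def Enh.toBEG {A : Type} [AddCommGroup A] [Finite A] (hA : ∀ x : A, ∃ k : ℕ, ℓ ^ k • x = 0)
    (S : Enh ℓ n A) : BEG ℓ n where
  carrier := A
  isPrimary := hA
  ω := S.ω
  ω_mem := S.ω_mem
  ω_torsion := S.ω_torsion
  ψ := S.ψ
  compat := S.compat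

/-- The enhancement of a bilinearly enhanced group. -/
def BEG.enh (X : BEG ℓ n) : Enh ℓ n X.carrier where
  ω := X.ω
  ω_mem := X.ω_mem
  ω_torsion := X.ω_torsion
  ψ := X.ψ
  compat := X.compat

variable {A B : Type} [AddCommGroup A] [AddCommGroup B]

theorem evalPair_map {N : ℕ} (f : A →+ B) (a b : B →+ ZMod N) (t : A ⊗[ℤ] A) :
    evalPair a b (TensorProduct.map f.toIntLinearMap f.toIntLinearMap t) =
      evalPair (a.comp f) (b.comp f) t := by
  induction t using TensorProduct.induction_on with
  | zero => simp only [map_zero]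
  | tmul x y => rfl
  | add x y hx hy => simp only [map_add, hx, hy]

theorem tensorMap_comp {A B C : Type*} [AddCommGroup A] [AddCommGroup B] [AddCommGroup C]
    (f : A →+ B) (g : B →+ C) (t : A ⊗[ℤ] A) :
    TensorProduct.map g.toIntLinearMap g.toIntLinearMap
        (TensorProduct.map f.toIntLinearMap f.toIntLinearMap t) =
      TensorProduct.map (g.comp f).toIntLinearMap (g.comp f).toIntLinearMap t := by
  induction t using TensorProduct.induction_on with
  | zero => simp only [map_zero]
  | tmul x y => rfl
  | add x y hx hy => simp only [map_add, hx, hy]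

theorem map_mem_wedgeSq (f : A →+ B) {t : A ⊗[ℤ] A} (ht : t ∈ wedgeSq A) :
    TensorProduct.map f.toIntLinearMap f.toIntLinearMap t ∈ wedgeSq B := by
  induction ht using AddSubgroup.closure_induction with
  | mem x hx =>
    obtain ⟨x, y, rfl⟩ := hx
    exact AddSubgroup.subset_closure ⟨f x, f y, by simp⟩
  | zero => rw [map_zero]; exact zero_mem _
  | add x y _ _ hx hy => rw [map_add]; exact add_mem hx hy
  | neg x _ hx => rw [map_neg]; exact neg_mem hx

/-- Push-forward of an enhancement. -/
def Enh.push (S : Enh ℓ n A) (f : A →+ B) : Enh ℓ n B where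
  ω := TensorProduct.map f.toIntLinearMap f.toIntLinearMap S.ω
  ω_mem := map_mem_wedgeSq f S.ω_mem
  ω_torsion := by rw [← map_nsmul, S.ω_torsion, map_zero]
  ψ := AddMonoidHom.mk' (fun γ => ⟨f (S.ψ (pullDual f γ)), by
      rw [mem_torsionBy_natCast, ← map_nsmul, mem_torsionBy_natCast.mp (S.ψ (pullDual f γ)).2,
        map_zero]⟩) (fun γ δ => by
      apply Subtype.ext
      change f (S.ψ (pullDual f γ + pullDual f δ)) = _
      rw [map_add]
      exact map_add f _ _)
  compat r a b := by
    rw [evalPair_map]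
    exact S.compat r (a.comp f) (b.comp f)

/-- A homomorphism out of X is thus a morphism for exactly one enhancement of its target. This lets
surjections be sorted by their image subgroup. -/
theorem isMor_iff {X Y : BEG ℓ n} {f : X.carrier →+ Y.carrier} :
    IsMor X Y f ↔ X.enh.push f = Y.enh := by
  rw [Enh.ext_iff]
  refine and_congr Iff.rfl ?_
  rw [DFunLike.ext_iff]
  exact forall_congr' fun γ => (Subtype.ext_iff (a1 := (X.enh.push f).ψ γ)).symm

theorem tensor_smul_eq_zero {R M N : Type*} [CommRing R] [AddCommGroup M] [AddCommGroup N]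
    [Module R M] [Module R N] (r : R) (h : ∀ m : M, r • m = 0) (x : M ⊗[R] N) : r • x = 0 := by
  induction x using TensorProduct.induction_on with
  | zero => rw [smul_zero]
  | tmul x y => rw [TensorProduct.smul_tmul', h, TensorProduct.zero_tmul]
  | add x y hx hy => rw [smul_add, hx, hy, add_zero]

instance finite_tensor {A B : Type*} [AddCommGroup A] [AddCommGroup B] [Finite A] [Finite B] :
    Finite (A ⊗[ℤ] B) := by
  have : Module.Finite ℤ A := Module.Finite.of_finite
  have : Module.Finite ℤ B := Module.Finite.of_finite
  refine @Module.finite_of_fg_torsion (A ⊗[ℤ] B) _ TensorProduct.instModule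
    (Module.Finite.tensorProduct ℤ A B) (fun {x} => ?_)
  exact ⟨⟨Nat.card A, mem_nonZeroDivisors_of_ne_zero (by exact_mod_cast Nat.card_pos.ne')⟩,
    tensor_smul_eq_zero (Nat.card A : ℤ) (fun m => by rw [natCast_zsmul, card_nsmul_eq_zero']) x⟩

theorem finite_dual_torsion [Fact ℓ.Prime] [Finite A] :
    Finite (AddSubgroup.torsionBy (Dual A) ((ℓ ^ n : ℕ) : ℤ)) := by
  refine Finite.of_surjective (fun a : A →+ ZMod (ℓ ^ n) =>
    (⟨(toQZ (ℓ ^ n)).comp a, ?_⟩ : AddSubgroup.torsionBy (Dual A) ((ℓ ^ n : ℕ) : ℤ))) ?_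
  · rw [mem_torsionBy_natCast]
    ext x
    change ℓ ^ n • toQZ _ (a x) = 0
    rw [← map_nsmul, nsmul_eq_mul, ZMod.natCast_self, zero_mul, map_zero]
  · intro γ
    obtain ⟨a, ha⟩ := exists_hom_zmod (ℓ ^ n) (pow_pos prime_pos n) γ.1 (fun x =>
      DFunLike.congr_fun (mem_torsionBy_natCast.mp γ.2) x)
    exact ⟨a, Subtype.ext ha⟩

instance [Fact ℓ.Prime] [Finite A] : Finite (Enh ℓ n A) := by
  have := finite_dual_torsion (ℓ := ℓ) (n := n) (A := A)
  refine Finite.of_injective (fun S : Enh ℓ n A => (S.ω, S.ψ)) ?_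
  intro S T h
  exact Enh.ext (congrArg Prod.fst h) (congrArg Prod.snd h)

instance {X Y : BEG ℓ n} : Finite (Surj X Y) := by
  have : Finite (X.carrier →+ Y.carrier) := DFunLike.finite _
  exact Subtype.finite

instance {X Y : BEG ℓ n} : Finite (Iso X Y) := by
  have : Finite (X.carrier ≃+ Y.carrier) := DFunLike.finite _
  exact Subtype.finite

theorem cls_out (c : BEGClass ℓ n) : (Quotient.out c).cls = c := Quotient.out_eq c

theorem cls_eq_cls {X Y : BEG ℓ n} : X.cls = Y.cls ↔ Nonempty (Iso X Y) := Quotient.eq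

theorem surjCount_cls (X Y : BEG ℓ n) : surjCount X.cls Y = Nat.card (Surj X Y) := rfl

/-- A bijective morphism is an isomorphism. -/
def Iso.ofBijective {X Y : BEG ℓ n} (f : X.carrier →+ Y.carrier) (h : IsMor X Y f)
    (hf : Function.Bijective f) : Iso X Y :=
  ⟨AddEquiv.ofBijective f hf, h⟩

theorem card_surj_of_card_eq {X Y : BEG ℓ n} (h : Nat.card X.carrier = Nat.card Y.carrier) :
    Nat.card (Surj X Y) = Nat.card (Iso X Y) := by
  have hb : ∀ f : Surj X Y, Function.Bijective f.1 := fun f =>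
    (Nat.bijective_iff_surjective_and_card _).mpr ⟨f.2.2, h⟩
  refine Nat.card_congr ⟨fun f => Iso.ofBijective f.1 f.2.1 (hb f), fun e =>
    ⟨e.1.toAddMonoidHom, e.2, e.1.surjective⟩, fun f => rfl, fun e => ?_⟩
  apply Subtype.ext
  ext x
  rfl

theorem card_le_of_surj {X Y : BEG ℓ n} (f : Surj X Y) :
    Nat.card Y.carrier ≤ Nat.card X.carrier := Nat.card_le_card_of_surjective _ f.2.2

theorem card_iso_congr {X X' Y : BEG ℓ n} (e : Iso X X') :
    Nat.card (Iso X Y) = Nat.card (Iso X' Y) :=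
  Nat.card_congr ⟨fun f => e.symm.trans f, fun f => e.trans f,
    fun f => by apply Subtype.ext; ext x; simp [Iso.trans, Iso.symm],
    fun f => by apply Subtype.ext; ext x; simp [Iso.trans, Iso.symm]⟩

theorem cardAut_pos (Y : BEG ℓ n) : 0 < cardAut Y := by
  have : Nonempty (Iso Y Y) := ⟨Iso.refl Y⟩
  exact Nat.card_pos

/-- The order of the groups in an isomorphism class. -/
def classCard (c : BEGClass ℓ n) : ℕ :=
  Quotient.lift (fun X : BEG ℓ n => Nat.card X.carrier)
    (fun _ _ h => Nonempty.elim h fun e => Nat.card_congr e.1.toEquiv) c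

/-- `ℓ` to the rank of the groups in an isomorphism class. -/
def rankCard (c : BEGClass ℓ n) : ℕ :=
  Quotient.lift (fun X : BEG ℓ n => homCard ℓ X.carrier)
    (fun _ _ h => Nonempty.elim h fun e => Nat.card_congr
      ⟨fun a => a.comp e.1.symm.toAddMonoidHom, fun a => a.comp e.1.toAddMonoidHom,
        fun a => by ext; simp, fun a => by ext; simp⟩) c

theorem classCard_cls (X : BEG ℓ n) : classCard X.cls = Nat.card X.carrier := rfl

theorem rankCard_cls (X : BEG ℓ n) : rankCard X.cls = homCard ℓ X.carrier := rfl

/-- A surjection between finite groups of equal order is bijective. This is the diagonal of the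
triangular system behind uniqueness. -/
theorem surjCount_eq_ite_of_classCard_eq (c : BEGClass ℓ n) (Y : BEG ℓ n)
    (h : classCard c = Nat.card Y.carrier) [Decidable (c = Y.cls)] :
    surjCount c Y = if c = Y.cls then cardAut Y else 0 := by
  obtain ⟨X, rfl⟩ : ∃ X : BEG ℓ n, X.cls = c := ⟨_, cls_out c⟩
  · rw [surjCount_cls, card_surj_of_card_eq h]
    split_ifs with hc
    · obtain ⟨e⟩ := cls_eq_cls.mp hc
      exact card_iso_congr e
    · have : IsEmpty (Iso X Y) := ⟨fun e => hc (cls_eq_cls.mpr ⟨e⟩)⟩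
      exact Nat.card_of_isEmpty

theorem classCard_le_of_surjCount_ne_zero {c : BEGClass ℓ n} {Y : BEG ℓ n}
    (h : surjCount c Y ≠ 0) : Nat.card Y.carrier ≤ classCard c := by
  induction c using Quotient.inductionOn with
  | h X =>
    have : Nonempty (Surj X Y) := (Nat.card_ne_zero.mp h).1
    exact card_le_of_surj this.some

section Prime

variable [Fact ℓ.Prime]

theorem exists_rankCard_eq_mul_pow {c : BEGClass ℓ n} {Y : BEG ℓ n} (h : surjCount c Y ≠ 0) :
    ∃ w, rankCard c = homCard ℓ Y.carrier * ℓ ^ w := by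
  induction c using Quotient.inductionOn with
  | h X =>
    have : Nonempty (Surj X Y) := (Nat.card_ne_zero.mp h).1
    have hle := homCard_le (ℓ := ℓ) this.some.1 this.some.2.2
    change ∃ w, homCard ℓ X.carrier = _
    obtain ⟨a, ha⟩ := exists_homCard_eq_pow (ℓ := ℓ) X.carrier
    obtain ⟨b, hb⟩ := exists_homCard_eq_pow (ℓ := ℓ) Y.carrier
    rw [ha, hb] at hle ⊢
    have := (Nat.pow_le_pow_iff_right (Fact.out : ℓ.Prime).one_lt).mp hle
    exact ⟨a - b, by rw [← pow_add]; congr 1; omega⟩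

/-- The product `#Surj(X, Z) · #Hom(X, B)` is a sum of numbers of surjections. -/
theorem exists_surjCount_mul_card_hom (Z : BEG ℓ n) (B : Type) [AddCommGroup B] [Finite B]
    (hB : ∀ x : B, ∃ k : ℕ, ℓ ^ k • x = 0) :
    ∃ (I : Type) (_ : Fintype I) (W : I → BEG ℓ n), ∀ X : BEG ℓ n,
      Nat.card (Surj X Z) * Nat.card (X.carrier →+ B) = ∑ i, Nat.card (Surj X (W i)) := by
  have hZB : ∀ (H : AddSubgroup (Z.carrier × B)) (x : H), ∃ k : ℕ, ℓ ^ k • x = 0 := by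
    rintro H ⟨⟨z, b⟩, hx⟩
    obtain ⟨k, hk⟩ := Z.isPrimary z
    obtain ⟨m, hm⟩ := hB b
    refine ⟨k + m, Subtype.ext (Prod.ext ?_ ?_)⟩
    · change ℓ ^ (k + m) • z = 0
      rw [add_comm, pow_add, mul_smul, hk, smul_zero]
    · change ℓ ^ (k + m) • b = 0
      rw [pow_add, mul_smul, hm, smul_zero]
  -- A pair (f, φ) is a homomorphism to Z × B. It is recorded by its image H and the structure
  -- pushed forward to H, for which the first projection is a surjective morphism to Z.
  let I := Σ H : AddSubgroup (Z.carrier × B), {S : Enh ℓ n H //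
    IsMor (S.toBEG (hZB H)) Z ((AddMonoidHom.fst _ _).comp H.subtype) ∧
      Function.Surjective ((AddMonoidHom.fst Z.carrier B).comp H.subtype)}
  have hI : Fintype I := Fintype.ofFinite I
  refine ⟨I, hI, fun i => i.2.1.toBEG (hZB i.1), fun X => ?_⟩
  have hfin : Finite (X.carrier →+ B) := DFunLike.finite _
  rw [← Nat.card_prod, ← Nat.card_sigma]
  symm
  refine Nat.card_eq_of_bijective (fun p : Σ i : I, Surj X (i.2.1.toBEG (hZB i.1)) =>
    ((⟨((AddMonoidHom.fst _ _).comp p.1.1.subtype).comp p.2.1, p.1.2.2.1.comp p.2.2.1,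
      p.1.2.2.2.comp p.2.2.2⟩ : Surj X Z),
      ((AddMonoidHom.snd _ _).comp p.1.1.subtype).comp p.2.1)) ⟨?_, ?_⟩
  · rintro ⟨⟨H, S, hS⟩, k, hk⟩ ⟨⟨H', S', hS'⟩, k', hk'⟩ h
    change X.carrier →+ H at k
    change X.carrier →+ H' at k'
    have hkk : ∀ x, (k x : Z.carrier × B) = k' x := fun x => Prod.ext
      (DFunLike.congr_fun (congrArg (fun q => q.1.1) h) x)
      (DFunLike.congr_fun (congrArg (fun q => q.2) h) x)
    have hH : H = H' := by
      ext y
      constructor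
      · intro hy
        obtain ⟨x, hx⟩ := hk.2 ⟨y, hy⟩
        have : (k x : Z.carrier × B) = y := congrArg Subtype.val hx
        rw [← this, hkk]
        exact (k' x).2
      · intro hy
        obtain ⟨x, hx⟩ := hk'.2 ⟨y, hy⟩
        have : (k' x : Z.carrier × B) = y := congrArg Subtype.val hx
        rw [← this, ← hkk]
        exact (k x).2
    subst hH
    have hk2 : k = k' := by
      ext x : 1
      exact Subtype.ext (hkk x)
    subst hk2
    have hS2 : S = S' := (isMor_iff.mp hk.1).symm.trans (isMor_iff.mp hk'.1)
    subst hS2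
    rfl
  -- Conversely (f, φ) comes from its corestriction to the image, with the push-forward structure
  -- there.
  · rintro ⟨⟨f, hf⟩, φ⟩
    let k := (f.prod φ).rangeRestrict
    have hk : Function.Surjective k := AddMonoidHom.rangeRestrict_surjective _
    have hfst : ((AddMonoidHom.fst Z.carrier B).comp (f.prod φ).range.subtype).comp k = f := rfl
    refine ⟨⟨⟨(f.prod φ).range, X.enh.push k, ?_, ?_⟩, ⟨k, isMor_iff.mpr rfl, hk⟩⟩, rfl⟩
    · refine ⟨?_, fun γ => ?_⟩
      · refine Eq.trans ?_ hf.1.1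
        exact tensorMap_comp k _ X.ω
      · exact hf.1.2 γ
    · intro z
      obtain ⟨x, hx⟩ := hf.2 z
      exact ⟨k x, hx⟩

/-- A surjective morphism of equal ranks between bilinearly enhanced groups with bijective `ψ` is
injective. -/
theorem injective_of_homCard_eq (hn : 0 < n) {X Y : BEG ℓ n} (f : Surj X Y)
    (hX : Function.Bijective X.ψ) (hY : Function.Bijective Y.ψ)
    (h : homCard ℓ X.carrier = homCard ℓ Y.carrier) : Function.Injective f.1 := by
  -- The kernel meets the socle trivially. Write x = ψ_X(γ). Then γ is killed by ℓ, and by equality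
  -- of ranks it is the pullback of a character δ of Y; since ψ_Y(δ) = f(x) = 0, both δ and γ
  -- vanish. Positivity of n puts the socle inside the ℓ^n-torsion.
  have key : ∀ x : X.carrier, ℓ • x = 0 → f.1 x = 0 → x = 0 := by
    intro x hx hfx
    have hℓn : ℓ ^ n = ℓ ^ (n - 1) * ℓ := by rw [← pow_succ]; congr 1; omega
    obtain ⟨γ, hγ⟩ := hX.2 ⟨x, by rw [mem_torsionBy_natCast, hℓn, mul_smul, hx, smul_zero]⟩
    have hγ' : (X.ψ γ : X.carrier) = x := congrArg Subtype.val hγ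
    have h0 : ℓ • γ = 0 := by
      apply hX.1
      apply Subtype.ext
      rw [map_nsmul, map_zero]
      change ℓ • (X.ψ γ : X.carrier) = 0
      rw [hγ', hx]
    obtain ⟨a, ha⟩ := exists_hom_zmod ℓ prime_pos γ.1 (fun y =>
      DFunLike.congr_fun (congrArg Subtype.val h0) y)
    obtain ⟨b, hb⟩ := exists_comp_eq_of_homCard_eq f.1 f.2.2 h a
    let δ : AddSubgroup.torsionBy (Dual Y.carrier) ((ℓ ^ n : ℕ) : ℤ) := ⟨(toQZ ℓ).comp b, by
      rw [mem_torsionBy_natCast]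
      ext y
      change ℓ ^ n • toQZ ℓ (b y) = 0
      rw [hℓn, mul_smul, ← map_nsmul, nsmul_eq_mul, ZMod.natCast_self, zero_mul, map_zero,
        smul_zero]⟩
    have hδ : pullDual f.1 δ = γ := by
      apply Subtype.ext
      rw [← ha, ← hb]
      rfl
    have hm := f.2.1.2 δ
    rw [hδ, hγ', hfx] at hm
    have hδ0 : δ = 0 := hY.1 (by rw [map_zero]; exact Subtype.ext hm.symm)
    have hγ0 : γ = 0 := by
      rw [← hδ, hδ0]
      rfl
    rw [← hγ', hγ0, map_zero]
    rfl
  rw [injective_iff_map_eq_zero]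
  intro x hx
  obtain ⟨k, hk⟩ := X.isPrimary x
  induction k with
  | zero => simpa using hk
  | succ k ih =>
    apply ih
    apply key
    · rw [smul_smul, ← pow_succ']
      exact hk
    · rw [map_nsmul, hx, smul_zero]

/-- The property that `ψ` is bijective, on isomorphism classes. -/
def psiBijective (c : BEGClass ℓ n) : Prop := ∃ X : BEG ℓ n, X.cls = c ∧ Function.Bijective X.ψ

theorem bijective_psi_of_iso {X Y : BEG ℓ n} (e : Iso X Y) (h : Function.Bijective X.ψ) :
    Function.Bijective Y.ψ := by
  have hm := e.2.2
  have hpull : ∀ γ, pullDual (N := ℓ ^ n) e.symm.1.toAddMonoidHom (pullDual e.1.toAddMonoidHom γ) = γ := by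
    intro γ
    apply Subtype.ext
    ext x
    simp [pullDual, Iso.symm]
  have hpull' : ∀ γ, pullDual (N := ℓ ^ n) e.1.toAddMonoidHom (pullDual e.symm.1.toAddMonoidHom γ) = γ := by
    intro γ
    apply Subtype.ext
    ext x
    simp [pullDual, Iso.symm]
  constructor
  · intro γ δ hγ
    have h1 := (hm γ).trans ((congrArg Subtype.val hγ).trans (hm δ).symm)
    have h2 := h.1 (Subtype.ext (e.1.injective h1))
    rw [← hpull γ, h2, hpull]
  · intro y
    obtain ⟨γ, hγ⟩ := h.2 ⟨e.1.symm y, by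
      rw [mem_torsionBy_natCast, ← map_nsmul, mem_torsionBy_natCast.mp y.2, map_zero]⟩
    refine ⟨pullDual e.symm.1.toAddMonoidHom γ, Subtype.ext ?_⟩
    have := hm (pullDual e.symm.1.toAddMonoidHom γ)
    rw [hpull', hγ] at this
    rw [← this]
    exact e.1.apply_symm_apply _

theorem psiBijective_cls {X : BEG ℓ n} : psiBijective X.cls ↔ Function.Bijective X.ψ := by
  constructor
  · rintro ⟨Y, hY, h⟩
    obtain ⟨e⟩ := cls_eq_cls.mp hY
    exact bijective_psi_of_iso e h
  · exact fun h => ⟨X, rfl, h⟩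

/-- On classes with bijective ψ, restricting a surjection count to equal rank isolates one class.
This is how a point mass is read off a moment. -/
theorem surjCount_ite_rankCard (hn : 0 < n) (c : BEGClass ℓ n) (Y : BEG ℓ n) (hc : psiBijective c)
    (hY : Function.Bijective Y.ψ) [Decidable (c = Y.cls)]
    [Decidable (rankCard c = homCard ℓ Y.carrier)] :
    (if rankCard c = homCard ℓ Y.carrier then surjCount c Y else 0) =
      if c = Y.cls then cardAut Y else 0 := by
  by_cases h : c = Y.cls
  · rw [if_pos h, if_pos (by rw [h, rankCard_cls])]
    classical
    rw [surjCount_eq_ite_of_classCard_eq c Y (by rw [h, classCard_cls]), if_pos h]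
  · rw [if_neg h]
    split_ifs with hr
    · obtain ⟨X, rfl, hX⟩ := hc
      have : IsEmpty (Surj X Y) := ⟨fun f => h (cls_eq_cls.mpr
        ⟨Iso.ofBijective f.1 f.2.1 ⟨injective_of_homCard_eq hn f hX hY hr, f.2.2⟩⟩)⟩
      exact Nat.card_of_isEmpty
    · rfl

end Prime

end Structures

/-! ### Finiteness of the sets of classes, and truncation modulo ℓ^k -/

section Truncation

variable {ℓ n : ℕ} [Fact ℓ.Prime]

/-- The isomorphism from `X` to the push-forward of its structure along an isomorphism. -/
theorem nonempty_iso_push (X : BEG ℓ n) {A : Type} [AddCommGroup A] [Finite A]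
    (e : X.carrier ≃+ A) (hA : ∀ x : A, ∃ k : ℕ, ℓ ^ k • x = 0) :
    Nonempty (Iso X ((X.enh.push e.toAddMonoidHom).toBEG hA)) :=
  ⟨⟨e, isMor_iff.mpr rfl⟩⟩

theorem finite_addCommGroup (α : Type) [Finite α] : Finite (AddCommGroup α) := by
  refine Finite.of_injective (fun i : AddCommGroup α => i.toAdd.add) ?_
  intro i j h
  exact AddCommGroup.ext (by exact h)

/-- Every class of this order has a representative on the underlying set α, and there are finitely
many group laws on α and enhancements of each. -/
theorem finite_classCard_eq_card (α : Type) [Finite α] :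
    {c : BEGClass ℓ n | classCard c = Nat.card α}.Finite := by
  classical
  have := finite_addCommGroup α
  let J := Σ inst : AddCommGroup α, @Enh ℓ n α inst
  let F : J → BEGClass ℓ n := fun j =>
    letI := j.1
    -- The value at group laws that are not ℓ-primary is arbitrary: only the finiteness of the range
    -- matters.
    if h : ∀ x : α, ∃ k : ℕ, ℓ ^ k • x = 0 then (j.2.toBEG h).cls else (trivialBEG ℓ n).cls
  have : Finite J := inferInstance
  refine (Set.finite_range F).subset ?_
  intro c hc
  obtain ⟨X, rfl⟩ : ∃ X : BEG ℓ n, X.cls = c := ⟨_, cls_out c⟩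
  have e : X.carrier ≃ α := (Finite.card_eq.mp hc).some
  let inst : AddCommGroup α := e.symm.addCommGroup
  let e' : X.carrier ≃+ α := (Equiv.addEquiv e.symm).symm
  have hA : ∀ x : α, ∃ k : ℕ, ℓ ^ k • x = 0 := by
    intro x
    obtain ⟨k, hk⟩ := X.isPrimary (e'.symm x)
    refine ⟨k, ?_⟩
    rw [← e'.apply_symm_apply x, ← map_nsmul, hk, map_zero]
  refine ⟨⟨inst, X.enh.push e'.toAddMonoidHom⟩, ?_⟩
  change dite _ _ _ = _
  rw [dif_pos hA]
  exact (cls_eq_cls.mpr (nonempty_iso_push X e' hA)).symm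

theorem finite_classCard_eq (N : ℕ) : {c : BEGClass ℓ n | classCard c = N}.Finite := by
  simpa using finite_classCard_eq_card (ℓ := ℓ) (n := n) (Fin N)

theorem finite_classCard_le (N : ℕ) : {c : BEGClass ℓ n | classCard c ≤ N}.Finite := by
  have : {c : BEGClass ℓ n | classCard c ≤ N} =
      ⋃ i ∈ Finset.range (N + 1), {c : BEGClass ℓ n | classCard c = i} := by
    ext c
    simp
  rw [this]
  exact Set.Finite.biUnion (Finset.finite_toSet _) fun i _ => finite_classCard_eq i

instance countable_begClass : Countable (BEGClass ℓ n) := by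
  rw [← Set.countable_univ_iff]
  have : (Set.univ : Set (BEGClass ℓ n)) = ⋃ i : ℕ, {c | classCard c = i} := by
    ext c
    simp
  rw [this]
  exact Set.countable_iUnion fun i => (finite_classCard_eq i).countable

/-- The group `X/ℓ^k`. -/
abbrev ModPow (ℓ k : ℕ) (X : Type) [AddCommGroup X] : Type :=
  X ⧸ (nsmulAddMonoidHom (α := X) (ℓ ^ k)).range

theorem modPow_nsmul {X : Type} [AddCommGroup X] (k : ℕ) (x : ModPow ℓ k X) : ℓ ^ k • x = 0 := by
  induction x using QuotientAddGroup.induction_on with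
  | H x =>
    rw [← QuotientAddGroup.mk_nsmul, QuotientAddGroup.eq_zero_iff]
    exact ⟨x, rfl⟩

/-- `X/ℓ^k` with the structure induced from `X`. -/
def truncBEG (k : ℕ) (X : BEG ℓ n) : BEG ℓ n :=
  (X.enh.push (QuotientAddGroup.mk' (nsmulAddMonoidHom (α := X.carrier) (ℓ ^ k)).range)).toBEG
    (fun x => ⟨k, modPow_nsmul k x⟩)

/-- Homomorphisms to a group killed by `ℓ^k` factor through `X/ℓ^k`. -/
def homModPowEquiv (k : ℕ) (X : Type) [AddCommGroup X] {B : Type*} [AddCommGroup B]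
    (hB : ∀ x : B, ℓ ^ k • x = 0) : (ModPow ℓ k X →+ B) ≃ (X →+ B) where
  toFun a := a.comp (QuotientAddGroup.mk' _)
  invFun a := QuotientAddGroup.lift _ a (by
    rintro _ ⟨y, rfl⟩
    change a (ℓ ^ k • y) = 0
    rw [map_nsmul, hB])
  left_inv a := by ext x; rfl
  right_inv a := by ext x; rfl

theorem card_surj_truncBEG (k : ℕ) (X Z : BEG ℓ n) (hZ : ∀ x : Z.carrier, ℓ ^ k • x = 0) :
    Nat.card (Surj X Z) = Nat.card (Surj (truncBEG k X) Z) := by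
  symm
  refine Nat.card_congr (Equiv.subtypeEquiv (homModPowEquiv k X.carrier hZ) fun f => ?_)
  refine and_congr ?_ ?_
  · rw [isMor_iff, isMor_iff]
    have : (truncBEG k X).enh.push f = X.enh.push (homModPowEquiv k X.carrier hZ f) := by
      refine Enh.ext ?_ ?_
      · exact tensorMap_comp _ f X.ω
      · rfl
    exact ⟨fun h => this.symm.trans h, fun h => this.trans h⟩
  · constructor
    · exact fun h => h.comp (QuotientAddGroup.mk'_surjective _)
    · exact fun h => Function.Surjective.of_comp (g := QuotientAddGroup.mk' _) h

theorem homCard_truncBEG (k : ℕ) (X : BEG ℓ n) :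
    homCard ℓ (truncBEG (k + 1) X).carrier = homCard ℓ X.carrier :=
  -- The exponent has to be positive: only then do maps to 𝔽_ℓ factor through the truncation.
  Nat.card_congr (homModPowEquiv (k + 1) X.carrier (fun x => by
    rw [pow_succ, mul_smul, nsmul_eq_mul ℓ, ZMod.natCast_self, zero_mul, smul_zero]))

/-- A choice of truncation on isomorphism classes. -/
def truncClass (k : ℕ) (c : BEGClass ℓ n) : BEGClass ℓ n := (truncBEG k (Quotient.out c)).cls

theorem surjCount_truncClass (k : ℕ) (c : BEGClass ℓ n) (Z : BEG ℓ n)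
    (hZ : ∀ x : Z.carrier, ℓ ^ k • x = 0) : surjCount (truncClass k c) Z = surjCount c Z := by
  conv_rhs => rw [← cls_out c]
  exact (card_surj_truncBEG k _ Z hZ).symm

theorem rankCard_truncClass (k : ℕ) (c : BEGClass ℓ n) :
    rankCard (truncClass (k + 1) c) = rankCard c := by
  conv_rhs => rw [← cls_out c]
  exact homCard_truncBEG k _

/-- The classes of groups killed by `ℓ^k`. -/
def KilledBy (k : ℕ) (c : BEGClass ℓ n) : Prop :=
  ∃ X : BEG ℓ n, X.cls = c ∧ ∀ x : X.carrier, ℓ ^ k • x = 0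

theorem killedBy_cls {k : ℕ} {X : BEG ℓ n} :
    KilledBy k X.cls ↔ ∀ x : X.carrier, ℓ ^ k • x = 0 := by
  constructor
  · rintro ⟨Y, hY, h⟩ x
    obtain ⟨e⟩ := cls_eq_cls.mp hY
    rw [← e.1.apply_symm_apply x, ← map_nsmul, h, map_zero]
  · exact fun h => ⟨X, rfl, h⟩

theorem killedBy_truncClass (k : ℕ) (c : BEGClass ℓ n) : KilledBy k (truncClass k c) :=
  ⟨_, rfl, fun x => modPow_nsmul k x⟩

theorem exists_killedBy (c : BEGClass ℓ n) : ∃ k, KilledBy k c := by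
  obtain ⟨X, rfl⟩ : ∃ X : BEG ℓ n, X.cls = c := ⟨_, cls_out c⟩
  obtain ⟨k, hk⟩ := exists_uniform_pow_smul X.isPrimary
  exact ⟨k, killedBy_cls.mpr hk⟩

theorem classCard_le_of_killedBy {k : ℕ} {c : BEGClass ℓ n} (h : KilledBy k c) :
    classCard c ≤ rankCard c ^ k := by
  obtain ⟨X, rfl, hX⟩ := h
  exact card_le_homCard_pow X.carrier k hX

/-- If ℓ^k kills X/ℓ^(k+1), then ℓ^k X ⊆ ℓ^(k+1) X, so ℓ^k X = 0 and X is its own truncation. The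
extra power of ℓ is what makes the truncation recognize the class, and so turns laws of truncations
into point masses. -/
theorem truncClass_eq_iff {k : ℕ} {c d : BEGClass ℓ n} (hd : KilledBy k d) :
    truncClass (k + 1) c = d ↔ c = d := by
  have key : ∀ X : BEG ℓ n, (∀ x : X.carrier, ℓ ^ k • x = 0) → (truncBEG (k + 1) X).cls = X.cls := by
    intro X hX
    have hinj : Function.Injective
        (QuotientAddGroup.mk' (nsmulAddMonoidHom (α := X.carrier) (ℓ ^ (k + 1))).range) := by
      rw [injective_iff_map_eq_zero]
      intro x hx
      obtain ⟨y, hy⟩ := (QuotientAddGroup.eq_zero_iff x).mp hx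
      rw [← hy]
      change ℓ ^ (k + 1) • y = 0
      rw [pow_succ', mul_smul, hX, smul_zero]
    symm
    exact cls_eq_cls.mpr ⟨Iso.ofBijective (Y := truncBEG (k + 1) X) (QuotientAddGroup.mk' _)
      (isMor_iff.mpr rfl) ⟨hinj, QuotientAddGroup.mk'_surjective _⟩⟩
  constructor
  · intro h
    rw [← cls_out c]
    rw [← h, truncClass] at hd
    rw [← h, truncClass, key]
    refine pow_smul_eq_zero_of_forall_exists (Quotient.out c).isPrimary k ?_
    intro x
    have := killedBy_cls.mp hd (QuotientAddGroup.mk x)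
    have h2 : ((ℓ ^ k • x : (Quotient.out c).carrier) : ModPow ℓ (k + 1) (Quotient.out c).carrier) = 0 := this
    obtain ⟨y, hy⟩ := (QuotientAddGroup.eq_zero_iff _).mp h2
    exact ⟨y, hy.symm⟩
  · rintro rfl
    rw [truncClass, key, cls_out]
    rw [← cls_out c] at hd
    exact killedBy_cls.mp hd

end Truncation

/-! ### Kernels of random symmetric matrices over 𝔽_ℓ -/

section SymmetricMatrices

theorem card_eq_card_mul_card_ker {A B : Type*} [AddCommGroup A] [AddCommGroup B] [Finite A]
    (f : A →+ B) (hf : Function.Surjective f) :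
    Nat.card A = Nat.card B * Nat.card {a : A // f a = 0} := by
  rw [AddSubgroup.card_eq_card_quotient_mul_card_addSubgroup f.ker,
    Nat.card_congr (QuotientAddGroup.quotientKerEquivOfSurjective f hf).toEquiv]
  rfl

variable {ℓ : ℕ} [Fact ℓ.Prime] (κ : Type) [Fintype κ] [DecidableEq κ]

/-- Symmetric matrices over `𝔽_ℓ`. -/
def symMat (ℓ : ℕ) : AddSubgroup (Matrix κ κ (ZMod ℓ)) where
  carrier := {D | ∀ i j, D i j = D j i}
  zero_mem' _ _ := rfl
  add_mem' h h' i j := by rw [Matrix.add_apply, Matrix.add_apply, h, h']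
  neg_mem' h i j := by rw [Matrix.neg_apply, Matrix.neg_apply, h]

instance : Fintype (symMat κ ℓ) := Fintype.ofFinite _

variable {κ}

/-- The order of the kernel of a matrix. -/
def kerCard (D : Matrix κ κ (ZMod ℓ)) : ℕ := Nat.card {x : κ → ZMod ℓ // D.mulVec x = 0}

theorem kerCard_eq_pow (D : Matrix κ κ (ZMod ℓ)) :
    kerCard D = ℓ ^ Module.finrank (ZMod ℓ) (LinearMap.ker D.mulVecLin) := by
  have h := Module.natCard_eq_pow_finrank (K := ZMod ℓ) (V := LinearMap.ker D.mulVecLin)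
  rw [Nat.card_zmod] at h
  exact h

/-- The symmetric matrices killing the given vectors. -/
def symMatKilling {d : ℕ} (x : Fin d → κ → ZMod ℓ) : AddSubgroup (Matrix κ κ (ZMod ℓ)) where
  carrier := {D | D ∈ symMat κ ℓ ∧ ∀ i, D.mulVec (x i) = 0}
  zero_mem' := ⟨zero_mem _, fun i => Matrix.zero_mulVec _⟩
  add_mem' h h' := ⟨add_mem h.1 h'.1, fun i => by rw [Matrix.add_mulVec, h.2, h'.2, add_zero]⟩
  neg_mem' h := ⟨neg_mem h.1, fun i => by rw [Matrix.neg_mulVec, h.2, neg_zero]⟩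

theorem dotProduct_surjective {d : ℕ} {x : Fin d → κ → ZMod ℓ} (hx : LinearIndependent (ZMod ℓ) x) :
    Function.Surjective (Matrix.of x).mulVecLin := by
  have h := LinearIndependent.rank_matrix (M := Matrix.of x) hx
  rw [← LinearMap.range_eq_top]
  apply Submodule.eq_top_of_finrank_eq
  rw [Matrix.rank] at h
  rw [h]
  simp

theorem card_orthogonal {d : ℕ} {x : Fin d → κ → ZMod ℓ} (hx : LinearIndependent (ZMod ℓ) x) :
    Nat.card {y : κ → ZMod ℓ // ∀ i, dotProduct (x i) y = 0} * ℓ ^ d = ℓ ^ Fintype.card κ := by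
  have h := card_eq_card_mul_card_ker (Matrix.of x).mulVecLin.toAddMonoidHom (dotProduct_surjective hx)
  rw [Nat.card_fun, Nat.card_fun, Nat.card_zmod, Nat.card_fin, Nat.card_eq_fintype_card] at h
  rw [h, mul_comm]
  congr 1
  refine Nat.card_congr (Equiv.subtypeEquivRight fun y => ?_)
  rw [funext_iff]
  rfl

/-- Evaluation at the last vector is a homomorphism on the symmetric matrices that kill the earlier
ones. By symmetry its values are orthogonal to the earlier vectors, and every such value occurs. -/
theorem card_symMatKilling_succ {d : ℕ} {x : Fin (d + 1) → κ → ZMod ℓ}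
    (hx : LinearIndependent (ZMod ℓ) x) :
    Nat.card (symMatKilling fun i => x (Fin.castSucc i)) * ℓ ^ d =
      ℓ ^ Fintype.card κ * Nat.card (symMatKilling x) := by
  have hx' : LinearIndependent (ZMod ℓ) fun i => x (Fin.castSucc i) :=
    hx.comp _ (Fin.castSucc_injective d)
  let T : AddSubgroup (κ → ZMod ℓ) :=
    { carrier := {y | ∀ i : Fin d, dotProduct (x (Fin.castSucc i)) y = 0}
      zero_mem' := fun i => dotProduct_zero _
      add_mem' := fun h h' i => by rw [dotProduct_add, h, h', add_zero]
      neg_mem' := fun h i => by rw [dotProduct_neg, h, neg_zero] }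
  let f : symMatKilling (fun i => x (Fin.castSucc i)) →+ T :=
    { toFun := fun D => ⟨D.1.mulVec (x (Fin.last d)), fun i => by
        have hsymm : D.1.transpose = D.1 := Matrix.ext fun i j => D.2.1 j i
        rw [Matrix.dotProduct_mulVec, ← Matrix.mulVec_transpose, hsymm, D.2.2 i, zero_dotProduct]⟩
      map_zero' := Subtype.ext (Matrix.zero_mulVec _)
      map_add' := fun D D' => Subtype.ext (Matrix.add_mulVec _ _ _) }
  have hf : Function.Surjective f := by
    intro y
    -- The vector z pairs to 1 with the last vector and to 0 with the others. Then y zᵀ + z yᵀ -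
    -- (y·x_d) z zᵀ is symmetric, kills the earlier vectors and sends the last one to y; the third
    -- term removes the excess multiple of z.
    obtain ⟨z, hz⟩ := dotProduct_surjective hx (Pi.single (Fin.last d) 1)
    have hz' : ∀ i, dotProduct z (x i) = (Pi.single (Fin.last d) 1 : Fin (d + 1) → ZMod ℓ) i := by
      intro i
      rw [dotProduct_comm]
      exact congrFun hz i
    have hmv : ∀ u v w : κ → ZMod ℓ, (Matrix.vecMulVec u v).mulVec w = (dotProduct v w) • u := by
      intro u v w
      ext i
      simp [Matrix.mulVec, Matrix.vecMulVec_apply, dotProduct, Finset.mul_sum, mul_comm, mul_left_comm]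
    let c := dotProduct (y : κ → ZMod ℓ) (x (Fin.last d))
    refine ⟨⟨Matrix.vecMulVec y z + Matrix.vecMulVec z y - c • Matrix.vecMulVec z z, ?_, ?_⟩, ?_⟩
    · intro i j
      simp only [Matrix.sub_apply, Matrix.add_apply, Matrix.smul_apply, Matrix.vecMulVec_apply,
        smul_eq_mul]
      ring
    · intro i
      have h1 : dotProduct z (x (Fin.castSucc i)) = 0 := by
        rw [hz', Pi.single_eq_of_ne (Fin.castSucc_lt_last i).ne]
      have h2 : dotProduct (y : κ → ZMod ℓ) (x (Fin.castSucc i)) = 0 := by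
        rw [dotProduct_comm]
        exact y.2 i
      rw [Matrix.sub_mulVec, Matrix.add_mulVec, Matrix.smul_mulVec, hmv, hmv, hmv, h1, h2]
      simp
    · apply Subtype.ext
      change (Matrix.vecMulVec (y : κ → ZMod ℓ) z + Matrix.vecMulVec z y - c • Matrix.vecMulVec z z).mulVec
        (x (Fin.last d)) = (y : κ → ZMod ℓ)
      have h1 : dotProduct z (x (Fin.last d)) = 1 := by
        rw [hz', Pi.single_eq_same]
      rw [Matrix.sub_mulVec, Matrix.add_mulVec, Matrix.smul_mulVec, hmv, hmv, hmv, h1]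
      simp [c]
  have h := card_eq_card_mul_card_ker f hf
  have hT : Nat.card T * ℓ ^ d = ℓ ^ Fintype.card κ := card_orthogonal hx'
  rw [h, mul_right_comm, hT]
  congr 1
  refine Nat.card_congr ⟨fun D => ⟨D.1.1, D.1.2.1, fun i => ?_⟩,
    fun D => ⟨⟨D.1, D.2.1, fun i => D.2.2 _⟩, ?_⟩, fun D => rfl, fun D => rfl⟩
  · refine Fin.lastCases ?_ (fun i => D.1.2.2 i) i
    exact congrArg Subtype.val D.2
  · exact Subtype.ext (D.2.2 _)

theorem card_symMatKilling {d : ℕ} {x : Fin d → κ → ZMod ℓ} (hx : LinearIndependent (ZMod ℓ) x) :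
    Nat.card (symMatKilling x) * (ℓ ^ Fintype.card κ) ^ d =
      Nat.card (symMat κ ℓ) * ℓ ^ (∑ i ∈ Finset.range d, i) := by
  induction d with
  | zero =>
    have : symMatKilling x = symMat κ ℓ := by
      ext D
      exact ⟨fun h => h.1, fun h => ⟨h, fun i => i.elim0⟩⟩
    simp [this]
  | succ d ih =>
    have h1 := ih (hx.comp _ (Fin.castSucc_injective d))
    have h2 := card_symMatKilling_succ hx
    rw [Finset.sum_range_succ, pow_add _ _ d, ← mul_assoc, ← h1, pow_succ]
    change _ = Nat.card (symMatKilling fun i => x (Fin.castSucc i)) * _ * _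
    rw [mul_right_comm, h2]
    ring

variable (κ) in
/-- The average of `φ(#ker D)` over the symmetric matrices `D` over `𝔽_ℓ`. -/
def symAvg (ℓ : ℕ) [Fact ℓ.Prime] (φ : ℕ → ℝ) : ℝ :=
  (∑ D : symMat κ ℓ, φ (kerCard D.1)) / Nat.card (symMat κ ℓ)

theorem sum_range_id_lt {d : ℕ} : ∑ i ∈ Finset.range d, i = d.choose 2 := by
  rw [Finset.sum_range_id, Nat.choose_two_right]

theorem prod_sub_eq_zero_of_lt {w d : ℕ} (h : w < d) :
    ∏ i ∈ Finset.range d, ((ℓ : ℝ) ^ w - (ℓ : ℝ) ^ i) = 0 :=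
  Finset.prod_eq_zero (Finset.mem_range.mpr h) (sub_self _)

theorem card_linearIndependent_eq {V : Type*} [AddCommGroup V] [Module (ZMod ℓ) V] [Finite V] (d : ℕ) :
    (Nat.card {s : Fin d → V // LinearIndependent (ZMod ℓ) s} : ℝ) =
      ∏ i ∈ Finset.range d, ((ℓ : ℝ) ^ Module.finrank (ZMod ℓ) V - (ℓ : ℝ) ^ i) := by
  by_cases hd : d ≤ Module.finrank (ZMod ℓ) V
  · have h := card_linearIndependent (K := ZMod ℓ) (V := V) hd
    rw [h, Nat.cast_prod, ← Fin.prod_univ_eq_prod_range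
      (fun i => (ℓ : ℝ) ^ Module.finrank (ZMod ℓ) V - (ℓ : ℝ) ^ i)]
    refine Finset.prod_congr rfl fun i _ => ?_
    rw [ZMod.card, Nat.cast_sub (Nat.pow_le_pow_right prime_pos (i.2.le.trans hd))]
    push_cast
    rfl
  · rw [prod_sub_eq_zero_of_lt (not_le.mp hd)]
    have : IsEmpty {s : Fin d → V // LinearIndependent (ZMod ℓ) s} := by
      refine ⟨fun s => hd ?_⟩
      simpa using s.2.fintype_card_le_finrank
    simp

/-- The product counts the linearly independent d-tuples in the kernel. Counting pairs (matrix,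
tuple) in the other order, every independent tuple is killed by the same number of symmetric
matrices. -/
theorem symAvg_prod_sub (d : ℕ) :
    symAvg κ ℓ (fun t => ∏ i ∈ Finset.range d, ((t : ℝ) - (ℓ : ℝ) ^ i)) =
      (∏ i ∈ Finset.range d, ((ℓ : ℝ) ^ Fintype.card κ - (ℓ : ℝ) ^ i)) * (ℓ : ℝ) ^ d.choose 2 /
        ((ℓ : ℝ) ^ Fintype.card κ) ^ d := by
  have hℓ : (ℓ : ℝ) ≠ 0 := by exact_mod_cast (prime_pos (ℓ := ℓ)).ne'
  have h1 : ∀ D : symMat κ ℓ, ∏ i ∈ Finset.range d, ((kerCard D.1 : ℝ) - (ℓ : ℝ) ^ i) =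
      Nat.card {s : Fin d → κ → ZMod ℓ // LinearIndependent (ZMod ℓ) s ∧ D.1 ∈ symMatKilling s} := by
    intro D
    rw [kerCard_eq_pow, Nat.cast_pow, ← card_linearIndependent_eq]
    congr 1
    refine Nat.card_congr ⟨fun s => ⟨fun i => (s.1 i : κ → ZMod ℓ),
        s.2.map' (Submodule.subtype _) (Submodule.ker_subtype _), D.2, fun i => (s.1 i).2⟩,
      fun s => ⟨fun i => ⟨s.1 i, s.2.2.2 i⟩, ?_⟩, fun s => rfl, fun s => rfl⟩
    exact LinearIndependent.of_comp (Submodule.subtype _) s.2.1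
  have h2 : ∑ D : symMat κ ℓ, (Nat.card
      {s : Fin d → κ → ZMod ℓ // LinearIndependent (ZMod ℓ) s ∧ D.1 ∈ symMatKilling s} : ℝ) =
      Nat.card {s : Fin d → κ → ZMod ℓ // LinearIndependent (ZMod ℓ) s} *
        (Nat.card (symMat κ ℓ) * (ℓ : ℝ) ^ d.choose 2 / ((ℓ : ℝ) ^ Fintype.card κ) ^ d) := by
    have e : (Σ D : symMat κ ℓ,
        {s : Fin d → κ → ZMod ℓ // LinearIndependent (ZMod ℓ) s ∧ D.1 ∈ symMatKilling s}) ≃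
        Σ s : {s : Fin d → κ → ZMod ℓ // LinearIndependent (ZMod ℓ) s}, symMatKilling s.1 :=
      ⟨fun p => ⟨⟨p.2.1, p.2.2.1⟩, ⟨p.1.1, p.2.2.2⟩⟩,
        fun p => ⟨⟨p.2.1, p.2.2.1⟩, ⟨p.1.1, p.1.2, p.2.2⟩⟩, fun p => rfl, fun p => rfl⟩
    have hfin : Fintype {s : Fin d → κ → ZMod ℓ // LinearIndependent (ZMod ℓ) s} := Fintype.ofFinite _
    have := Nat.card_congr e
    rw [Nat.card_sigma, Nat.card_sigma] at this
    rw [← Nat.cast_sum, this, Nat.cast_sum, Nat.card_eq_fintype_card (α := {s : Fin d → κ → ZMod ℓ //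
      LinearIndependent (ZMod ℓ) s}), ← nsmul_eq_mul, ← Finset.card_univ, ← Finset.sum_const]
    refine Finset.sum_congr rfl fun s _ => ?_
    have h3 := card_symMatKilling s.2
    rw [sum_range_id_lt] at h3
    rw [eq_div_iff (by positivity)]
    exact_mod_cast h3
  have hpos : (Nat.card (symMat κ ℓ) : ℝ) ≠ 0 := by exact_mod_cast Nat.card_pos.ne'
  rw [symAvg, Finset.sum_congr rfl fun D _ => h1 D, h2, card_linearIndependent_eq]
  rw [Module.finrank_fintype_fun_eq_card]
  field_simp

end SymmetricMatrices

/-! ### Möbius inversion over subspaces and Euler's product -/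

section QSeries

variable (ℓ : ℕ)

/-- The number `∏_{i<d} (ℓ^w - ℓ^i)` of injective maps `𝔽_ℓ^d → 𝔽_ℓ^w`. -/
def injNum (w d : ℕ) : ℝ := ∏ i ∈ Finset.range d, ((ℓ : ℝ) ^ w - (ℓ : ℝ) ^ i)

theorem injNum_zero_right (w : ℕ) : injNum ℓ w 0 = 1 := by simp [injNum]

theorem injNum_succ_right (w d : ℕ) :
    injNum ℓ w (d + 1) = injNum ℓ w d * ((ℓ : ℝ) ^ w - (ℓ : ℝ) ^ d) := Finset.prod_range_succ _ _

theorem injNum_succ_succ (w d : ℕ) :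
    injNum ℓ (w + 1) (d + 1) = ((ℓ : ℝ) ^ (w + 1) - 1) * (ℓ : ℝ) ^ d * injNum ℓ w d := by
  rw [injNum, Finset.prod_range_succ', pow_zero]
  have : ∀ i ∈ Finset.range d, (ℓ : ℝ) ^ (w + 1) - (ℓ : ℝ) ^ (i + 1) =
      ℓ * ((ℓ : ℝ) ^ w - (ℓ : ℝ) ^ i) := fun i _ => by ring
  rw [Finset.prod_congr rfl this, Finset.prod_mul_distrib, Finset.prod_const, Finset.card_range,
    injNum]
  ring

theorem injNum_of_lt {w d : ℕ} (h : w < d) : injNum ℓ w d = 0 :=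
  Finset.prod_eq_zero (Finset.mem_range.mpr h) (sub_self _)

/-- The coefficients of Möbius inversion in the lattice of subspaces. -/
def mobCoeff (d : ℕ) : ℝ := (-1) ^ d * (ℓ : ℝ) ^ d.choose 2 / injNum ℓ d d

variable {ℓ} (hℓ : 3 ≤ ℓ)
include hℓ

theorem one_lt_cast : (1 : ℝ) < ℓ := by exact_mod_cast (by omega : 1 < ℓ)

theorem pow_sub_one_pos (d : ℕ) : 0 < (ℓ : ℝ) ^ (d + 1) - 1 :=
  sub_pos.mpr (one_lt_pow₀ (one_lt_cast hℓ) d.succ_ne_zero)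

theorem injNum_self_pos (d : ℕ) : 0 < injNum ℓ d d := by
  have h := one_lt_cast hℓ
  exact Finset.prod_pos fun i hi => sub_pos.mpr (pow_lt_pow_right₀ h (Finset.mem_range.mp hi))

theorem injNum_nonneg (w d : ℕ) : 0 ≤ injNum ℓ w d := by
  rcases lt_or_ge w d with h | h
  · rw [injNum_of_lt ℓ h]
  · exact Finset.prod_nonneg fun i hi => sub_nonneg.mpr
      (pow_le_pow_right₀ (one_lt_cast hℓ).le ((Finset.mem_range.mp hi).le.trans h))

theorem injNum_le (w d : ℕ) : injNum ℓ w d ≤ ((ℓ : ℝ) ^ w) ^ d := by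
  rcases lt_or_ge w d with h | h
  · rw [injNum_of_lt ℓ h]
    positivity
  · rw [injNum, ← Finset.card_range d, ← Finset.prod_const, Finset.card_range]
    refine Finset.prod_le_prod (fun i hi => sub_nonneg.mpr
      (pow_le_pow_right₀ (one_lt_cast hℓ).le ((Finset.mem_range.mp hi).le.trans h))) fun i _ => ?_
    have : 0 ≤ (ℓ : ℝ) ^ i := by positivity
    linarith

/-- A closed form for the truncated sums, proved by induction on D. It vanishes from D = w + 1 on,
which gives the inversion formula. -/
theorem sum_mobCoeff_succ (w D : ℕ) :
    ∑ d ∈ Finset.range (D + 1), mobCoeff ℓ d * injNum ℓ (w + 1) d =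
      (-1) ^ D * (ℓ : ℝ) ^ (D + 1).choose 2 * injNum ℓ w D / injNum ℓ D D := by
  induction D with
  | zero => simp [mobCoeff, injNum_zero_right]
  | succ D ih =>
    rw [Finset.sum_range_succ, ih, mobCoeff, injNum_succ_succ, injNum_succ_succ,
      injNum_succ_right]
    have h1 := (injNum_self_pos hℓ D).ne'
    have h2 := (pow_sub_one_pos hℓ D).ne'
    have h3 : (ℓ : ℝ) ≠ 0 := by have := one_lt_cast hℓ; positivity
    have h4 : (D + 1 + 1).choose 2 = (D + 1).choose 2 + (D + 1) := by
      rw [Nat.choose_succ_succ' (D + 1) 1, Nat.choose_one_right, add_comm]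
    rw [h4, pow_add (ℓ : ℝ) _ (D + 1)]
    field_simp
    ring

theorem sum_mobCoeff (w : ℕ) :
    ∑ d ∈ Finset.range (w + 1), mobCoeff ℓ d * injNum ℓ w d = if w = 0 then 1 else 0 := by
  rcases w with _ | w
  · simp [mobCoeff, injNum_zero_right]
  · rw [sum_mobCoeff_succ hℓ, injNum_of_lt ℓ (Nat.lt_succ_self w)]
    simp

/-- The limiting terms of the inversion. -/
def invTerm (ℓ d : ℕ) : ℝ := mobCoeff ℓ d * (ℓ : ℝ) ^ d.choose 2

omit hℓ in
theorem invTerm_zero : invTerm ℓ 0 = 1 := by simp [invTerm, mobCoeff, injNum_zero_right]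

theorem invTerm_succ (d : ℕ) :
    invTerm ℓ (d + 1) = invTerm ℓ d * (-(ℓ : ℝ) ^ d / ((ℓ : ℝ) ^ (d + 1) - 1)) := by
  have h1 := (injNum_self_pos hℓ d).ne'
  have h2 := (pow_sub_one_pos hℓ d).ne'
  have h3 : (ℓ : ℝ) ≠ 0 := by have := one_lt_cast hℓ; positivity
  have h4 : (d + 1).choose 2 = d.choose 2 + d := by
    rw [Nat.choose_succ_succ' d 1, Nat.choose_one_right, add_comm]
  rw [invTerm, invTerm, mobCoeff, mobCoeff, injNum_succ_succ, h4, pow_add (ℓ : ℝ) _ d]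
  field_simp
  ring

/-- The reciprocal of `∏_{j<d} (1 - ℓ^{-(j+1)})`. -/
def qPochInv (ℓ d : ℕ) : ℝ := ∏ j ∈ Finset.range d, (1 - ((ℓ : ℝ)⁻¹) ^ (j + 1))⁻¹

theorem inv_le_third : (ℓ : ℝ)⁻¹ ≤ 1 / 3 := by
  rw [inv_eq_one_div]
  exact one_div_le_one_div_of_le (by norm_num) (by exact_mod_cast hℓ)

theorem inv_pow_le_third (k : ℕ) : ((ℓ : ℝ)⁻¹) ^ (k + 1) ≤ 1 / 3 := by
  have h1 : 0 ≤ (ℓ : ℝ)⁻¹ := by positivity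
  have h2 := inv_le_third hℓ
  rw [pow_succ]
  have : ((ℓ : ℝ)⁻¹) ^ k ≤ 1 := pow_le_one₀ h1 (by linarith)
  nlinarith

theorem qPochInv_nonneg (d : ℕ) : 0 ≤ qPochInv ℓ d :=
  Finset.prod_nonneg fun j _ => inv_nonneg.mpr (by linarith [inv_pow_le_third hℓ j])

theorem qPochInv_le (d : ℕ) : qPochInv ℓ d ≤ (3 / 2) ^ d := by
  rw [qPochInv, ← Finset.card_range d, ← Finset.prod_const, Finset.card_range]
  refine Finset.prod_le_prod (fun j _ => inv_nonneg.mpr (by linarith [inv_pow_le_third hℓ j]))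
    fun j _ => ?_
  rw [inv_le_comm₀ (by linarith [inv_pow_le_third hℓ j]) (by norm_num)]
  linarith [inv_pow_le_third hℓ j]

/-- For ℓ ≥ 3 each factor 1/(1 - ℓ^(-j)) is at most 3/2, and ℓ^(-k-1) ≤ 1/3. The bound does not
depend on k, as dominated convergence requires. -/
theorem norm_qPochInv_mul_le (k d : ℕ) :
    ‖qPochInv ℓ d * (-((ℓ : ℝ)⁻¹) ^ (k + 1)) ^ d‖ ≤ (1 / 2) ^ d := by
  rw [norm_mul, norm_pow, norm_neg, Real.norm_of_nonneg (qPochInv_nonneg hℓ d),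
    Real.norm_of_nonneg (by positivity : (0 : ℝ) ≤ ((ℓ : ℝ)⁻¹) ^ (k + 1))]
  calc qPochInv ℓ d * (((ℓ : ℝ)⁻¹) ^ (k + 1)) ^ d ≤ (3 / 2) ^ d * (1 / 3) ^ d := by
        gcongr
        · exact qPochInv_le hℓ d
        · exact inv_pow_le_third hℓ k
    _ = (1 / 2) ^ d := by rw [← mul_pow]; norm_num

theorem summable_qPochInv (k : ℕ) :
    Summable fun d => qPochInv ℓ d * (-((ℓ : ℝ)⁻¹) ^ (k + 1)) ^ d :=
  Summable.of_norm_bounded summable_geometric_two (norm_qPochInv_mul_le hℓ k)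

theorem invTerm_eq (d : ℕ) : invTerm ℓ d = qPochInv ℓ d * (-((ℓ : ℝ)⁻¹) ^ (0 + 1)) ^ d := by
  induction d with
  | zero => simp [invTerm_zero, qPochInv]
  | succ d ih =>
    rw [invTerm_succ hℓ, ih, qPochInv, qPochInv, Finset.prod_range_succ]
    have h2 := (pow_sub_one_pos hℓ d).ne'
    have h3 : (ℓ : ℝ) ≠ 0 := by have := one_lt_cast hℓ; positivity
    have h5 : -(ℓ : ℝ) ^ d / ((ℓ : ℝ) ^ (d + 1) - 1) =
        (1 - ((ℓ : ℝ)⁻¹) ^ (d + 1))⁻¹ * (-((ℓ : ℝ)⁻¹)) := by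
      have h6 : 1 - ((ℓ : ℝ)⁻¹) ^ (d + 1) = ((ℓ : ℝ) ^ (d + 1) - 1) / (ℓ : ℝ) ^ (d + 1) := by
        rw [inv_pow, eq_div_iff (pow_ne_zero _ h3), sub_mul, inv_mul_cancel₀ (pow_ne_zero _ h3),
          one_mul]
      rw [h6]
      field_simp
      ring
    rw [h5]
    simp only [zero_add, pow_one]
    ring

theorem summable_norm_invTerm : Summable fun d => ‖invTerm ℓ d‖ := by
  simp_rw [invTerm_eq hℓ]
  exact Summable.of_nonneg_of_le (fun _ => norm_nonneg _) (norm_qPochInv_mul_le hℓ 0)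
    summable_geometric_two

/-- The series `∑ x^d / (q;q)_d` at `x = -q^(k+1)`. -/
def eulerSum (ℓ k : ℕ) : ℝ := ∑' d, qPochInv ℓ d * (-((ℓ : ℝ)⁻¹) ^ (k + 1)) ^ d

/-- With q = 1/ℓ and E(x) = ∑ x^d/(q;q)_d, the equation (1 - q^d)/(q;q)_d = 1/(q;q)_{d-1} gives E(x)
- E(qx) = x E(x). Here x = -q^(k+1). -/
theorem eulerSum_succ (k : ℕ) :
    eulerSum ℓ k * (1 + ((ℓ : ℝ)⁻¹) ^ (k + 1)) = eulerSum ℓ (k + 1) := by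
  have h0 := summable_qPochInv hℓ k
  have h1 := summable_qPochInv hℓ (k + 1)
  have e : eulerSum ℓ k - eulerSum ℓ (k + 1) = -((ℓ : ℝ)⁻¹) ^ (k + 1) * eulerSum ℓ k := by
    rw [eulerSum, eulerSum, ← h0.tsum_sub h1, ← tsum_mul_left, (h0.sub h1).tsum_eq_zero_add]
    simp only [pow_zero, mul_one, sub_self, zero_add]
    refine tsum_congr fun d => ?_
    rw [qPochInv, qPochInv, Finset.prod_range_succ]
    have h2 : 1 - ((ℓ : ℝ)⁻¹) ^ (d + 1) ≠ 0 := by linarith [inv_pow_le_third hℓ d]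
    have h3 : -((ℓ : ℝ)⁻¹) ^ (k + 1 + 1) = -((ℓ : ℝ)⁻¹) ^ (k + 1) * (ℓ : ℝ)⁻¹ := by ring
    rw [h3, mul_pow]
    generalize ((ℓ : ℝ)⁻¹) ^ (d + 1) = a at *
    generalize -((ℓ : ℝ)⁻¹) ^ (k + 1) = x
    field_simp
    ring
  linarith

theorem eulerSum_mul_prod (N : ℕ) :
    eulerSum ℓ 0 * ∏ i ∈ Finset.range N, (1 + ((ℓ : ℝ)⁻¹) ^ (i + 1)) = eulerSum ℓ N := by
  induction N with
  | zero => simp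
  | succ N ih => rw [Finset.prod_range_succ, ← mul_assoc, ih, eulerSum_succ hℓ]

theorem tendsto_inv_pow : Tendsto (fun N : ℕ => ((ℓ : ℝ)⁻¹) ^ N) atTop (𝓝 0) :=
  tendsto_pow_atTop_nhds_zero_of_lt_one (by positivity) (by linarith [inv_le_third hℓ])

theorem tendsto_eulerSum : Tendsto (fun N => eulerSum ℓ N) atTop (𝓝 1) := by
  have h : (∑' d : ℕ, if d = 0 then (1 : ℝ) else 0) = 1 := tsum_ite_eq 0 (fun _ => 1)
  rw [← h]
  refine tendsto_tsum_of_dominated_convergence summable_geometric_two (fun d => ?_)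
    (Eventually.of_forall fun N d => norm_qPochInv_mul_le hℓ N d)
  rcases d with _ | d
  · simp [qPochInv]
  · rw [if_neg d.succ_ne_zero, ← mul_zero (qPochInv ℓ (d + 1))]
    refine Tendsto.const_mul _ ?_
    have h1 := (tendsto_inv_pow hℓ).comp (tendsto_add_atTop_nat 1)
    have h2 := (h1.neg).pow (d + 1)
    simpa using h2

/-- A finite form of Euler's identity ∏ (1 + q^i) ∏ (1 - q^(2i-1)) = 1. Multiply by the even factors
∏ (1 - q^(2i)), i ≤ N: they complete the odd ones, and (1 + q^i)(1 - q^i) = 1 - q^(2i). The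
right-hand side is the error from truncation. -/
theorem prod_one_add_mul_prod (N : ℕ) :
    (∏ i ∈ Finset.range (2 * N), (1 + ((ℓ : ℝ)⁻¹) ^ (i + 1))) *
        ∏ i ∈ Finset.range N, (1 - ((ℓ : ℝ) ^ (2 * i + 1))⁻¹) =
      ∏ i ∈ Finset.range N, (1 - ((ℓ : ℝ)⁻¹) ^ (2 * (N + i) + 2)) := by
  have hne : ∀ M : ℕ, ∏ i ∈ Finset.range M, (1 - ((ℓ : ℝ)⁻¹) ^ (2 * i + 2)) ≠ 0 := fun M =>
    Finset.prod_ne_zero_iff.mpr fun i _ => by linarith [inv_pow_le_third hℓ (2 * i + 1)]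
  have h1 : (∏ i ∈ Finset.range N, (1 - ((ℓ : ℝ) ^ (2 * i + 1))⁻¹)) *
      ∏ i ∈ Finset.range N, (1 - ((ℓ : ℝ)⁻¹) ^ (2 * i + 2)) =
      ∏ i ∈ Finset.range (2 * N), (1 - ((ℓ : ℝ)⁻¹) ^ (i + 1)) := by
    clear hne
    induction N with
    | zero => simp
    | succ N ih =>
      rw [show 2 * (N + 1) = 2 * N + 1 + 1 by ring, Finset.prod_range_succ, Finset.prod_range_succ,
        Finset.prod_range_succ, Finset.prod_range_succ, ← ih, inv_pow]
      ring
  have h2 : (∏ i ∈ Finset.range (2 * N), (1 + ((ℓ : ℝ)⁻¹) ^ (i + 1))) *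
      ∏ i ∈ Finset.range (2 * N), (1 - ((ℓ : ℝ)⁻¹) ^ (i + 1)) =
      ∏ i ∈ Finset.range (2 * N), (1 - ((ℓ : ℝ)⁻¹) ^ (2 * i + 2)) := by
    rw [← Finset.prod_mul_distrib]
    exact Finset.prod_congr rfl fun i _ => by ring
  have h3 : ∏ i ∈ Finset.range (2 * N), (1 - ((ℓ : ℝ)⁻¹) ^ (2 * i + 2)) =
      (∏ i ∈ Finset.range N, (1 - ((ℓ : ℝ)⁻¹) ^ (2 * i + 2))) *
        ∏ i ∈ Finset.range N, (1 - ((ℓ : ℝ)⁻¹) ^ (2 * (N + i) + 2)) := by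
    rw [two_mul, Finset.prod_range_add]
  apply mul_right_cancel₀ (hne N)
  rw [mul_assoc, h1, h2, h3, mul_comm]

theorem tendsto_prod_tail :
    Tendsto (fun N : ℕ => ∏ i ∈ Finset.range N, (1 - ((ℓ : ℝ)⁻¹) ^ (2 * (N + i) + 2))) atTop (𝓝 1) := by
  have hlow : ∀ N : ℕ, 1 - (N : ℝ) * ((ℓ : ℝ)⁻¹) ^ N ≤
      ∏ i ∈ Finset.range N, (1 - ((ℓ : ℝ)⁻¹) ^ (2 * (N + i) + 2)) := by
    intro N
    have hq : (ℓ : ℝ)⁻¹ ≤ 1 := by linarith [inv_le_third hℓ]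
    have hN : ((ℓ : ℝ)⁻¹) ^ N ≤ 1 := pow_le_one₀ (by positivity) hq
    -- Every factor is at least 1 - q^N, so Bernoulli's inequality bounds the product below by 1 - N
    -- q^N.
    have h1 := one_add_mul_le_pow (a := -((ℓ : ℝ)⁻¹) ^ N) (by linarith) N
    refine le_trans (by linarith) (h1.trans ?_)
    rw [← Finset.card_range N, ← Finset.prod_const, Finset.card_range]
    refine Finset.prod_le_prod (fun i _ => by linarith) fun i _ => ?_
    have : ((ℓ : ℝ)⁻¹) ^ (2 * (N + i) + 2) ≤ ((ℓ : ℝ)⁻¹) ^ N :=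
      pow_le_pow_of_le_one (by positivity) hq (by omega)
    linarith
  refine tendsto_of_tendsto_of_tendsto_of_le_of_le (g := fun N : ℕ => 1 - (N : ℝ) * ((ℓ : ℝ)⁻¹) ^ N)
    (h := fun _ => 1) ?_ tendsto_const_nhds hlow ?_
  · have := tendsto_self_mul_const_pow_of_lt_one (r := (ℓ : ℝ)⁻¹) (by positivity)
      (by linarith [inv_le_third hℓ])
    simpa using this.const_sub 1
  · intro N
    refine Finset.prod_le_one (fun i _ => ?_) fun i _ => ?_
    · linarith [inv_pow_le_third hℓ (2 * (N + i) + 1)]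
    · have : 0 ≤ ((ℓ : ℝ)⁻¹) ^ (2 * (N + i) + 2) := by positivity
      linarith

/-- Iterating the functional equation gives E(-q) = 1/∏ (1 + q^i), which Euler's identity turns into
the product over odd exponents. -/
theorem eulerSum_zero : eulerSum ℓ 0 = cConst ℓ := by
  have h1 : Tendsto (fun N : ℕ => eulerSum ℓ (2 * N) *
      ∏ i ∈ Finset.range N, (1 - ((ℓ : ℝ) ^ (2 * i + 1))⁻¹)) atTop (𝓝 (1 * cConst ℓ)) :=
    ((tendsto_eulerSum hℓ).comp (tendsto_id.const_mul_atTop' (by norm_num : 0 < 2))).mul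
      (multipliable_cConst ℓ (by omega)).hasProd.tendsto_prod_nat
  have h2 : Tendsto (fun N : ℕ => eulerSum ℓ 0 *
      ∏ i ∈ Finset.range N, (1 - ((ℓ : ℝ)⁻¹) ^ (2 * (N + i) + 2))) atTop (𝓝 (eulerSum ℓ 0 * 1)) :=
    (tendsto_prod_tail hℓ).const_mul _
  rw [one_mul] at h1
  rw [mul_one] at h2
  refine tendsto_nhds_unique h2 (h1.congr fun N => ?_)
  rw [← eulerSum_mul_prod hℓ, mul_assoc, prod_one_add_mul_prod hℓ]

theorem cConst_pos : 0 < cConst ℓ := by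
  rw [← eulerSum_zero hℓ]
  have h := (tendsto_eulerSum hℓ).eventually (lt_mem_nhds one_pos)
  obtain ⟨N, hN⟩ := h.exists
  rw [← eulerSum_mul_prod hℓ] at hN
  exact pos_of_mul_pos_left hN (Finset.prod_nonneg fun i _ => by positivity)

theorem tsum_invTerm : ∑' d, invTerm ℓ d = cConst ℓ := by
  rw [← eulerSum_zero hℓ, eulerSum]
  exact tsum_congr fun d => invTerm_eq hℓ d

theorem tendsto_injNum_div (d : ℕ) :
    Tendsto (fun m : ℕ => injNum ℓ m d / ((ℓ : ℝ) ^ m) ^ d) atTop (𝓝 1) := by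
  have h3 : (ℓ : ℝ) ≠ 0 := by have := one_lt_cast hℓ; positivity
  have : ∀ m : ℕ, injNum ℓ m d / ((ℓ : ℝ) ^ m) ^ d =
      ∏ i ∈ Finset.range d, (1 - (ℓ : ℝ) ^ i * ((ℓ : ℝ)⁻¹) ^ m) := by
    intro m
    rw [injNum, ← Finset.card_range d, ← Finset.prod_const, Finset.card_range, ← Finset.prod_div_distrib]
    refine Finset.prod_congr rfl fun i _ => ?_
    rw [inv_pow]
    field_simp
  simp_rw [this]
  have h := tendsto_finsetProd (Finset.range d)
    fun i _ => ((tendsto_inv_pow hℓ).const_mul ((ℓ : ℝ) ^ i)).const_sub 1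
  simpa using h

/-- The probability that a random symmetric `m × m` matrix over `𝔽_ℓ` is invertible. -/
def invProb (ℓ m : ℕ) : ℝ := ∑' d, invTerm ℓ d * (injNum ℓ m d / ((ℓ : ℝ) ^ m) ^ d)

theorem tendsto_invProb : Tendsto (fun m => invProb ℓ m) atTop (𝓝 (cConst ℓ)) := by
  rw [← tsum_invTerm hℓ]
  refine tendsto_tsum_of_dominated_convergence (summable_norm_invTerm hℓ) (fun d => ?_)
    (Eventually.of_forall fun m d => ?_)
  · simpa using (tendsto_injNum_div hℓ d).const_mul (invTerm ℓ d)
  · rw [norm_mul]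
    have hpos : 0 < ((ℓ : ℝ) ^ m) ^ d := by have := one_lt_cast hℓ; positivity
    refine mul_le_of_le_one_right (norm_nonneg _) ?_
    rw [Real.norm_of_nonneg (div_nonneg (injNum_nonneg hℓ m d) hpos.le), div_le_one hpos]
    exact injNum_le hℓ m d

/-- Expand the indicator of a trivial kernel by Möbius inversion and average term by term with
`symAvg_prod_sub`. The series defining `invProb` stops at the size of the matrix. -/
theorem symAvg_eq_one [Fact ℓ.Prime] {κ : Type} [Fintype κ] [DecidableEq κ] :
    symAvg κ ℓ (fun t => if t = 1 then 1 else 0) = invProb ℓ (Fintype.card κ) := by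
  have hℓ1 := one_lt_cast hℓ
  have hind : ∀ D : symMat κ ℓ, (if kerCard D.1 = 1 then (1 : ℝ) else 0) =
      ∑ d ∈ Finset.range (Fintype.card κ + 1), mobCoeff ℓ d *
        ∏ i ∈ Finset.range d, ((kerCard D.1 : ℝ) - (ℓ : ℝ) ^ i) := by
    intro D
    rw [kerCard_eq_pow]
    set w := Module.finrank (ZMod ℓ) (LinearMap.ker D.1.mulVecLin) with hw
    have hle : w ≤ Fintype.card κ := by
      have := Submodule.finrank_le (LinearMap.ker D.1.mulVecLin)
      rwa [Module.finrank_fintype_fun_eq_card] at this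
    have h1 := sum_mobCoeff hℓ w
    -- The extra terms vanish; a summation range independent of the matrix allows the sums to be
    -- exchanged.
    have h2 : ∑ d ∈ Finset.range (Fintype.card κ + 1), mobCoeff ℓ d * injNum ℓ w d =
        ∑ d ∈ Finset.range (w + 1), mobCoeff ℓ d * injNum ℓ w d := by
      symm
      refine Finset.sum_subset (Finset.range_mono (by omega)) fun d _ hd => ?_
      rw [injNum_of_lt ℓ (by simpa using hd), mul_zero]
    have h3 : ℓ ^ w = 1 ↔ w = 0 := by
      rw [Nat.pow_eq_one]
      constructor
      · rintro (h | h)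
        · omega
        · exact h
      · exact Or.inr
    rw [Nat.cast_pow]
    simp only [h3]
    rw [← h1, ← h2]
    rfl
  have h0 : symAvg κ ℓ (fun t => if t = 1 then 1 else 0) =
      ∑ d ∈ Finset.range (Fintype.card κ + 1), mobCoeff ℓ d *
        symAvg κ ℓ (fun t => ∏ i ∈ Finset.range d, ((t : ℝ) - (ℓ : ℝ) ^ i)) := by
    rw [symAvg, Finset.sum_congr rfl fun D _ => hind D, Finset.sum_comm, Finset.sum_div]
    refine Finset.sum_congr rfl fun d _ => ?_
    rw [symAvg, ← Finset.mul_sum, mul_div_assoc]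
  rw [h0, invProb, tsum_eq_sum (s := Finset.range (Fintype.card κ + 1))]
  · refine Finset.sum_congr rfl fun d _ => ?_
    rw [symAvg_prod_sub, invTerm, injNum]
    ring
  · intro d hd
    rw [injNum_of_lt ℓ (by simpa using hd)]
    simp

end QSeries

/-! ### Haar measure in coordinates: independent symmetric entries -/

section Haar

variable {ℓ : ℕ} [Fact ℓ.Prime] {g : ℕ}

instance : (haarSkew ℓ g).IsAddHaarMeasure := by
  unfold haarSkew
  infer_instance

instance : IsProbabilityMeasure (haarSkew ℓ g) := by
  refine ⟨?_⟩
  have h := Measure.addHaarMeasure_self (G := skewSymplectic ℓ g) (K₀ := ⊤)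
  exact h

/-- The fibres of a homomorphism onto a finite group with measurable fibres have equal measure. -/
theorem haarSkew_fiber {A : Type*} [AddCommGroup A] [Finite A] (Φ : skewSymplectic ℓ g →+ A)
    (hΦ : Function.Surjective Φ) (hmeas : ∀ a, MeasurableSet (Φ ⁻¹' {a})) (a : A) :
    haarSkew ℓ g (Φ ⁻¹' {a}) = (Nat.card A : ℝ≥0∞)⁻¹ := by
  have := Fintype.ofFinite A
  have heq : ∀ b, haarSkew ℓ g (Φ ⁻¹' {b}) = haarSkew ℓ g (Φ ⁻¹' {a}) := by
    intro b
    -- Translation by a preimage of a - b carries one fibre to the other.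
    obtain ⟨M, hM⟩ := hΦ (a - b)
    rw [← measure_preimage_add (haarSkew ℓ g) M (Φ ⁻¹' {a})]
    congr 1
    ext N
    simp only [Set.mem_preimage, Set.mem_singleton_iff, map_add, hM]
    constructor
    · rintro rfl
      abel
    · intro h
      rw [← sub_eq_zero] at h ⊢
      rw [← h]
      abel
  have hsum : ∑ b : A, haarSkew ℓ g (Φ ⁻¹' {b}) = 1 := by
    rw [← measure_biUnion_finset (fun b _ c _ hbc => ?_) (fun b _ => hmeas b)]
    · rw [← measure_univ (μ := haarSkew ℓ g)]
      congr 1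
      ext N
      simp
    · exact Disjoint.preimage _ (by simpa using hbc)
  rw [Finset.sum_congr rfl fun b _ => heq b, Finset.sum_const, Finset.card_univ, nsmul_eq_mul] at hsum
  rw [Nat.card_eq_fintype_card]
  exact ENNReal.eq_inv_of_mul_eq_one_left (by rw [mul_comm]; exact hsum)

theorem isOpen_toZModPow_preimage (m : ℕ) (z : ZMod (ℓ ^ m)) :
    IsOpen {c : ℤ_[ℓ] | PadicInt.toZModPow m c = z} := by
  rw [Metric.isOpen_iff]
  intro c hc
  have hpos : (0 : ℝ) < (ℓ : ℝ) ^ (-(m : ℤ)) := zpow_pos (by exact_mod_cast prime_pos (ℓ := ℓ)) _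
  refine ⟨(ℓ : ℝ) ^ (-(m : ℤ)), hpos, fun d hd => ?_⟩
  have h : PadicInt.toZModPow m (d - c) = 0 := by
    rw [← RingHom.mem_ker, PadicInt.ker_toZModPow, ← PadicInt.norm_le_pow_iff_mem_span_pow]
    rw [Metric.mem_ball, dist_eq_norm] at hd
    exact hd.le
  rw [map_sub, sub_eq_zero] at h
  exact h.trans hc

theorem continuous_sympForm_mulVec (v w : Lattice ℓ g) :
    Continuous fun M : skewSymplectic ℓ g => sympForm (M.1.mulVec v) w := by
  have h : Continuous fun M : Mat ℓ g => sympForm (M.mulVec v) w := by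
    unfold sympForm Matrix.mulVec dotProduct
    fun_prop
  exact h.comp continuous_subtype_val

theorem measurableSet_dvd_sympForm (e : ℕ) (v w : Lattice ℓ g) (c : ℤ_[ℓ]) :
    MeasurableSet {M : skewSymplectic ℓ g | (ℓ : ℤ_[ℓ]) ^ e ∣ sympForm (M.1.mulVec v) w - c} := by
  have : {M : skewSymplectic ℓ g | (ℓ : ℤ_[ℓ]) ^ e ∣ sympForm (M.1.mulVec v) w - c} =
      (fun M : skewSymplectic ℓ g => sympForm (M.1.mulVec v) w) ⁻¹'
        {d | PadicInt.toZModPow e d = PadicInt.toZModPow e c} := by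
    ext M
    rw [Set.mem_ofPred_eq, Set.mem_preimage, Set.mem_ofPred_eq, ← toZModPow_eq_zero, map_sub,
      sub_eq_zero]
  rw [this]
  exact ((isOpen_toZModPow_preimage e _).preimage (continuous_sympForm_mulVec v w)).measurableSet

theorem sympForm_neg_left (v w : Lattice ℓ g) : sympForm (-v) w = - sympForm v w := by
  rw [← neg_one_smul ℤ_[ℓ] v, sympForm_smul_left]; ring

theorem sympForm_sub_left (v v' w : Lattice ℓ g) :
    sympForm (v - v') w = sympForm v w - sympForm v' w := by
  rw [sub_eq_add_neg, sympForm_add_left, sympForm_neg_left]; ring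

theorem sympForm_zero_left (w : Lattice ℓ g) : sympForm 0 w = 0 := by
  simp [sympForm]

theorem sympForm_sum_left {κ : Type*} (s : Finset κ) (v : κ → Lattice ℓ g) (w : Lattice ℓ g) :
    sympForm (∑ i ∈ s, v i) w = ∑ i ∈ s, sympForm (v i) w := by
  classical
  induction s using Finset.induction_on with
  | empty => simp [sympForm_zero_left]
  | insert a s ha ih => rw [Finset.sum_insert ha, Finset.sum_insert ha, sympForm_add_left, ih]

theorem sympForm_sum_right {κ : Type*} (s : Finset κ) (v : κ → Lattice ℓ g) (w : Lattice ℓ g) :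
    sympForm w (∑ i ∈ s, v i) = ∑ i ∈ s, sympForm w (v i) := by
  rw [sympForm_swap, sympForm_sum_left, ← Finset.sum_neg_distrib]
  exact Finset.sum_congr rfl fun i _ => by rw [sympForm_swap (v i), neg_neg]

theorem sympForm_nondegenerate {v : Lattice ℓ g} (h : ∀ w, sympForm v w = 0) : v = 0 := by
  ext k
  rcases k with i | i
  · have := h (fVec i)
    rwa [sympForm_fVec_right] at this
  · have := h (eVec i)
    rw [sympForm_eVec_right, neg_eq_zero] at this
    exact this

/-- Every linear functional is of the form `⟨•, s⟩`. -/
theorem exists_sympForm_eq_linear (φ : Lattice ℓ g →ₗ[ℤ_[ℓ]] ℤ_[ℓ]) : ∃ s, ∀ x, φ x = sympForm x s := by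
  refine ⟨Sum.elim (fun i => - φ (fVec i)) (fun i => φ (eVec i)), fun x => ?_⟩
  conv_lhs => rw [lattice_eq_sum x]
  simp only [map_sum, map_add, map_smul, sympForm, Sum.elim_inl, Sum.elim_inr, smul_eq_mul]
  exact Finset.sum_congr rfl fun i _ => by ring

/-- A basis of `ℤ_ℓ^{2g}` and its dual basis for the symplectic form. -/
structure DualBases (ℓ g : ℕ) [Fact ℓ.Prime] (ι : Type) [Fintype ι] [LinearOrder ι] where
  v : ι → Lattice ℓ g
  b : ι → Lattice ℓ g
  dual : ∀ i j, sympForm (v i) (b j) = if i = j then 1 else 0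
  eq_sum_v : ∀ x, x = ∑ i, sympForm x (b i) • v i

variable {ι : Type} [Fintype ι] [LinearOrder ι] (B : DualBases ℓ g ι)

namespace DualBases

/-- The dual bases of an arbitrary basis. -/
theorem exists_of_basis (β : Module.Basis ι ℤ_[ℓ] (Lattice ℓ g)) : ∃ B : DualBases ℓ g ι, B.v = β := by
  choose s hs using fun i => exists_sympForm_eq_linear (β.coord i)
  refine ⟨⟨β, s, fun i j => ?_, fun x => ?_⟩, rfl⟩
  · rw [← hs, Module.Basis.coord_apply, Module.Basis.repr_self, Finsupp.single_apply]
  · conv_lhs => rw [← β.sum_repr x]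
    exact Finset.sum_congr rfl fun i _ => by rw [← hs, Module.Basis.coord_apply]

theorem eq_sum_b (x : Lattice ℓ g) : x = ∑ i, sympForm (B.v i) x • B.b i := by
  rw [← sub_eq_zero]
  apply sympForm_nondegenerate
  intro w
  rw [sympForm_swap, neg_eq_zero, B.eq_sum_v w, sympForm_sum_left]
  refine Finset.sum_eq_zero fun j _ => ?_
  have h : ∀ y z, sympForm (B.v j) (y - z) = sympForm (B.v j) y - sympForm (B.v j) z := by
    intro y z
    rw [sympForm_swap, sympForm_sub_left, sympForm_swap y, sympForm_swap z]
    ring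
  rw [sympForm_smul_left, h]
  simp [sympForm_sum_right, sympForm_smul_right, B.dual]

/-- The matrix entries `⟨M b_j, b_i⟩`. -/
def entry (M : Mat ℓ g) (i j : ι) : ℤ_[ℓ] := sympForm (M.mulVec (B.b j)) (B.b i)

/-- Skewness of M and skewness of the form cancel, so ⟨M·,·⟩ is symmetric. -/
theorem entry_symm {M : Mat ℓ g} (hM : M ∈ skewSymplectic ℓ g) (i j : ι) :
    B.entry M i j = B.entry M j i := by
  have h : ∀ v w, sympForm (M.mulVec v) w = - sympForm v (M.mulVec w) := hM
  rw [entry, h, entry, sympForm_swap (B.b j), neg_neg]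

/-- The matrix is x ↦ ∑ s_ij ⟨v_j, x⟩ v_i. Every symmetric array occurs, which makes the entries
with i ≤ j independent under Haar measure. -/
theorem exists_entry_eq (s : ι → ι → ℤ_[ℓ]) (hs : ∀ i j, s i j = s j i) :
    ∃ M ∈ skewSymplectic ℓ g, ∀ i j, B.entry M i j = s i j := by
  let L : Lattice ℓ g →ₗ[ℤ_[ℓ]] Lattice ℓ g :=
    { toFun := fun x => ∑ i, ∑ j, (s i j * sympForm (B.v j) x) • B.v i
      map_add' := fun x y => by
        simp only [sympForm_add_right, mul_add, add_smul, Finset.sum_add_distrib]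
      map_smul' := fun c x => by
        simp only [sympForm_smul_right, Finset.smul_sum, smul_smul, RingHom.id_apply]
        exact Finset.sum_congr rfl fun i _ => Finset.sum_congr rfl fun j _ => by
          congr 1; ring }
  have hL : ∀ x y, sympForm (L x) y = ∑ i, ∑ j, s i j * sympForm (B.v j) x * sympForm (B.v i) y := by
    intro x y
    change sympForm (∑ i, ∑ j, _) y = _
    simp only [sympForm_sum_left, sympForm_smul_left]
  have hmul : ∀ x, (LinearMap.toMatrix' L).mulVec x = L x := fun x => by
    rw [← Matrix.mulVecLin_apply, ← Matrix.toLin'_apply', Matrix.toLin'_toMatrix']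
  refine ⟨LinearMap.toMatrix' L, ?_, fun i j => ?_⟩
  · intro x y
    rw [hmul, hmul, sympForm_swap x, neg_neg, hL, hL, Finset.sum_comm]
    exact Finset.sum_congr rfl fun i _ => Finset.sum_congr rfl fun j _ => by
      rw [hs]; ring
  · rw [entry, hmul, hL]
    simp [B.dual]

end DualBases

/-- The probability that the entries of a random matrix satisfy given congruences. -/
theorem haarSkew_entries (B : DualBases ℓ g ι) (e : ι → ι → ℕ) (σ : ι → ι → ℤ_[ℓ]) :
    haarSkew ℓ g {M | ∀ i j, i ≤ j → (ℓ : ℤ_[ℓ]) ^ e i j ∣ B.entry M.1 i j - σ i j} =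
      ∏ p : {p : ι × ι // p.1 ≤ p.2}, ((ℓ : ℝ≥0∞) ^ e p.1.1 p.1.2)⁻¹ := by
  let A := ∀ p : {p : ι × ι // p.1 ≤ p.2}, ZMod (ℓ ^ e p.1.1 p.1.2)
  let Φ : skewSymplectic ℓ g →+ A :=
    { toFun := fun M p => PadicInt.toZModPow _ (B.entry M.1 p.1.1 p.1.2)
      map_zero' := by
        funext p
        change PadicInt.toZModPow _ (B.entry 0 _ _) = 0
        rw [DualBases.entry, Matrix.zero_mulVec, sympForm_zero_left, map_zero]
      map_add' := fun M N => by
        funext p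
        change PadicInt.toZModPow _ (B.entry (M.1 + N.1) _ _) =
          PadicInt.toZModPow _ (B.entry M.1 _ _) + PadicInt.toZModPow _ (B.entry N.1 _ _)
        rw [DualBases.entry, Matrix.add_mulVec, sympForm_add_left, map_add]
        rfl }
  have hsurj : Function.Surjective Φ := by
    intro a
    choose c hc using fun p : {p : ι × ι // p.1 ≤ p.2} =>
      ZMod.ringHom_surjective (PadicInt.toZModPow (e p.1.1 p.1.2)) (a p)
    -- The prescribed upper triangle is extended by symmetry; the final value 0 is never reached,
    -- the order being total.
    obtain ⟨M, hM, h⟩ := B.exists_entry_eq (fun i j => if h : i ≤ j then c ⟨(i, j), h⟩ else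
        if h : j ≤ i then c ⟨(j, i), h⟩ else 0) (fun i j => by
      by_cases h1 : i ≤ j
      · by_cases h2 : j ≤ i
        · obtain rfl := le_antisymm h1 h2
          rfl
        · simp [h1, h2]
      · have h2 : j ≤ i := (not_le.mp h1).le
        simp [h1, h2])
    refine ⟨⟨M, hM⟩, funext fun p => ?_⟩
    change PadicInt.toZModPow _ (B.entry M p.1.1 p.1.2) = _
    rw [h, dif_pos p.2]
    exact hc p
  have hset : {M : skewSymplectic ℓ g | ∀ i j, i ≤ j → (ℓ : ℤ_[ℓ]) ^ e i j ∣ B.entry M.1 i j - σ i j} =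
      Φ ⁻¹' {fun p => PadicInt.toZModPow _ (σ p.1.1 p.1.2)} := by
    ext M
    rw [Set.mem_preimage, Set.mem_singleton_iff, funext_iff, Subtype.forall, Prod.forall]
    refine forall_congr' fun i => forall_congr' fun j => forall_congr' fun h => ?_
    rw [← toZModPow_eq_zero, map_sub, sub_eq_zero]
    rfl
  have hmeas : ∀ a : A, MeasurableSet (Φ ⁻¹' {a}) := by
    intro a
    obtain ⟨M0, rfl⟩ := hsurj a
    have : Φ ⁻¹' {Φ M0} = ⋂ p : {p : ι × ι // p.1 ≤ p.2}, {M : skewSymplectic ℓ g |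
        (ℓ : ℤ_[ℓ]) ^ e p.1.1 p.1.2 ∣ sympForm (M.1.mulVec (B.b p.1.2)) (B.b p.1.1) -
          B.entry M0.1 p.1.1 p.1.2} := by
      ext M
      rw [Set.mem_preimage, Set.mem_singleton_iff, funext_iff, Set.mem_iInter]
      refine forall_congr' fun p => ?_
      rw [Set.mem_ofPred_eq, ← toZModPow_eq_zero, map_sub, sub_eq_zero]
      rfl
    rw [this]
    exact MeasurableSet.iInter fun p => measurableSet_dvd_sympForm _ _ _ _
  rw [hset, haarSkew_fiber Φ hsurj hmeas, Nat.card_pi, Nat.cast_prod, ENNReal.prod_inv_distrib]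
  · refine Finset.prod_congr rfl fun p _ => ?_
    rw [Nat.card_zmod, Nat.cast_pow]
  · intro p _ q _ _
    exact Or.inr (ENNReal.natCast_ne_top _)

theorem measurableSet_entries (B : DualBases ℓ g ι) (e : ι → ι → ℕ) (σ : ι → ι → ℤ_[ℓ]) :
    MeasurableSet {M : skewSymplectic ℓ g |
      ∀ i j, i ≤ j → (ℓ : ℤ_[ℓ]) ^ e i j ∣ B.entry M.1 i j - σ i j} := by
  have : {M : skewSymplectic ℓ g | ∀ i j, i ≤ j → (ℓ : ℤ_[ℓ]) ^ e i j ∣ B.entry M.1 i j - σ i j} =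
      ⋂ i, ⋂ j, ⋂ _ : i ≤ j, {M : skewSymplectic ℓ g |
        (ℓ : ℤ_[ℓ]) ^ e i j ∣ sympForm (M.1.mulVec (B.b j)) (B.b i) - σ i j} := by
    ext M
    simp only [Set.mem_ofPred_eq, Set.mem_iInter]
    rfl
  rw [this]
  exact MeasurableSet.iInter fun i => MeasurableSet.iInter fun j => MeasurableSet.iInter fun _ =>
    measurableSet_dvd_sympForm _ _ _ _

end Haar

/-! ### Bases adapted to a surjection, and morphisms described on the lattice -/

section Adapted

variable {ℓ : ℕ} [Fact ℓ.Prime] {g n : ℕ}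

theorem natCast_padic_ne_zero : (ℓ : ℤ_[ℓ]) ≠ 0 := by
  exact_mod_cast (Fact.out : ℓ.Prime).ne_zero

theorem exists_comp_eq_of_ker_le {V A B : Type*} [AddCommGroup V] [AddCommGroup A] [AddCommGroup B]
    (F : V →+ A) (hF : Function.Surjective F) (φ : V →+ B) (h : ∀ x, F x = 0 → φ x = 0) :
    ∃ φ' : A →+ B, ∀ x, φ' (F x) = φ x := by
  obtain ⟨s, hs⟩ := hF.hasRightInverse
  refine ⟨F.liftOfRightInverse s hs ⟨φ, fun x hx => h x hx⟩, fun x => ?_⟩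
  exact F.liftOfRightInverse_comp_apply s hs ⟨φ, fun x hx => h x hx⟩ x

/-- Additive maps to a group killed by ℓ^k are automatically compatible with the ℤ_ℓ-action, through
integer approximations of the scalar. -/
theorem map_natCast_add_smul {A : Type*} [AddCommGroup A] (F : Lattice ℓ g →+ A) {k : ℕ}
    (hk : ∀ a : A, ℓ ^ k • a = 0) (m : ℕ) (d : ℤ_[ℓ]) (x : Lattice ℓ g) :
    F (((m : ℤ_[ℓ]) + (ℓ : ℤ_[ℓ]) ^ k * d) • x) = m • F x := by
  rw [add_smul, mul_smul, Nat.cast_smul_eq_nsmul, ← Nat.cast_pow, Nat.cast_smul_eq_nsmul,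
    map_add, map_nsmul, map_nsmul, hk, add_zero]

theorem map_smul_eq_zero {A : Type*} [AddCommGroup A] (F : Lattice ℓ g →+ A) {k : ℕ}
    (hk : ∀ a : A, ℓ ^ k • a = 0) (c : ℤ_[ℓ]) {x : Lattice ℓ g} (hx : F x = 0) : F (c • x) = 0 := by
  obtain ⟨m, d, rfl⟩ := exists_natCast_add k c
  rw [map_natCast_add_smul F hk, hx, smul_zero]

/-- Dual bases in which the kernel of `F` is diagonal. -/
structure AdaptedBases {A : Type*} [AddCommGroup A] (F : Lattice ℓ g →+ A) (ι : Type) [Fintype ι]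
    [LinearOrder ι] extends DualBases ℓ g ι where
  lam : ι → ℕ
  mem_ker : ∀ x, F x = 0 ↔ ∀ i, (ℓ : ℤ_[ℓ]) ^ lam i ∣ sympForm x (b i)

/-- Smith normal form of ker F inside the lattice, together with the dual basis for the symplectic
form. -/
theorem AdaptedBases.exists {A : Type*} [AddCommGroup A] (F : Lattice ℓ g →+ A) {k : ℕ}
    (hk : ∀ a : A, ℓ ^ k • a = 0) : Nonempty (AdaptedBases F (Fin (g + g))) := by
  let K : Submodule ℤ_[ℓ] (Lattice ℓ g) :=
    { carrier := {x | F x = 0}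
      zero_mem' := map_zero F
      add_mem' := fun {x y} hx hy => by
        change F (x + y) = 0
        rw [map_add, show F x = 0 from hx, show F y = 0 from hy, add_zero]
      smul_mem' := fun c x hx => map_smul_eq_zero F hk c hx }
  have hl : (ℓ : ℤ_[ℓ]) ^ k ≠ 0 := pow_ne_zero _ natCast_padic_ne_zero
  let β : Module.Basis (Fin (g + g)) ℤ_[ℓ] (Lattice ℓ g) :=
    (Pi.basisFun ℤ_[ℓ] (Fin g ⊕ Fin g)).reindex finSumFinEquiv
  -- The kernel contains ℓ^k times the lattice, so it has full rank and no elementary divisor is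
  -- zero.
  have hrank : Module.finrank ℤ_[ℓ] K = Module.finrank ℤ_[ℓ] (Lattice ℓ g) := by
    refine le_antisymm (Submodule.finrank_le K) ?_
    let L : Lattice ℓ g →ₗ[ℤ_[ℓ]] K :=
      ((ℓ : ℤ_[ℓ]) ^ k • (LinearMap.id : Lattice ℓ g →ₗ[ℤ_[ℓ]] Lattice ℓ g)).codRestrict K
        (fun x => by
          change F ((ℓ : ℤ_[ℓ]) ^ k • x) = 0
          rw [← Nat.cast_pow, Nat.cast_smul_eq_nsmul, map_nsmul, hk])
    refine LinearMap.finrank_le_finrank_of_injective (f := L) ?_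
    intro x y hxy
    have h : (ℓ : ℤ_[ℓ]) ^ k • x = (ℓ : ℤ_[ℓ]) ^ k • y := congrArg Subtype.val hxy
    funext i
    exact mul_left_cancel₀ hl (congrFun h i)
  obtain ⟨b', a, ab, hab⟩ := Submodule.exists_smith_normal_form_of_rank_eq β hrank
  obtain ⟨B, hB⟩ := DualBases.exists_of_basis b'
  have ha : ∀ i, a i ≠ 0 := by
    intro i h
    have h1 := hab i
    rw [h, zero_smul] at h1
    exact ab.ne_zero i (Subtype.ext h1)
  -- An elementary divisor is a unit times a power of ℓ, and only the exponent matters.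
  have hdvd : ∀ i y, (ℓ : ℤ_[ℓ]) ^ (a i).valuation ∣ y ↔ a i ∣ y := by
    intro i y
    have h : Associated ((ℓ : ℤ_[ℓ]) ^ (a i).valuation) (a i) :=
      ⟨PadicInt.unitCoeff (ha i), by rw [mul_comm]; exact (PadicInt.unitCoeff_spec (ha i)).symm⟩
    exact h.dvd_iff_dvd_left
  refine ⟨⟨B, fun i => (a i).valuation, fun x => ?_⟩⟩
  simp only [hdvd]
  constructor
  · intro hx i
    have h := congrArg Subtype.val (ab.sum_repr ⟨x, hx⟩)
    rw [Submodule.coe_sum] at h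
    change _ = x at h
    rw [← h, sympForm_sum_left]
    refine Finset.dvd_sum fun j _ => ?_
    rw [Submodule.coe_smul, hab, ← hB, sympForm_smul_left, sympForm_smul_left, B.dual]
    split_ifs with hji
    · subst hji
      rw [mul_one]
      exact Dvd.intro_left _ rfl
    · simp
  · intro h
    choose c hc using h
    have hx : x = ∑ i, c i • (ab i : Lattice ℓ g) := by
      conv_lhs => rw [B.eq_sum_v x]
      refine Finset.sum_congr rfl fun i _ => ?_
      rw [hc, hab, ← hB, smul_smul, mul_comm]
    change x ∈ K
    rw [hx]
    exact sum_mem fun i _ => K.smul_mem _ (ab i).2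

/-- The image of `∑ e_i ∧ f_i` under `F ⊗ F`. -/
def latOmega {A : Type*} [AddCommGroup A] (F : Lattice ℓ g →+ A) : A ⊗[ℤ] A :=
  ∑ i, (F (eVec i) ⊗ₜ[ℤ] F (fVec i) - F (fVec i) ⊗ₜ[ℤ] F (eVec i))

/-- The tensor ∑ e_i ∧ f_i is inverse to the symplectic form, so pairing it with the functionals ⟨·,
s⟩ and ⟨·, t⟩ returns ⟨s, t⟩. This turns conditions on ω into symplectic ones. -/
theorem evalPair_latOmega {A : Type*} [AddCommGroup A] (F : Lattice ℓ g →+ A) {m : ℕ}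
    {a b : A →+ ZMod (ℓ ^ m)} {s t : Lattice ℓ g}
    (ha : ∀ x, a (F x) = PadicInt.toZModPow m (sympForm x s))
    (hb : ∀ x, b (F x) = PadicInt.toZModPow m (sympForm x t)) :
    evalPair a b (latOmega F) = PadicInt.toZModPow m (sympForm s t) := by
  have e : ∀ x y, evalPair a b (x ⊗ₜ[ℤ] y) = a x * b y := fun x y => rfl
  rw [latOmega, map_sum, sympForm, map_sum]
  refine Finset.sum_congr rfl fun i _ => ?_
  rw [map_sub, e, e, ha, ha, hb, hb, sympForm_eVec, sympForm_eVec, sympForm_fVec, sympForm_fVec,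
    ← map_mul, ← map_mul, ← map_sub]
  congr 1
  ring

/-- The functional `⟨•, s⟩ mod ℓ^m`. -/
def pairMod (m : ℕ) (s : Lattice ℓ g) : Lattice ℓ g →+ ZMod (ℓ ^ m) where
  toFun x := PadicInt.toZModPow m (sympForm x s)
  map_zero' := by rw [sympForm_zero_left, map_zero]
  map_add' x y := by rw [sympForm_add_left, map_add]

variable {A : Type*} [AddCommGroup A]

theorem exists_hom_of_pairMod (F : Lattice ℓ g →+ A) (hF : Function.Surjective F) (m : ℕ)
    (s : Lattice ℓ g) (hs : ∀ x, F x = 0 → (ℓ : ℤ_[ℓ]) ^ m ∣ sympForm x s) :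
    ∃ a : A →+ ZMod (ℓ ^ m), ∀ x, a (F x) = PadicInt.toZModPow m (sympForm x s) :=
  exists_comp_eq_of_ker_le F hF (pairMod m s) fun x hx => (toZModPow_eq_zero m _).mpr (hs x hx)

/-- The character `⟨•, s / ℓ^n⟩` of `A`. -/
def charOf (n : ℕ) {F : Lattice ℓ g →+ A} (hF : Function.Surjective F) (s : Lattice ℓ g)
    (hs : ∀ x, F x = 0 → (ℓ : ℤ_[ℓ]) ^ n ∣ sympForm x s) :
    AddSubgroup.torsionBy (Dual A) ((ℓ ^ n : ℕ) : ℤ) :=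
  ⟨(toQZ (ℓ ^ n)).comp (exists_hom_of_pairMod F hF n s hs).choose, by
    rw [mem_torsionBy_natCast]
    ext x
    change ℓ ^ n • toQZ _ _ = 0
    rw [← map_nsmul, nsmul_eq_mul, ZMod.natCast_self, zero_mul, map_zero]⟩

theorem charOf_apply {F : Lattice ℓ g →+ A} (hF : Function.Surjective F) (s : Lattice ℓ g)
    (hs : ∀ x, F x = 0 → (ℓ : ℤ_[ℓ]) ^ n ∣ sympForm x s) (x : Lattice ℓ g) :
    (charOf n hF s hs).1 (F x) = toQZ (ℓ ^ n) (PadicInt.toZModPow n (sympForm x s)) := by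
  change toQZ (ℓ ^ n) ((exists_hom_of_pairMod F hF n s hs).choose (F x)) = _
  rw [(exists_hom_of_pairMod F hF n s hs).choose_spec]

theorem eq_charOf {F : Lattice ℓ g →+ A} (hF : Function.Surjective F) (s : Lattice ℓ g)
    (hs : ∀ x, F x = 0 → (ℓ : ℤ_[ℓ]) ^ n ∣ sympForm x s)
    (γ : AddSubgroup.torsionBy (Dual A) ((ℓ ^ n : ℕ) : ℤ))
    (hγ : ∀ x, γ.1 (F x) = toQZ (ℓ ^ n) (PadicInt.toZModPow n (sympForm x s))) :
    γ = charOf n hF s hs := by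
  apply Subtype.ext
  ext y
  obtain ⟨x, rfl⟩ := hF y
  rw [hγ, charOf_apply]

theorem dvd_of_char {F : Lattice ℓ g →+ A} (γ : Dual A) (s : Lattice ℓ g)
    (hγ : ∀ x, γ (F x) = toQZ (ℓ ^ n) (PadicInt.toZModPow n (sympForm x s)))
    (x : Lattice ℓ g) (hx : F x = 0) : (ℓ : ℤ_[ℓ]) ^ n ∣ sympForm x s := by
  have h := hγ x
  rw [hx, map_zero] at h
  rw [← toZModPow_eq_zero]
  apply toQZ_injective _ (pow_pos_of_prime n)
  rw [← h, map_zero]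

/-- `F` induces a morphism of bilinearly enhanced groups `G_M → Y`. -/
structure LiftsMor (Y : BEG ℓ n) (M : Mat ℓ g) (F : Lattice ℓ g →+ Y.carrier) : Prop where
  shift_eq_zero : ∀ x, F (shift n M x) = 0
  omega : latOmega F = Y.ω
  psi : ∀ (γ : AddSubgroup.torsionBy (Dual Y.carrier) ((ℓ ^ n : ℕ) : ℤ)) (s u : Lattice ℓ g),
    (∀ x, γ.1 (F x) = toQZ (ℓ ^ n) (PadicInt.toZModPow n (sympForm x s))) →
      shift n M s = (ℓ : ℤ_[ℓ]) ^ n • u → F u = (Y.ψ γ : Y.carrier)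

theorem pow_smul_injective (k : ℕ) {u v : Lattice ℓ g}
    (h : (ℓ : ℤ_[ℓ]) ^ k • u = (ℓ : ℤ_[ℓ]) ^ k • v) : u = v := by
  funext i
  exact mul_left_cancel₀ (pow_ne_zero k natCast_padic_ne_zero) (congrFun h i)

/-- The relation between `ψ` and `ω`, on the lattice. -/
theorem lattice_compat (Y : BEG ℓ n) {F : Lattice ℓ g →+ Y.carrier} (hF : Function.Surjective F)
    (hω : latOmega F = Y.ω) (r : ℕ) {s t P Q : Lattice ℓ g}
    (hs : ∀ x, F x = 0 → (ℓ : ℤ_[ℓ]) ^ (n + r) ∣ sympForm x s)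
    (ht : ∀ x, F x = 0 → (ℓ : ℤ_[ℓ]) ^ (n + r) ∣ sympForm x t)
    (hP : ∀ γ : AddSubgroup.torsionBy (Dual Y.carrier) ((ℓ ^ n : ℕ) : ℤ), 
      (∀ x, γ.1 (F x) = toQZ (ℓ ^ n) (PadicInt.toZModPow n (sympForm x s))) → F P = Y.ψ γ)
    (hQ : ∀ γ : AddSubgroup.torsionBy (Dual Y.carrier) ((ℓ ^ n : ℕ) : ℤ), 
      (∀ x, γ.1 (F x) = toQZ (ℓ ^ n) (PadicInt.toZModPow n (sympForm x t))) → F Q = Y.ψ γ) :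
    (ℓ : ℤ_[ℓ]) ^ (n + r) ∣ sympForm P t - sympForm Q s - 2 * sympForm s t := by
  obtain ⟨a, ha⟩ := exists_hom_of_pairMod F hF (n + r) s hs
  obtain ⟨b, hb⟩ := exists_hom_of_pairMod F hF (n + r) t ht
  have hsc : ∀ (a : Y.carrier →+ ZMod (ℓ ^ (n + r))) (s : Lattice ℓ g),
      (∀ x, a (F x) = PadicInt.toZModPow (n + r) (sympForm x s)) → ∀ x,
      (scaledDual ℓ n r a).1 (F x) = toQZ (ℓ ^ n) (PadicInt.toZModPow n (sympForm x s)) := by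
    intro a s ha x
    rw [← toZModPow_add_smul n r, ← ha]
    rfl
  have h := Y.compat r a b
  rw [← hP _ (hsc a s ha), ← hQ _ (hsc b t hb), ← hω, evalPair_latOmega F ha hb, hb, ha,
    ← map_nsmul, ← map_add] at h
  have h' := toQZ_injective _ (pow_pos_of_prime (n + r)) h
  rw [← toZModPow_eq_zero, map_sub, map_sub, h', map_mul, map_ofNat, nsmul_eq_mul, Nat.cast_two]
  ring

namespace AdaptedBases

variable {Y : BEG ℓ n} {F : Lattice ℓ g →+ Y.carrier} {ι : Type} [Fintype ι] [LinearOrder ι]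

section

variable {F : Lattice ℓ g →+ A} (B : AdaptedBases F ι)

/-- The exponents of `A[ℓ^n]`. -/
def mu (n : ℕ) (i : ι) : ℕ := min (B.lam i) n

theorem mu_le (n : ℕ) (i : ι) : B.mu n i ≤ n := min_le_right _ _

theorem mu_le_lam (n : ℕ) (i : ι) : B.mu n i ≤ B.lam i := min_le_left _ _

theorem map_pow_smul_v (i : ι) : F ((ℓ : ℤ_[ℓ]) ^ B.lam i • B.v i) = 0 := by
  rw [B.mem_ker]
  intro j
  rw [sympForm_smul_left, B.dual]
  split_ifs with h
  · subst h; simp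
  · simp

theorem dvd_charVec (n : ℕ) (j : ι) (x : Lattice ℓ g) (hx : F x = 0) :
    (ℓ : ℤ_[ℓ]) ^ n ∣ sympForm x ((ℓ : ℤ_[ℓ]) ^ (n - B.mu n j) • B.b j) := by
  rw [sympForm_smul_right]
  have h := (B.mem_ker x).mp hx j
  have : n ≤ (n - B.mu n j) + B.lam j := by
    have := B.mu_le_lam n j
    omega
  refine (pow_dvd_pow _ this).trans ?_
  rw [pow_add]
  exact mul_dvd_mul_left _ h

end

variable (B : AdaptedBases F ι) (hF : Function.Surjective F)

/-- The basic characters of `A[ℓ^n]`. -/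
def char (j : ι) : AddSubgroup.torsionBy (Dual Y.carrier) ((ℓ ^ n : ℕ) : ℤ) :=
  charOf n hF ((ℓ : ℤ_[ℓ]) ^ (n - B.mu n j) • B.b j) (B.dvd_charVec n j)

theorem char_apply (j : ι) (x : Lattice ℓ g) : (B.char hF j).1 (F x) =
    toQZ (ℓ ^ n) (PadicInt.toZModPow n (sympForm x ((ℓ : ℤ_[ℓ]) ^ (n - B.mu n j) • B.b j))) :=
  charOf_apply hF _ _ x

theorem pow_smul_char (j : ι) : ℓ ^ B.mu n j • B.char hF j = 0 := by
  apply Subtype.ext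
  ext y
  obtain ⟨x, rfl⟩ := hF y
  change ℓ ^ B.mu n j • (B.char hF j).1 (F x) = 0
  rw [char_apply, ← map_nsmul, ← map_nsmul]
  have : PadicInt.toZModPow n
      (ℓ ^ B.mu n j • sympForm x ((ℓ : ℤ_[ℓ]) ^ (n - B.mu n j) • B.b j)) = 0 := by
    rw [toZModPow_eq_zero, nsmul_eq_mul, sympForm_smul_right, ← mul_assoc, Nat.cast_pow, ← pow_add]
    have := B.mu_le n j
    exact Dvd.dvd.mul_right (pow_dvd_pow _ (by omega)) _
  rw [this, map_zero]

/-- The characters of the vectors ℓ^(n-μ_j) b_j generate the ℓ^n-torsion of the dual, so ψ has to be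
checked on them only. Vanishing of F on the image of M + ℓ^n then comes for free: ℓ^μ_j kills the
j-th character, hence also its image under ψ. -/
theorem liftsMor_iff {M : Mat ℓ g} (hM : M ∈ skewSymplectic ℓ g) (hω : latOmega F = Y.ω) :
    LiftsMor Y M F ↔ ∀ j, ∃ q, shift n M (B.b j) = (ℓ : ℤ_[ℓ]) ^ B.mu n j • q ∧
      F q = Y.ψ (B.char hF j) := by
  constructor
  · intro h j
    obtain ⟨u, hu⟩ := shift_divisible (n := n) hM ((ℓ : ℤ_[ℓ]) ^ (n - B.mu n j) • B.b j) (fun x => by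
      rw [toZModPow_eq_zero]
      exact B.dvd_charVec n j _ (h.shift_eq_zero x))
    refine ⟨u, ?_, h.psi _ _ _ (B.char_apply hF j) hu⟩
    apply pow_smul_injective (n - B.mu n j)
    rw [← map_smul, hu, smul_smul, ← pow_add, Nat.sub_add_cancel (B.mu_le n j)]
  · intro h
    choose q hq hψ using h
    obtain ⟨k0, hk0⟩ := exists_uniform_pow_smul Y.isPrimary
    -- One approximation of scalars has to serve twice: modulo an exponent of the group, and modulo
    -- ℓ^n for the values of characters.
    have hk : ∀ a : Y.carrier, ℓ ^ (k0 + n) • a = 0 := fun a => by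
      rw [pow_add, mul_comm, mul_smul, hk0, smul_zero]
    have hker : ∀ j, F ((ℓ : ℤ_[ℓ]) ^ B.mu n j • q j) = 0 := by
      intro j
      rw [← Nat.cast_pow, Nat.cast_smul_eq_nsmul, map_nsmul, hψ]
      have := congrArg Subtype.val (congrArg Y.ψ (B.pow_smul_char hF j))
      rw [map_nsmul, map_zero] at this
      exact this
    refine ⟨fun x => ?_, hω, fun γ s u hγ hu => ?_⟩
    · rw [B.eq_sum_b x, map_sum, map_sum]
      refine Finset.sum_eq_zero fun j _ => ?_
      rw [map_smul, hq]
      exact map_smul_eq_zero F hk _ (hker j)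
    -- Since ℓ^λ_j v_j lies in ker F, the number ℓ^λ_j ⟨v_j, s⟩ is divisible by ℓ^n. Hence s is a
    -- combination of the basic vectors ℓ^(n-μ_j) b_j.
    · have hc : ∀ j, ∃ d, sympForm (B.v j) s = (ℓ : ℤ_[ℓ]) ^ (n - B.mu n j) * d := by
        intro j
        have h1 := dvd_of_char γ.1 s hγ _ (B.map_pow_smul_v j)
        rw [sympForm_smul_left] at h1
        rcases le_total n (B.lam j) with h2 | h2
        · rw [mu, min_eq_right h2, Nat.sub_self]
          exact ⟨_, by rw [pow_zero, one_mul]⟩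
        · rw [mu, min_eq_left h2]
          have h3 : (ℓ : ℤ_[ℓ]) ^ n = (ℓ : ℤ_[ℓ]) ^ B.lam j * (ℓ : ℤ_[ℓ]) ^ (n - B.lam j) := by
            rw [← pow_add, Nat.add_sub_cancel' h2]
          rw [h3] at h1
          exact (mul_dvd_mul_iff_left (pow_ne_zero _ natCast_padic_ne_zero)).mp h1
      choose d hd using hc
      choose m d' hm using fun j => exists_natCast_add (k0 + n) (d j)
      have hs : s = ∑ j, (ℓ : ℤ_[ℓ]) ^ (n - B.mu n j) • d j • B.b j := by
        conv_lhs => rw [B.eq_sum_b s]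
        exact Finset.sum_congr rfl fun j _ => by rw [hd, mul_smul]
      have hu' : u = ∑ j, d j • q j := by
        apply pow_smul_injective n
        rw [← hu]
        conv_lhs => rw [hs]
        rw [map_sum, Finset.smul_sum]
        refine Finset.sum_congr rfl fun j _ => ?_
        rw [map_smul, map_smul, hq, smul_comm (d j), smul_smul, ← pow_add,
          Nat.sub_add_cancel (B.mu_le n j)]
      have hγ' : γ = ∑ j, m j • B.char hF j := by
        apply Subtype.ext
        ext y
        obtain ⟨x, rfl⟩ := hF y
        rw [hγ, AddSubgroup.val_finsetSum, AddMonoidHom.finsetSum_apply]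
        have : ∀ j, ((m j • B.char hF j : AddSubgroup.torsionBy (Dual Y.carrier) ((ℓ ^ n : ℕ) : ℤ)) :
            Dual Y.carrier) (F x) = toQZ (ℓ ^ n) (PadicInt.toZModPow n
              (d j * sympForm x ((ℓ : ℤ_[ℓ]) ^ (n - B.mu n j) • B.b j))) := by
          intro j
          change m j • (B.char hF j).1 (F x) = _
          rw [char_apply, ← map_nsmul, ← map_nsmul]
          congr 1
          rw [← sub_eq_zero, ← map_sub, toZModPow_eq_zero, nsmul_eq_mul, hm j]
          refine Dvd.intro (-((ℓ : ℤ_[ℓ]) ^ k0 * d' j *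
            sympForm x ((ℓ : ℤ_[ℓ]) ^ (n - B.mu n j) • B.b j))) ?_
          ring
        rw [Finset.sum_congr rfl fun j _ => this j, ← map_sum, ← map_sum]
        conv_lhs => rw [hs]
        rw [sympForm_sum_right]
        congr 2
        refine Finset.sum_congr rfl fun j _ => ?_
        rw [smul_comm, sympForm_smul_right]
      rw [hu', hγ', map_sum, map_sum, AddSubgroup.val_finsetSum]
      refine Finset.sum_congr rfl fun j _ => ?_
      rw [hm j, map_natCast_add_smul F hk, hψ, map_nsmul]
      rfl

end AdaptedBases

end Adapted

/-! ### Morphisms as congruences on symmetric entries -/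

section Core

variable {ℓ : ℕ} [Fact ℓ.Prime] {g n : ℕ}

namespace AdaptedBases

variable {Y : BEG ℓ n} {F : Lattice ℓ g →+ Y.carrier} {ι : Type} [Fintype ι] [LinearOrder ι]
variable (B : AdaptedBases F ι) (hF : Function.Surjective F)

/-- A lift of `ψ` of a basic character. -/
def psiLift (j : ι) : Lattice ℓ g := (hF (Y.ψ (B.char hF j) : Y.carrier)).choose

theorem map_psiLift (j : ι) : F (B.psiLift hF j) = Y.ψ (B.char hF j) :=
  (hF (Y.ψ (B.char hF j) : Y.carrier)).choose_spec

/-- The residue of `⟨M b_j, b_i⟩` modulo `ℓ^(λ_i + μ_j)` for a morphism. -/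
def target (i j : ι) : ℤ_[ℓ] :=
  (ℓ : ℤ_[ℓ]) ^ B.mu n j * sympForm (B.psiLift hF j) (B.b i) -
    (ℓ : ℤ_[ℓ]) ^ n * sympForm (B.b j) (B.b i)

/-- The vector (M + ℓ^n) b_j must be ℓ^μ_j times a vector congruent to the chosen lift modulo ker F.
Pairing with b_i reads off its i-th coordinate, and ker F contributes the factor ℓ^λ_i. -/
theorem liftsMor_iff_dvd {M : Mat ℓ g} (hM : M ∈ skewSymplectic ℓ g) (hω : latOmega F = Y.ω) :
    LiftsMor Y M F ↔ ∀ i j,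
      (ℓ : ℤ_[ℓ]) ^ (B.lam i + B.mu n j) ∣ B.entry M i j - B.target hF i j := by
  rw [B.liftsMor_iff hF hM hω, forall_comm]
  refine forall_congr' fun j => ?_
  have key : ∀ i, B.entry M i j - B.target hF i j = sympForm (shift n M (B.b j)) (B.b i) -
      (ℓ : ℤ_[ℓ]) ^ B.mu n j * sympForm (B.psiLift hF j) (B.b i) := by
    intro i
    rw [DualBases.entry, target, shift_apply, sympForm_add_left, sympForm_smul_left]
    ring
  constructor
  · rintro ⟨q, hq, hψ⟩ i
    rw [key, hq, sympForm_smul_left, ← mul_sub, ← sympForm_sub_left, add_comm, pow_add]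
    refine mul_dvd_mul_left _ ((B.mem_ker _).mp ?_ i)
    rw [map_sub, hψ, map_psiLift, sub_self]
  · intro h
    choose c hc using h
    -- The quotients in the congruences are the coordinates of the correction, which lies in ker F.
    refine ⟨B.psiLift hF j + ∑ i, (ℓ : ℤ_[ℓ]) ^ B.lam i • c i • B.v i, ?_, ?_⟩
    · conv_lhs => rw [B.eq_sum_v (shift n M (B.b j))]
      conv_rhs => rw [B.eq_sum_v (B.psiLift hF j)]
      rw [← Finset.sum_add_distrib, Finset.smul_sum]
      refine Finset.sum_congr rfl fun i _ => ?_
      have h1 := hc i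
      rw [key, sub_eq_iff_eq_add] at h1
      rw [h1, smul_smul, ← add_smul, smul_smul]
      congr 1
      ring
    · rw [map_add, map_psiLift, add_eq_left, B.mem_ker]
      intro i
      rw [sympForm_sum_left]
      refine Finset.dvd_sum fun k _ => ?_
      rw [sympForm_smul_left, sympForm_smul_left, B.dual]
      split_ifs with h1
      · subst h1
        exact Dvd.intro _ rfl
      · simp

/-- A symmetric matrix can meet the conditions at (i, j) and (j, i) only if their residues agree
modulo the smaller modulus. This is where the axiom relating ψ and ω enters, including its term 2ω
and the levels r > 0. -/
theorem dvd_target_sub (hω : latOmega F = Y.ω) {i j : ι} (hij : B.lam j ≤ B.lam i) :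
    (ℓ : ℤ_[ℓ]) ^ (B.lam j + B.mu n i) ∣ B.target hF i j - B.target hF j i := by
  have hch : ∀ j (γ : AddSubgroup.torsionBy (Dual Y.carrier) ((ℓ ^ n : ℕ) : ℤ)),
      (∀ x, γ.1 (F x) = toQZ (ℓ ^ n) (PadicInt.toZModPow n
        (sympForm x ((ℓ : ℤ_[ℓ]) ^ (n - B.mu n j) • B.b j)))) → F (B.psiLift hF j) = Y.ψ γ := by
    intro j γ hγ
    rw [map_psiLift, char, ← eq_charOf hF _ (B.dvd_charVec n j) γ hγ]
  have key : B.target hF i j - B.target hF j i =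
      (ℓ : ℤ_[ℓ]) ^ B.mu n j * sympForm (B.psiLift hF j) (B.b i) -
      (ℓ : ℤ_[ℓ]) ^ B.mu n i * sympForm (B.psiLift hF i) (B.b j) -
      2 * (ℓ : ℤ_[ℓ]) ^ n * sympForm (B.b j) (B.b i) := by
    rw [target, target, sympForm_swap (B.b i) (B.b j)]
    ring
  rw [key]
  -- If λ_j ≥ n, then b_i and b_j themselves define characters of level ℓ^λ_j, and the axiom is used
  -- with r = λ_j - n. Otherwise it is used with r = 0 on the rescaled vectors ℓ^(n-μ) b.
  rcases le_total n (B.lam j) with h | h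
  · obtain ⟨r, hr⟩ := Nat.exists_eq_add_of_le h
    have hj : B.mu n j = n := min_eq_right h
    have hi : B.mu n i = n := min_eq_right (h.trans hij)
    have e := lattice_compat Y hF hω r (s := B.b j) (t := B.b i) (P := B.psiLift hF j)
      (Q := B.psiLift hF i) (fun x hx => hr ▸ (B.mem_ker x).mp hx j)
      (fun x hx => (pow_dvd_pow _ (hr ▸ hij)).trans ((B.mem_ker x).mp hx i))
      (fun γ hγ => hch j γ (by rw [hj, Nat.sub_self, pow_zero, one_smul]; exact hγ))
      (fun γ hγ => hch i γ (by rw [hi, Nat.sub_self, pow_zero, one_smul]; exact hγ))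
    rw [hi, hj, hr, pow_add, mul_comm ((ℓ : ℤ_[ℓ]) ^ (n + r))]
    refine (mul_dvd_mul_left _ e).trans (dvd_of_eq ?_)
    ring
  · have hj : B.mu n j = B.lam j := min_eq_left h
    have e := lattice_compat Y hF hω 0 (B.dvd_charVec n j) (B.dvd_charVec n i) (hch j) (hch i)
    rw [hj] at e ⊢
    have hi := B.mu_le n i
    rw [sympForm_smul_right, sympForm_smul_right, sympForm_smul_right, sympForm_smul_left] at e
    -- The factor ℓ^(λ_j+μ_i) undoes the rescaling of both vectors and makes the relation ℓ^n times
    -- the wanted one; ℓ^n is then cancelled.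
    have e2 := mul_dvd_mul_left ((ℓ : ℤ_[ℓ]) ^ (B.lam j + B.mu n i)) e
    rw [mul_comm, add_zero] at e2
    refine (mul_dvd_mul_iff_left (pow_ne_zero n (natCast_padic_ne_zero (ℓ := ℓ)))).mp
      (e2.trans (dvd_of_eq ?_))
    have h1 : (ℓ : ℤ_[ℓ]) ^ n = (ℓ : ℤ_[ℓ]) ^ B.lam j * (ℓ : ℤ_[ℓ]) ^ (n - B.lam j) := by
      rw [← pow_add, Nat.add_sub_cancel' h]
    have h2 : (ℓ : ℤ_[ℓ]) ^ n = (ℓ : ℤ_[ℓ]) ^ B.mu n i * (ℓ : ℤ_[ℓ]) ^ (n - B.mu n i) := by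
      rw [← pow_add, Nat.add_sub_cancel' hi]
    rw [pow_add]
    linear_combination
      (- (ℓ : ℤ_[ℓ]) ^ B.lam j * sympForm (B.psiLift hF j) (B.b i)
        + 2 * (ℓ : ℤ_[ℓ]) ^ B.lam j * (ℓ : ℤ_[ℓ]) ^ (n - B.lam j) * sympForm (B.b j) (B.b i)) * h2
      + ((ℓ : ℤ_[ℓ]) ^ B.mu n i * sympForm (B.psiLift hF i) (B.b j)
        + 2 * (ℓ : ℤ_[ℓ]) ^ n * sympForm (B.b j) (B.b i)) * h1

/-- The exponent of the congruence imposed on `⟨M b_j, b_i⟩`. -/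
def expo (n : ℕ) (i j : ι) : ℕ := max (B.lam i + B.mu n j) (B.lam j + B.mu n i)

theorem expo_eq {i j : ι} (h : B.lam j ≤ B.lam i) : B.expo n i j = B.lam i + B.mu n j := by
  apply max_eq_left
  unfold mu
  omega

theorem expo_comm (i j : ι) : B.expo n i j = B.expo n j i := max_comm _ _

/-- The residue of `⟨M b_j, b_i⟩` modulo `ℓ^(expo n i j)` for a morphism. -/
def symTarget (i j : ι) : ℤ_[ℓ] :=
  if B.lam j ≤ B.lam i then B.target hF i j else B.target hF j i

/-- Of the two congruences on a pair of symmetric entries, the one with larger modulus implies the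
other, by `dvd_target_sub`. What remains is one condition on each independent entry. -/
theorem liftsMor_iff_symTarget {M : Mat ℓ g} (hM : M ∈ skewSymplectic ℓ g)
    (hω : latOmega F = Y.ω) :
    LiftsMor Y M F ↔ ∀ i j, i ≤ j →
      (ℓ : ℤ_[ℓ]) ^ B.expo n i j ∣ B.entry M i j - B.symTarget hF i j := by
  rw [B.liftsMor_iff_dvd hF hM hω]
  constructor
  · intro h i j _
    rw [symTarget]
    split_ifs with hij
    · rw [B.expo_eq hij]
      exact h i j
    · rw [expo_comm, B.expo_eq (not_le.mp hij).le, B.entry_symm hM]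
      exact h j i
  · intro h
    have h1 : ∀ i j, B.lam j ≤ B.lam i →
        ((ℓ : ℤ_[ℓ]) ^ (B.lam i + B.mu n j) ∣ B.entry M i j - B.target hF i j) →
        ((ℓ : ℤ_[ℓ]) ^ (B.lam j + B.mu n i) ∣ B.entry M j i - B.target hF j i) := by
      intro i j hij hd
      have e : B.entry M j i - B.target hF j i = (B.entry M i j - B.target hF i j) +
          (B.target hF i j - B.target hF j i) := by
        rw [B.entry_symm hM j i]; ring
      rw [e]
      refine dvd_add ((pow_dvd_pow _ ?_).trans hd) (B.dvd_target_sub hF hω hij)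
      unfold mu
      omega
    have h2 : ∀ i j, i ≤ j →
        ((ℓ : ℤ_[ℓ]) ^ (B.lam i + B.mu n j) ∣ B.entry M i j - B.target hF i j) ∧
        ((ℓ : ℤ_[ℓ]) ^ (B.lam j + B.mu n i) ∣ B.entry M j i - B.target hF j i) := by
      intro i j hij
      have h3 := h i j hij
      rw [symTarget] at h3
      split_ifs at h3 with h4
      · rw [B.expo_eq h4] at h3
        exact ⟨h3, h1 i j h4 h3⟩
      · have h5 := (not_le.mp h4).le
        rw [expo_comm, B.expo_eq h5, B.entry_symm hM] at h3
        exact ⟨h1 j i h5 h3, h3⟩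
    intro i j
    rcases le_total i j with hij | hij
    · exact (h2 i j hij).1
    · exact (h2 j i hij).2

end AdaptedBases

end Core

/-! ### The rank of the cokernel and the free block -/

section Rank

variable {ℓ : ℕ} [Fact ℓ.Prime] {g n : ℕ}

theorem toZMod_eq_zero (c : ℤ_[ℓ]) : PadicInt.toZMod c = 0 ↔ (ℓ : ℤ_[ℓ]) ∣ c := by
  rw [← RingHom.mem_ker, PadicInt.ker_toZMod, PadicInt.maximalIdeal_eq_span_p,
    Ideal.mem_span_singleton]

theorem map_smul_zmod (a : Lattice ℓ g →+ ZMod ℓ) (c : ℤ_[ℓ]) (x : Lattice ℓ g) :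
    a (c • x) = PadicInt.toZMod c * a x := by
  obtain ⟨m, d, rfl⟩ := exists_natCast_add 1 c
  rw [map_natCast_add_smul a (k := 1) (fun z => by
    rw [pow_one, nsmul_eq_mul, ZMod.natCast_self, zero_mul])]
  simp

variable {ι : Type} [Fintype ι] [LinearOrder ι]

/-- Homomorphisms to `𝔽_ℓ` from a quotient of the lattice. -/
def DualBases.homEquiv (B : DualBases ℓ g ι) {Q : Type*} [AddCommGroup Q] (π : Lattice ℓ g →+ Q)
    (hπ : Function.Surjective π) : (Q →+ ZMod ℓ) ≃ {c : ι → ZMod ℓ //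
      ∀ x, π x = 0 → ∑ i, PadicInt.toZMod (sympForm x (B.b i)) * c i = 0} := by
  have key : ∀ (a : Lattice ℓ g →+ ZMod ℓ) x,
      ∑ i, PadicInt.toZMod (sympForm x (B.b i)) * a (B.v i) = a x := by
    intro a x
    conv_rhs => rw [B.eq_sum_v x]
    rw [map_sum]
    exact Finset.sum_congr rfl fun i _ => (map_smul_zmod a _ _).symm
  refine Equiv.ofBijective (fun a => ⟨fun i => a (π (B.v i)), fun x hx => ?_⟩) ⟨?_, ?_⟩
  · have h := key (a.comp π) x
    refine h.trans ?_
    rw [AddMonoidHom.comp_apply, hx, map_zero]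
  · intro a a' h
    ext y
    obtain ⟨x, rfl⟩ := hπ y
    have h1 := key (a.comp π) x
    have h2 := key (a'.comp π) x
    change a.comp π x = a'.comp π x
    rw [← h1, ← h2]
    exact Finset.sum_congr rfl fun i _ => by
      congr 1
      exact congrFun (congrArg Subtype.val h) i
  · rintro ⟨c, hc⟩
    let φ : Lattice ℓ g →+ ZMod ℓ :=
      { toFun := fun x => ∑ i, PadicInt.toZMod (sympForm x (B.b i)) * c i
        map_zero' := by simp [sympForm_zero_left]
        map_add' := fun x y => by
          simp only [sympForm_add_left, map_add, add_mul, Finset.sum_add_distrib] }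
    obtain ⟨a, ha⟩ := exists_comp_eq_of_ker_le π hπ φ hc
    refine ⟨a, Subtype.ext (funext fun j => ?_)⟩
    change a (π (B.v j)) = c j
    rw [ha]
    change ∑ i, PadicInt.toZMod (sympForm (B.v j) (B.b i)) * c i = c j
    simp [B.dual]

theorem mem_symMat {κ : Type} {D : Matrix κ κ (ZMod ℓ)} :
    D ∈ symMat κ ℓ ↔ ∀ i j, D i j = D j i := Iff.rfl

/-- The reduction modulo `ℓ` of a block of the matrix `⟨M b_j, b_i⟩`. -/
def DualBases.redMat (B : DualBases ℓ g ι) (P : ι → Prop) (M : Mat ℓ g) :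
    Matrix {i // P i} {i // P i} (ZMod ℓ) :=
  Matrix.of fun i j => PadicInt.toZMod (B.entry M i j)

theorem DualBases.redMat_mem (B : DualBases ℓ g ι) (P : ι → Prop) {M : Mat ℓ g}
    (hM : M ∈ skewSymplectic ℓ g) : B.redMat P M ∈ symMat {i // P i} ℓ := by
  rw [mem_symMat]
  intro i j
  rw [DualBases.redMat, Matrix.of_apply, Matrix.of_apply, B.entry_symm hM]

variable {A : Type*} [AddCommGroup A]

open Classical in
theorem card_split (P : ι → Prop) (R : (ι → ZMod ℓ) → Prop) (R' : ({i // P i} → ZMod ℓ) → Prop)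
    (h : ∀ c, R c ↔ R' fun i => c i) :
    Nat.card {c // R c} = ℓ ^ Nat.card {i // ¬ P i} * Nat.card {c // R' c} := by
  let e := (Equiv.piEquivPiSubtypeProd P fun _ => ZMod ℓ)
  let e1 : {c // R c} ≃ {y : ({i // P i} → ZMod ℓ) × ({i // ¬ P i} → ZMod ℓ) // R' y.1} :=
    e.subtypeEquiv fun c => h c
  rw [Nat.card_congr (e1.trans Equiv.prodSubtypeFstEquivSubtypeProd), Nat.card_prod, Nat.card_fun,
    Nat.card_zmod, mul_comm]

namespace AdaptedBases

theorem homCard_eq {F : Lattice ℓ g →+ A} (B : AdaptedBases F ι) (hF : Function.Surjective F) :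
    homCard ℓ A = ℓ ^ Nat.card {i // ¬ B.lam i = 0} := by
  rw [homCard, Nat.card_congr (B.homEquiv F hF),
    card_split (fun i => B.lam i = 0) _ (fun c => c = 0)]
  · simp
  · intro c
    constructor
    · intro h
      funext ⟨i, hi⟩
      have h1 := h _ (B.map_pow_smul_v i)
      rw [hi, pow_zero, one_smul] at h1
      simpa [B.dual] using h1
    · intro h x hx
      refine Finset.sum_eq_zero fun i _ => ?_
      by_cases hi : B.lam i = 0
      · rw [congrFun h ⟨i, hi⟩, Pi.zero_apply, mul_zero]
      · have h1 := (B.mem_ker x).mp hx i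
        have h2 := (toZMod_eq_zero _).mpr ((dvd_pow_self (ℓ : ℤ_[ℓ]) hi).trans h1)
        rw [h2, zero_mul]

open Classical in
theorem card_lam_eq_zero {F : Lattice ℓ g →+ A} (B : AdaptedBases F ι)
    (hF : Function.Surjective F) :
    homCard ℓ A * ℓ ^ Fintype.card {i // B.lam i = 0} = ℓ ^ Fintype.card ι := by
  rw [B.homCard_eq hF, ← pow_add, Nat.card_eq_fintype_card, Fintype.card_subtype_compl]
  congr 1
  have := Fintype.card_subtype_le fun i => B.lam i = 0
  omega

/-- Modulo ℓ the term ℓ^n disappears, as n > 0. Rows and columns with λ_i ≠ 0 vanish modulo ℓ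
because M + ℓ^n maps into ker F. So the rank of the cokernel is the number of these indices, which
is the rank of Y, plus the corank of the remaining block. -/
theorem homCard_coker {Y : BEG ℓ n} (hn : 0 < n) {F : Lattice ℓ g →+ Y.carrier}
    (B : AdaptedBases F ι) (hF : Function.Surjective F) {M : Mat ℓ g}
    (hM : M ∈ skewSymplectic ℓ g) (h : LiftsMor Y M F) :
    homCard ℓ (Coker n M) = homCard ℓ Y.carrier * kerCard (B.redMat (fun i => B.lam i = 0) M) := by
  have hNM : ∀ i j, PadicInt.toZMod (sympForm (shift n M (B.b j)) (B.b i)) =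
      PadicInt.toZMod (B.entry M i j) := by
    intro i j
    rw [shift_apply, sympForm_add_left, sympForm_smul_left, map_add, map_mul, map_pow, map_natCast,
      ZMod.natCast_self, zero_pow hn.ne', zero_mul, add_zero]
    rfl
  have hz : ∀ i j, B.lam i ≠ 0 → PadicInt.toZMod (B.entry M i j) = 0 := by
    intro i j hi
    rw [← hNM, toZMod_eq_zero]
    exact (dvd_pow_self _ hi).trans ((B.mem_ker _).mp (h.shift_eq_zero _) i)
  rw [B.homCard_eq hF, homCard, Nat.card_congr (B.homEquiv (proj n M).toAddMonoidHom
    (Submodule.mkQ_surjective _)), kerCard]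
  apply card_split (fun i => B.lam i = 0)
  intro c
  have h1 : (∀ x, (proj n M).toAddMonoidHom x = 0 →
      ∑ i, PadicInt.toZMod (sympForm x (B.b i)) * c i = 0) ↔
      ∀ j, ∑ i, PadicInt.toZMod (B.entry M i j) * c i = 0 := by
    constructor
    · intro h j
      have := h (shift n M (B.b j)) ((Submodule.Quotient.mk_eq_zero _).mpr ⟨_, rfl⟩)
      simpa only [hNM] using this
    · intro h x hx
      obtain ⟨y, rfl⟩ := (Submodule.Quotient.mk_eq_zero _).mp hx
      rw [B.eq_sum_b y]
      have : ∀ i, PadicInt.toZMod (sympForm (shift n M (∑ j, sympForm (B.v j) y • B.b j)) (B.b i)) =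
          ∑ j, PadicInt.toZMod (sympForm (B.v j) y) * PadicInt.toZMod (B.entry M i j) := by
        intro i
        rw [map_sum, sympForm_sum_left, map_sum]
        refine Finset.sum_congr rfl fun j _ => ?_
        rw [map_smul, sympForm_smul_left, map_mul, hNM]
      simp only [this, Finset.sum_mul]
      rw [Finset.sum_comm]
      refine Finset.sum_eq_zero fun j _ => ?_
      simp only [mul_assoc]
      rw [← Finset.mul_sum, h j, mul_zero]
  rw [h1, funext_iff, Subtype.forall]
  refine forall_congr' fun j => ?_
  by_cases hj : B.lam j = 0
  · rw [forall_prop_of_true hj]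
    have h2 : ∑ i, PadicInt.toZMod (B.entry M i j) * c i =
        (B.redMat (fun i => B.lam i = 0) M).mulVec (fun i => c i) ⟨j, hj⟩ := by
      rw [← Fintype.sum_subtype_add_sum_subtype (fun i => B.lam i = 0)]
      rw [Finset.sum_eq_zero (s := (Finset.univ : Finset {x // ¬ B.lam x = 0})), add_zero]
      · refine Finset.sum_congr rfl fun i _ => ?_
        rw [B.entry_symm hM]
        rfl
      · intro i _
        rw [hz _ _ i.2, zero_mul]
    rw [h2]
    rfl
  · refine iff_of_true ?_ fun h => absurd h hj
    refine Finset.sum_eq_zero fun i _ => ?_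
    rw [B.entry_symm hM, hz _ _ hj, zero_mul]

end AdaptedBases

section Probability

variable (B : DualBases ℓ g ι) (e : ι → ι → ℕ) (σ : ι → ι → ℤ_[ℓ]) (P : ι → Prop)

/-- The matrices satisfying given congruences, with given reduction of a block. -/
def entriesSet (D : Matrix {i // P i} {i // P i} (ZMod ℓ)) : Set (skewSymplectic ℓ g) :=
  {M | (∀ i j, i ≤ j → (ℓ : ℤ_[ℓ]) ^ e i j ∣ B.entry M.1 i j - σ i j) ∧ B.redMat P M.1 = D}

/-- No condition is imposed on the block, so prescribing it modulo ℓ replaces the exponents 0 there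
by 1. The measure of the resulting set does not depend on the prescribed matrix. -/
theorem entriesSet_eq (he : ∀ i j, P i → P j → e i j = 0) (D : symMat {i // P i} ℓ) :
    ∃ σ' : ι → ι → ℤ_[ℓ], entriesSet B e σ P D.1 = {M | ∀ i j, i ≤ j →
      (ℓ : ℤ_[ℓ]) ^ (open Classical in if P i ∧ P j then 1 else e i j) ∣
        B.entry M.1 i j - σ' i j} := by
  classical
  obtain ⟨σ', hσ, hσ'⟩ : ∃ σ' : ι → ι → ℤ_[ℓ],
      (∀ i j : {i // P i}, PadicInt.toZMod (σ' i j) = D.1 i j) ∧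
        ∀ i j, ¬ (P i ∧ P j) → σ' i j = σ i j := by
    choose c hc using ZMod.ringHom_surjective (PadicInt.toZMod (p := ℓ))
    let d : {i // P i} → {i // P i} → ZMod ℓ := fun i j => D.1 i j
    exact ⟨fun i j => if h : P i ∧ P j then c (d ⟨i, h.1⟩ ⟨j, h.2⟩) else σ i j,
      fun i j => (congrArg _ (dif_pos ⟨i.2, j.2⟩)).trans (hc _), fun i j h => dif_neg h⟩
  refine ⟨σ', ?_⟩
  ext M
  have key : ∀ i j : {i // P i}, (ℓ : ℤ_[ℓ]) ^ 1 ∣ B.entry M.1 i j - σ' i j ↔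
      B.redMat P M.1 i j = D.1 i j := by
    intro i j
    rw [pow_one, ← toZMod_eq_zero, map_sub, hσ, sub_eq_zero, DualBases.redMat, Matrix.of_apply]
  constructor
  · rintro ⟨h1, h2⟩ i j hij
    by_cases h : P i ∧ P j
    · rw [if_pos h]
      refine (key ⟨i, h.1⟩ ⟨j, h.2⟩).mpr ?_
      rw [h2]
    · rw [if_neg h, hσ' i j h]
      exact h1 i j hij
  · intro h
    refine ⟨fun i j hij => ?_, ?_⟩
    · have h1 := h i j hij
      by_cases h2 : P i ∧ P j
      · rw [he i j h2.1 h2.2, pow_zero]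
        exact one_dvd _
      · rwa [if_neg h2, hσ' i j h2] at h1
    · have h0 : ∀ i j : {i // P i}, i.1 ≤ j.1 → B.redMat P M.1 i j = D.1 i j := by
        intro i j hij
        have h1 := h i.1 j.1 hij
        rw [if_pos ⟨i.2, j.2⟩] at h1
        exact (key i j).mp h1
      ext i j
      rcases le_total i.1 j.1 with hij | hij
      · exact h0 i j hij
      · rw [mem_symMat.mp (B.redMat_mem P M.2) i j, mem_symMat.mp D.2 i j]
        exact h0 j i hij

theorem measurableSet_entriesSet (he : ∀ i j, P i → P j → e i j = 0) (D : symMat {i // P i} ℓ) :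
    MeasurableSet (entriesSet B e σ P D.1) := by
  obtain ⟨σ', h⟩ := entriesSet_eq B e σ P he D
  rw [h]
  exact measurableSet_entries _ _ _

/-- The sets belonging to the various block reductions are disjoint, of equal measure, and cover the
event given by the congruences alone: the block is uniform and independent of that event. -/
theorem haarSkew_entriesSet (he : ∀ i j, P i → P j → e i j = 0) (D : symMat {i // P i} ℓ) :
    haarSkew ℓ g (entriesSet B e σ P D.1) =
      (∏ p : {p : ι × ι // p.1 ≤ p.2}, ((ℓ : ℝ≥0∞) ^ e p.1.1 p.1.2)⁻¹) /
        Nat.card (symMat {i // P i} ℓ) := by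
  classical
  have heq : ∀ D' : symMat {i // P i} ℓ, haarSkew ℓ g (entriesSet B e σ P D'.1) =
      haarSkew ℓ g (entriesSet B e σ P D.1) := by
    intro D'
    obtain ⟨σ', h⟩ := entriesSet_eq B e σ P he D'
    obtain ⟨σ'', h'⟩ := entriesSet_eq B e σ P he D
    rw [h, h', haarSkew_entries, haarSkew_entries]
  rw [← haarSkew_entries B e σ]
  have hU : {M : skewSymplectic ℓ g | ∀ i j, i ≤ j → (ℓ : ℤ_[ℓ]) ^ e i j ∣
      B.entry M.1 i j - σ i j} =
      ⋃ D' ∈ (Finset.univ : Finset (symMat {i // P i} ℓ)), entriesSet B e σ P D'.1 := by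
    ext M
    simp only [Finset.mem_univ, Set.iUnion_true, Set.mem_iUnion]
    exact ⟨fun h => ⟨⟨_, B.redMat_mem P M.2⟩, h, rfl⟩, fun ⟨_, h, _⟩ => h⟩
  rw [hU, measure_biUnion_finset]
  · rw [Finset.sum_congr rfl fun D' _ => heq D', Finset.sum_const, Finset.card_univ,
      nsmul_eq_mul, Nat.card_eq_fintype_card, mul_comm, ENNReal.mul_div_cancel_right]
    · exact_mod_cast Fintype.card_ne_zero
    · exact ENNReal.natCast_ne_top _
  · intro D1 _ D2 _ h12
    refine Set.disjoint_left.mpr fun M h1 h2 => h12 (Subtype.ext (h1.2.symm.trans h2.2))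
  · exact fun D' _ => measurableSet_entriesSet B e σ P he D'

end Probability

end Rank

/-! ### Bilinear forms on a group with given elementary divisors -/

section Counts

variable {ℓ : ℕ} [Fact ℓ.Prime] {g n : ℕ}

instance (k : ℕ) : NeZero (ℓ ^ k) := ⟨(pow_pos_of_prime k).ne'⟩

theorem card_zmod_pow_torsion (k m : ℕ) :
    Nat.card {c : ZMod (ℓ ^ k) // (ℓ : ZMod (ℓ ^ k)) ^ m * c = 0} = ℓ ^ min m k := by
  have h := IsAddCyclic.card_nsmulAddMonoidHom_ker (G := ZMod (ℓ ^ k)) (ℓ ^ m)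
  rw [Nat.card_zmod] at h
  have h2 : (ℓ ^ k).gcd (ℓ ^ m) = ℓ ^ min m k := by
    rcases le_total m k with h | h
    · rw [min_eq_left h, Nat.gcd_eq_right (pow_dvd_pow _ h)]
    · rw [min_eq_right h, Nat.gcd_eq_left (pow_dvd_pow _ h)]
  rw [← h2, ← h]
  refine Nat.card_congr (Equiv.subtypeEquivRight fun c => ?_)
  rw [AddMonoidHom.mem_ker, nsmulAddMonoidHom_apply, nsmul_eq_mul, Nat.cast_pow]

variable {ι : Type} [Fintype ι] [LinearOrder ι] {A : Type*} [AddCommGroup A]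

theorem DualBases.hom_apply (B : DualBases ℓ g ι) {k : ℕ} (a : Lattice ℓ g →+ ZMod (ℓ ^ k))
    (x : Lattice ℓ g) :
    a x = ∑ i, PadicInt.toZModPow k (sympForm x (B.b i)) * a (B.v i) := by
  conv_lhs => rw [B.eq_sum_v x]
  rw [map_sum]
  refine Finset.sum_congr rfl fun i _ => ?_
  obtain ⟨m, d, h⟩ := exists_natCast_add k (sympForm x (B.b i))
  have h0 : PadicInt.toZModPow k ((ℓ : ℤ_[ℓ]) ^ k * d) = 0 :=
    (toZModPow_eq_zero k _).mpr (Dvd.intro _ rfl)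
  rw [h, map_natCast_add_smul a (k := k) (fun z => by
    rw [nsmul_eq_mul, ZMod.natCast_self, zero_mul]), map_add, h0, map_natCast, add_zero,
    nsmul_eq_mul]

namespace AdaptedBases

theorem natCard_eq {F : Lattice ℓ g →+ A} (B : AdaptedBases F ι) (hF : Function.Surjective F) :
    Nat.card A = ∏ i, ℓ ^ B.lam i := by
  let co : Lattice ℓ g →+ (∀ i, ZMod (ℓ ^ B.lam i)) := AddMonoidHom.pi fun i => pairMod _ (B.b i)
  have hco : ∀ x i, co x i = PadicInt.toZModPow _ (sympForm x (B.b i)) := fun x i => rfl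
  have hker : ∀ x, F x = 0 ↔ co x = 0 := by
    intro x
    rw [B.mem_ker, funext_iff]
    exact forall_congr' fun i => (toZModPow_eq_zero _ _).symm
  obtain ⟨φ, hφ⟩ := exists_comp_eq_of_ker_le F hF co fun x hx => (hker x).mp hx
  have hbij : Function.Bijective φ := by
    constructor
    · rw [injective_iff_map_eq_zero]
      intro a ha
      obtain ⟨x, rfl⟩ := hF a
      rw [hφ] at ha
      exact (hker x).mpr ha
    · intro y
      choose c hc using fun i => ZMod.ringHom_surjective (PadicInt.toZModPow (B.lam i)) (y i)
      refine ⟨F (∑ i, c i • B.v i), ?_⟩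
      rw [hφ]
      funext j
      rw [hco]
      simp [sympForm_sum_left, sympForm_smul_left, B.dual, hc]
  rw [Nat.card_congr (Equiv.ofBijective φ hbij), Nat.card_pi]
  simp

variable {F : Lattice ℓ g →+ A} (B : AdaptedBases F ι)

theorem bilin_apply {k : ℕ} (β : A →+ A →+ ZMod (ℓ ^ k)) (x y : Lattice ℓ g) :
    β (F x) (F y) = ∑ i, ∑ j, PadicInt.toZModPow k (sympForm x (B.b i)) *
      PadicInt.toZModPow k (sympForm y (B.b j)) * β (F (B.v i)) (F (B.v j)) := by
  have h1 : β (F x) (F y) = ∑ j, PadicInt.toZModPow k (sympForm y (B.b j)) * β (F x) (F (B.v j)) :=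
    B.hom_apply ((β (F x)).comp F) y
  have h2 : ∀ j, β (F x) (F (B.v j)) = ∑ i, PadicInt.toZModPow k (sympForm x (B.b i)) *
      β (F (B.v i)) (F (B.v j)) := fun j => B.hom_apply ((β.flip (F (B.v j))).comp F) x
  rw [h1, Finset.sum_comm]
  refine Finset.sum_congr rfl fun j _ => ?_
  rw [h2, Finset.mul_sum]
  exact Finset.sum_congr rfl fun i _ => by ring

theorem exists_bilin (hF : Function.Surjective F) {k : ℕ} (c : ι → ι → ZMod (ℓ ^ k))
    (h1 : ∀ i j, (ℓ : ZMod (ℓ ^ k)) ^ B.lam i * c i j = 0)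
    (h2 : ∀ i j, (ℓ : ZMod (ℓ ^ k)) ^ B.lam j * c i j = 0) :
    ∃ β : A →+ A →+ ZMod (ℓ ^ k), ∀ x y, β (F x) (F y) = ∑ i, ∑ j,
      PadicInt.toZModPow k (sympForm x (B.b i)) * PadicInt.toZModPow k (sympForm y (B.b j)) * c i j := by
  have hz : ∀ (x : Lattice ℓ g) (d : ZMod (ℓ ^ k)) i, F x = 0 →
      (ℓ : ZMod (ℓ ^ k)) ^ B.lam i * d = 0 → PadicInt.toZModPow k (sympForm x (B.b i)) * d = 0 := by
    intro x d i hx hd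
    obtain ⟨u, hu⟩ := (B.mem_ker x).mp hx i
    rw [hu, map_mul, map_pow, map_natCast, mul_right_comm, hd, zero_mul]
  let T : Lattice ℓ g →+ Lattice ℓ g →+ ZMod (ℓ ^ k) := AddMonoidHom.mk' (fun x =>
    AddMonoidHom.mk' (fun y => ∑ i, ∑ j, PadicInt.toZModPow k (sympForm x (B.b i)) *
      PadicInt.toZModPow k (sympForm y (B.b j)) * c i j) (fun y y' => by
        simp only [sympForm_add_left, map_add, mul_add, add_mul, Finset.sum_add_distrib]))
    (fun x x' => by
      refine AddMonoidHom.ext fun y => ?_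
      simp only [AddMonoidHom.mk'_apply, AddMonoidHom.add_apply, sympForm_add_left, map_add,
        add_mul, Finset.sum_add_distrib])
  have hT : ∀ x y, T x y = ∑ i, ∑ j, PadicInt.toZModPow k (sympForm x (B.b i)) *
      PadicInt.toZModPow k (sympForm y (B.b j)) * c i j := fun x y => rfl
  obtain ⟨T1, hT1⟩ := exists_comp_eq_of_ker_le F hF T (fun x hx => by
    refine AddMonoidHom.ext fun y => ?_
    rw [hT]
    refine Finset.sum_eq_zero fun i _ => Finset.sum_eq_zero fun j _ => ?_
    rw [mul_right_comm, hz x _ i hx (h1 i j), zero_mul])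
  obtain ⟨T2, hT2⟩ := exists_comp_eq_of_ker_le F hF T1.flip (fun y hy => by
    ext a
    obtain ⟨x, rfl⟩ := hF a
    rw [AddMonoidHom.flip_apply, hT1, hT]
    refine Finset.sum_eq_zero fun i _ => Finset.sum_eq_zero fun j _ => ?_
    rw [mul_assoc, hz y _ j hy (h2 i j), mul_zero])
  refine ⟨T2.flip, fun x y => ?_⟩
  rw [AddMonoidHom.flip_apply, hT2, AddMonoidHom.flip_apply, hT1, hT]

theorem pow_lam_mul (k : ℕ) (a : A →+ ZMod (ℓ ^ k)) (i : ι) :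
    (ℓ : ZMod (ℓ ^ k)) ^ B.lam i * a (F (B.v i)) = 0 := by
  have h := congrArg a (B.map_pow_smul_v i)
  rw [← Nat.cast_pow, Nat.cast_smul_eq_nsmul, map_nsmul, map_nsmul, map_zero, nsmul_eq_mul,
    Nat.cast_pow] at h
  exact h

/-- The number of `ε`-symmetric bilinear maps to `ℤ/ℓ^k`. -/
theorem card_bilin (hF : Function.Surjective F) (k : ℕ) (ε : ZMod (ℓ ^ k)) (hε : ε * ε = 1)
    (R : ι → ι → Prop) [DecidableRel R] (hR : ∀ i j, R i j → i ≤ j) (hR' : ∀ i j, i < j → R i j)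
    (hd : ∀ i, (R i i ∧ ε = 1) ∨ (¬ R i i ∧ ∀ c : ZMod (ℓ ^ k), c = ε * c → c = 0)) :
    Nat.card {β : A →+ A →+ ZMod (ℓ ^ k) // ∀ x y, β y x = ε * β x y} =
      ∏ p : {p : ι × ι // R p.1 p.2}, ℓ ^ min (min (B.lam p.1.1) (B.lam p.1.2)) k := by
  -- A form is determined by its values on the pairs of basis images selected by R: i ≤ j in the
  -- symmetric case, i < j in the skew one, where the diagonal is forced to vanish. A value at (i,
  -- j) may be any element killed by ℓ^min(λ_i, λ_j).
  have hbij : Function.Bijective (fun (β : {β : A →+ A →+ ZMod (ℓ ^ k) // ∀ x y, β y x = ε * β x y})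
      (p : {p : ι × ι // R p.1 p.2}) =>
      (⟨β.1 (F (B.v p.1.1)) (F (B.v p.1.2)), by
        rcases le_total (B.lam p.1.1) (B.lam p.1.2) with h | h
        · rw [min_eq_left h]
          exact B.pow_lam_mul k (β.1.flip (F (B.v p.1.2))) p.1.1
        · rw [min_eq_right h]
          exact B.pow_lam_mul k (β.1 (F (B.v p.1.1))) p.1.2⟩ :
        {c : ZMod (ℓ ^ k) // (ℓ : ZMod (ℓ ^ k)) ^ min (B.lam p.1.1) (B.lam p.1.2) * c = 0})) := by
    constructor
    · intro β β' h
      have hp : ∀ i j, R i j → β.1 (F (B.v i)) (F (B.v j)) = β'.1 (F (B.v i)) (F (B.v j)) :=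
        fun i j hij => congrArg Subtype.val (congrFun h ⟨(i, j), hij⟩)
      have hall : ∀ i j, β.1 (F (B.v i)) (F (B.v j)) = β'.1 (F (B.v i)) (F (B.v j)) := by
        intro i j
        rcases lt_trichotomy i j with hij | hij | hij
        · exact hp i j (hR' i j hij)
        · subst hij
          rcases hd i with ⟨h1, -⟩ | ⟨-, h1⟩
          · exact hp i i h1
          · rw [h1 _ (β.2 _ _), h1 _ (β'.2 _ _)]
        · rw [β.2 (F (B.v j)), β'.2 (F (B.v j)), hp j i (hR' j i hij)]
      apply Subtype.ext
      ext a a'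
      obtain ⟨x, rfl⟩ := hF a
      obtain ⟨y, rfl⟩ := hF a'
      rw [B.bilin_apply, B.bilin_apply]
      simp only [hall]
    · intro d
      let c : ι → ι → ZMod (ℓ ^ k) := fun i j => if h : R i j then (d ⟨(i, j), h⟩).1 else
        if h : R j i then ε * (d ⟨(j, i), h⟩).1 else 0
      have hc1 : ∀ p : {p : ι × ι // R p.1 p.2}, c p.1.1 p.1.2 = (d p).1 := fun p => dif_pos p.2
      have hlt : ∀ i j, i < j → ¬ R j i := fun i j hij h => absurd hij (not_lt.mpr (hR j i h))
      have hc2 : ∀ i j, c j i = ε * c i j := by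
        intro i j
        rcases lt_trichotomy i j with hij | hij | hij
        · change dite _ _ _ = ε * dite _ _ _
          rw [dif_neg (hlt i j hij), dif_pos (hR' i j hij), dif_pos (hR' i j hij)]
        · subst hij
          rcases hd i with ⟨-, h1⟩ | ⟨h1, -⟩
          · rw [h1, one_mul]
          · change dite _ _ _ = ε * dite _ _ _
            rw [dif_neg h1, dif_neg h1, mul_zero]
        · change dite _ _ _ = ε * dite _ _ _
          rw [dif_pos (hR' j i hij), dif_neg (hlt j i hij), dif_pos (hR' j i hij), ← mul_assoc, hε,
            one_mul]
      have hc3 : ∀ i j, (ℓ : ZMod (ℓ ^ k)) ^ min (B.lam i) (B.lam j) * c i j = 0 := by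
        intro i j
        by_cases h : R i j
        · have h1 := hc1 ⟨(i, j), h⟩
          dsimp only at h1
          rw [h1]
          exact (d ⟨(i, j), h⟩).2
        · by_cases h' : R j i
          · rw [hc2 j i]
            have h1 := hc1 ⟨(j, i), h'⟩
            dsimp only at h1
            have h2 := (d ⟨(j, i), h'⟩).2
            dsimp only at h2
            rw [h1, mul_left_comm, min_comm, h2, mul_zero]
          · have : c i j = 0 := by
              change dite _ _ _ = _
              rw [dif_neg h, dif_neg h']
            rw [this, mul_zero]
      have hpow : ∀ (m m' : ℕ) (x : ZMod (ℓ ^ k)), m ≤ m' → (ℓ : ZMod (ℓ ^ k)) ^ m * x = 0 →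
          (ℓ : ZMod (ℓ ^ k)) ^ m' * x = 0 := by
        intro m m' x h hx
        obtain ⟨r, rfl⟩ := Nat.exists_eq_add_of_le h
        rw [pow_add, mul_right_comm, hx, zero_mul]
      obtain ⟨β, hβ⟩ := B.exists_bilin hF c (fun i j => hpow _ _ _ (min_le_left _ _) (hc3 i j))
        (fun i j => hpow _ _ _ (min_le_right _ _) (hc3 i j))
      refine ⟨⟨β, fun a a' => ?_⟩, ?_⟩
      · obtain ⟨x, rfl⟩ := hF a
        obtain ⟨y, rfl⟩ := hF a'
        rw [hβ, hβ, Finset.sum_comm, Finset.mul_sum]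
        refine Finset.sum_congr rfl fun i _ => ?_
        rw [Finset.mul_sum]
        refine Finset.sum_congr rfl fun j _ => ?_
        rw [hc2 i j]
        ring
      · funext p
        apply Subtype.ext
        change β (F (B.v p.1.1)) (F (B.v p.1.2)) = _
        rw [hβ, ← hc1]
        simp [B.dual]
  rw [Nat.card_congr (Equiv.ofBijective _ hbij), Nat.card_pi]
  exact Finset.prod_congr rfl fun p _ => card_zmod_pow_torsion k _

end AdaptedBases

end Counts

/-! ### The symmetric square and symmetric forms -/

section SymSquare

variable {A : Type*} [AddCommGroup A] {C : Type*} [AddCommGroup C]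

theorem symPower_hom_ext {h h' : SymmetricPower ℤ (Fin 2) A →+ C}
    (H : ∀ m : Fin 2 → A, h (SymmetricPower.tprod ℤ m) = h' (SymmetricPower.tprod ℤ m)) : h = h' := by
  have : h.toIntLinearMap = h'.toIntLinearMap := by
    refine LinearMap.ext_on (SymmetricPower.span_tprod_eq_top ℤ (Fin 2) A) ?_
    rintro _ ⟨m, rfl⟩
    exact H m
  ext x
  exact congrArg (fun T : SymmetricPower ℤ (Fin 2) A →ₗ[ℤ] C => T x) this

/-- The bilinear map underlying a homomorphism from the symmetric square. -/
def symPowerBilin (h : SymmetricPower ℤ (Fin 2) A →+ C) : A →+ A →+ C :=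
  AddMonoidHom.mk' (fun x => AddMonoidHom.mk' (fun y => h (SymmetricPower.tprod ℤ ![x, y]))
    (fun y y' => by
      rw [← map_add]
      congr 1
      have e := (SymmetricPower.tprod ℤ (ι := Fin 2) (M := A)).map_update_add ![x, 0] 1 y y'
      have u : ∀ z, Function.update ![x, 0] 1 z = ![x, z] := fun z => by
        funext i
        fin_cases i <;> rfl
      rwa [u, u, u] at e))
    (fun x x' => by
      ext y
      change h _ = h _ + h _
      rw [← map_add]
      congr 1
      have e := (SymmetricPower.tprod ℤ (ι := Fin 2) (M := A)).map_update_add ![0, y] 0 x x'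
      have u : ∀ z, Function.update ![0, y] 0 z = ![z, y] := fun z => by
        funext i
        fin_cases i <;> rfl
      rwa [u, u, u] at e)

theorem symPowerBilin_apply (h : SymmetricPower ℤ (Fin 2) A →+ C) (x y : A) :
    symPowerBilin h x y = h (SymmetricPower.tprod ℤ ![x, y]) := rfl

theorem symPowerBilin_symm (h : SymmetricPower ℤ (Fin 2) A →+ C) (x y : A) :
    symPowerBilin h y x = symPowerBilin h x y := by
  rw [symPowerBilin_apply, symPowerBilin_apply]
  congr 1
  rw [← SymmetricPower.tprod_equiv (Equiv.swap 0 1) ![x, y]]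
  congr 1
  funext i
  fin_cases i <;> rfl

theorem exists_symPowerBilin_eq (β : A →+ A →+ C) (hβ : ∀ x y, β y x = β x y) :
    ∃ h, symPowerBilin h = β := by
  let T : MultilinearMap ℤ (fun _ : Fin 2 => A) C :=
    { toFun := fun m => β (m 0) (m 1)
      map_update_add' := fun m i x y => by
        fin_cases i <;> simp [Function.update]
      map_update_smul' := fun m i c x => by
        fin_cases i <;> simp [Function.update] }
  have hT : ∀ m, T m = β (m 0) (m 1) := fun m => rfl
  let L : (⨂[ℤ] _ : Fin 2, A) →+ C := (PiTensorProduct.lift T).toAddMonoidHom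
  have hL : ∀ m : Fin 2 → A, L (PiTensorProduct.tprod ℤ m) = T m := fun m => PiTensorProduct.lift.tprod m
  -- The symmetric power is the quotient of the tensor power by permutations of the factors; on two
  -- factors only the swap has to be checked.
  have hle : addConGen (SymmetricPower.Rel ℤ (Fin 2) A) ≤ AddCon.ker L := by
    rw [AddCon.addConGen_le]
    rintro _ _ ⟨e, f⟩
    rw [AddCon.ker_rel, hL, hL, hT, hT]
    have he : (e 0 = 0 ∧ e 1 = 1) ∨ (e 0 = 1 ∧ e 1 = 0) := by
      revert e
      decide
    rcases he with ⟨h0, h1⟩ | ⟨h0, h1⟩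
    · rw [h0, h1]
    · rw [h0, h1, hβ]
  refine ⟨AddCon.lift _ L hle, ?_⟩
  ext x y
  exact hL ![x, y]

theorem card_hom_symPower :
    Nat.card (SymmetricPower ℤ (Fin 2) A →+ C) = Nat.card {β : A →+ A →+ C // ∀ x y, β y x = β x y} := by
  refine Nat.card_congr (Equiv.ofBijective
    (fun h => ⟨symPowerBilin h, symPowerBilin_symm h⟩) ⟨fun h h' H => ?_, fun β => ?_⟩)
  · apply symPower_hom_ext
    intro m
    have e : m = ![m 0, m 1] := by
      funext i
      fin_cases i <;> rfl
    rw [e]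
    exact DFunLike.congr_fun (DFunLike.congr_fun (congrArg Subtype.val H) (m 0)) (m 1)
  · obtain ⟨h, hh⟩ := exists_symPowerBilin_eq β.1 β.2
    exact ⟨h, Subtype.ext hh⟩

instance finite_symPower [Finite A] : Finite (SymmetricPower ℤ (Fin 2) A) := by
  have : Module.Finite ℤ (SymmetricPower ℤ (Fin 2) A) :=
    ⟨Submodule.fg_def.mpr ⟨_, Set.finite_range _, SymmetricPower.span_tprod_eq_top ℤ (Fin 2) A⟩⟩
  refine Module.finite_of_fg_torsion (SymmetricPower ℤ (Fin 2) A) (fun {x} => ?_)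
  refine ⟨⟨Nat.card A, mem_nonZeroDivisors_of_ne_zero (by exact_mod_cast Nat.card_pos.ne')⟩, ?_⟩
  change (Nat.card A : ℤ) • x = 0
  rw [natCast_zsmul]
  have h : nsmulAddMonoidHom (α := SymmetricPower ℤ (Fin 2) A) (Nat.card A) = 0 := by
    apply symPower_hom_ext
    intro m
    have e : m = ![m 0, m 1] := by
      funext i
      fin_cases i <;> rfl
    rw [e]
    change Nat.card A • symPowerBilin (AddMonoidHom.id _) (m 0) (m 1) = 0
    rw [← map_nsmul, card_nsmul_eq_zero', map_zero]
  exact DFunLike.congr_fun h x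

end SymSquare

/-! ### The exterior square and alternating forms -/

section WedgeSquare

variable {A : Type*} [AddCommGroup A]

/-- The element `x ∧ y` of `∧²A`. -/
def wedge (x y : A) : wedgeSq A :=
  ⟨x ⊗ₜ[ℤ] y - y ⊗ₜ[ℤ] x, AddSubgroup.subset_closure ⟨x, y, rfl⟩⟩

theorem wedge_add_left (x x' y : A) : wedge (x + x') y = wedge x y + wedge x' y := by
  apply Subtype.ext
  change (x + x') ⊗ₜ[ℤ] y - y ⊗ₜ[ℤ] (x + x') = (x ⊗ₜ[ℤ] y - y ⊗ₜ[ℤ] x) + (x' ⊗ₜ[ℤ] y - y ⊗ₜ[ℤ] x')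
  rw [TensorProduct.add_tmul, TensorProduct.tmul_add]
  abel

theorem wedge_swap (x y : A) : wedge y x = - wedge x y := by
  apply Subtype.ext
  change y ⊗ₜ[ℤ] x - x ⊗ₜ[ℤ] y = -(x ⊗ₜ[ℤ] y - y ⊗ₜ[ℤ] x)
  abel

theorem wedge_add_right (x y y' : A) : wedge x (y + y') = wedge x y + wedge x y' := by
  rw [wedge_swap, wedge_add_left, neg_add, ← wedge_swap, ← wedge_swap]

/-- The wedge product as a bilinear map. -/
def wedgeHom (A : Type*) [AddCommGroup A] : A →+ A →+ wedgeSq A :=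
  AddMonoidHom.mk' (fun x => AddMonoidHom.mk' (fun y => wedge x y) (wedge_add_right x))
    (fun x x' => by ext y; exact congrArg Subtype.val (wedge_add_left x x' y))

theorem wedgeHom_apply (x y : A) : wedgeHom A x y = wedge x y := rfl

theorem wedgeSq_induction {p : wedgeSq A → Prop} (hw : ∀ x y, p (wedge x y)) (h0 : p 0)
    (hadd : ∀ a b, p a → p b → p (a + b)) (hneg : ∀ a, p a → p (-a)) (t : wedgeSq A) : p t := by
  obtain ⟨t, ht⟩ := t
  induction ht using AddSubgroup.closure_induction with
  | mem x hx =>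
    obtain ⟨x, y, rfl⟩ := hx
    exact hw x y
  | zero => exact h0
  | add x y _ _ hx hy => exact hadd _ _ hx hy
  | neg x _ hx => exact hneg _ hx

theorem wedgeSq_hom_ext {C : Type*} [AddCommGroup C] {h h' : wedgeSq A →+ C}
    (H : ∀ x y, h (wedge x y) = h' (wedge x y)) : h = h' := by
  ext t
  induction t using wedgeSq_induction with
  | hw x y => exact H x y
  | h0 => rw [map_zero, map_zero]
  | hadd a b ha hb => rw [map_add, map_add, ha, hb]
  | hneg a ha => rw [map_neg, map_neg, ha]

/-- Here ∧²A is a subgroup of A ⊗ A, so a skew form β has to be extended. The functional u β on A ⊗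
A takes x ∧ y to u(β(x, y) - β(y, x)) = 2u β(x, y) = β(x, y); this needs 2 to be invertible. -/
theorem card_hom_wedgeSq {N : ℕ} {u : ZMod N} (hu : 2 * u = 1) :
    Nat.card (wedgeSq A →+ ZMod N) =
      Nat.card {β : A →+ A →+ ZMod N // ∀ x y, β y x = -1 * β x y} := by
  refine Nat.card_congr (Equiv.ofBijective
    (fun h => ⟨(AddMonoidHom.compHom h).comp (wedgeHom A), fun x y => ?_⟩) ⟨fun h h' H => ?_, fun β => ?_⟩)
  · change h (wedge y x) = -1 * h (wedge x y)
    rw [wedge_swap, map_neg, neg_one_mul]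
  · exact wedgeSq_hom_ext fun x y =>
      DFunLike.congr_fun (DFunLike.congr_fun (congrArg Subtype.val H) x) y
  · let T : A ⊗[ℤ] A →+ ZMod N :=
      (TensorProduct.lift (LinearMap.mk₂ ℤ (fun x y => u * β.1 x y)
        (by intros; simp [mul_add]) (by intros; simp [mul_left_comm]) (by intros; simp [mul_add])
        (by intros; simp [mul_left_comm]))).toAddMonoidHom
    have hT : ∀ x y, T (x ⊗ₜ[ℤ] y) = u * β.1 x y := fun x y => rfl
    refine ⟨T.comp (wedgeSq A).subtype, Subtype.ext ?_⟩
    ext x y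
    change T (x ⊗ₜ[ℤ] y - y ⊗ₜ[ℤ] x) = β.1 x y
    rw [map_sub, hT, hT, β.2 x y]
    linear_combination β.1 x y * hu

theorem nsmul_wedgeSq_eq_zero {N : ℕ} (hN : ∀ a : A, N • a = 0) (t : wedgeSq A) : N • t = 0 := by
  induction t using wedgeSq_induction with
  | hw x y => 
    rw [← wedgeHom_apply, ← map_nsmul, hN, map_zero]
  | h0 => rw [smul_zero]
  | hadd a b ha hb => rw [smul_add, ha, hb, add_zero]
  | hneg a ha => rw [smul_neg, ha, neg_zero]

instance [Finite A] : Finite (wedgeSq A) := Subtype.finite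

end WedgeSquare

/-! ### Orders of ∧²G and (Sym²G)[ℓ^n], and the resulting probability -/

section Counts

variable {ℓ : ℕ} [Fact ℓ.Prime] {g n : ℕ} {ι : Type} [Fintype ι] [LinearOrder ι]

theorem exists_half (hℓ : ℓ ≠ 2) (k : ℕ) : ∃ u : ZMod (ℓ ^ k), 2 * u = 1 := by
  have hcop : Nat.Coprime 2 (ℓ ^ k) :=
    (Nat.Coprime.pow_left k ((Nat.coprime_primes Fact.out Nat.prime_two).mpr hℓ)).symm
  exact ⟨((2 : ℕ) : ZMod (ℓ ^ k))⁻¹, by exact_mod_cast ZMod.coe_mul_inv_eq_one 2 hcop⟩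

namespace AdaptedBases

theorem natCard_wedgeSq {A : Type*} [AddCommGroup A] [Finite A] {F : Lattice ℓ g →+ A}
    (B : AdaptedBases F ι) (hF : Function.Surjective F) (hℓ : ℓ ≠ 2)
    (hA : ∀ x : A, ∃ k : ℕ, ℓ ^ k • x = 0) :
    Nat.card (wedgeSq A) =
      ∏ p : {p : ι × ι // p.1 < p.2}, ℓ ^ min (B.lam p.1.1) (B.lam p.1.2) := by
  obtain ⟨k0, hk0⟩ := exists_uniform_pow_smul hA
  -- Large enough to kill the group and to exceed every λ_i, so that the minimum with k disappears
  -- from the count.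
  let k := k0 + ∑ i, B.lam i
  have hk : ∀ a : A, ℓ ^ k • a = 0 := fun a => by
    rw [pow_add, mul_comm, mul_smul, hk0, smul_zero]
  have hlam : ∀ i, B.lam i ≤ k := fun i =>
    (Finset.single_le_sum (f := B.lam) (fun _ _ => Nat.zero_le _) (Finset.mem_univ i)).trans
      (Nat.le_add_left _ _)
  obtain ⟨u, hu⟩ := exists_half hℓ k
  rw [← card_hom_zmod_of_nsmul_eq_zero (ℓ ^ k) (nsmul_wedgeSq_eq_zero hk), card_hom_wedgeSq hu,
    B.card_bilin hF k (-1) (by ring) (fun i j => i < j) (fun _ _ h => h.le) (fun _ _ h => h)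
      (fun i => Or.inr ⟨lt_irrefl i, fun c hc => ?_⟩)]
  · refine Finset.prod_congr rfl fun p _ => ?_
    rw [min_eq_left ((min_le_left _ _).trans (hlam _))]
  · linear_combination u * hc - c * hu

theorem cardSymSq_eq {Y : BEG ℓ n} {F : Lattice ℓ g →+ Y.carrier} (B : AdaptedBases F ι)
    (hF : Function.Surjective F) :
    cardSymSq Y = ∏ p : {p : ι × ι // p.1 ≤ p.2},
      ℓ ^ min (min (B.lam p.1.1) (B.lam p.1.2)) n := by
  rw [cardSymSq, card_torsionBy_eq_card_hom, card_hom_symPower,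
    ← B.card_bilin hF n 1 (by ring) (fun i j => i ≤ j) (fun _ _ h => h) (fun _ _ h => h.le)
      (fun i => Or.inl ⟨le_rfl, rfl⟩)]
  simp only [one_mul]

/-- The heart of the moment computation. For i < j, max(λ_i+μ_j, λ_j+μ_i) + min(λ_i, λ_j) = λ_i +
λ_j + min(λ_i, λ_j, n), while a diagonal exponent is λ_i + min(λ_i, n). Summed over i ≤ j, every λ_i
alone occurs once for each index. -/
theorem prod_pow_expo {Y : BEG ℓ n} {F : Lattice ℓ g →+ Y.carrier} (B : AdaptedBases F ι)
    (hF : Function.Surjective F) (hℓ : ℓ ≠ 2) :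
    (∏ p : {p : ι × ι // p.1 ≤ p.2}, ℓ ^ B.expo n p.1.1 p.1.2) * Nat.card (wedgeSq Y.carrier) =
      Nat.card Y.carrier ^ Fintype.card ι * cardSymSq Y := by
  rw [B.natCard_wedgeSq hF hℓ Y.isPrimary, B.cardSymSq_eq hF, B.natCard_eq hF,
    Finset.prod_pow_eq_pow_sum, Finset.prod_pow_eq_pow_sum, Finset.prod_pow_eq_pow_sum,
    Finset.prod_pow_eq_pow_sum, ← pow_add, ← pow_mul, ← pow_add]
  congr 1
  have hle : ∀ f : ι → ι → ℕ, ∑ p : {p : ι × ι // p.1 ≤ p.2}, f p.1.1 p.1.2 =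
      ∑ i, ∑ j, if i ≤ j then f i j else 0 := by
    intro f
    rw [← Fintype.sum_prod_type', ← Finset.sum_filter]
    exact (Finset.sum_subtype _ (by simp) fun p : ι × ι => f p.1 p.2).symm
  have hlt : ∀ f : ι → ι → ℕ, ∑ p : {p : ι × ι // p.1 < p.2}, f p.1.1 p.1.2 =
      ∑ i, ∑ j, if i < j then f i j else 0 := by
    intro f
    rw [← Fintype.sum_prod_type', ← Finset.sum_filter]
    exact (Finset.sum_subtype _ (by simp) fun p : ι × ι => f p.1 p.2).symm
  rw [hle (fun i j => B.expo n i j), hlt (fun i j => min (B.lam i) (B.lam j)),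
    hle (fun i j => min (min (B.lam i) (B.lam j)) n)]
  have h1 : ∀ i j, (if i ≤ j then B.expo n i j else 0) + (if i < j then min (B.lam i) (B.lam j) else 0)
      = (if i ≤ j then B.lam j else 0) + (if i < j then B.lam i else 0) +
        if i ≤ j then min (min (B.lam i) (B.lam j)) n else 0 := by
    intro i j
    rcases lt_trichotomy i j with h | h | h
    · rw [if_pos h.le, if_pos h, if_pos h.le, if_pos h, if_pos h.le, expo, mu, mu]
      omega
    · subst h
      simp [expo, mu]
    · rw [if_neg (not_le.mpr h), if_neg (not_lt.mpr h.le), if_neg (not_le.mpr h),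
        if_neg (not_lt.mpr h.le), if_neg (not_le.mpr h)]
  have h2 : ∑ i, ∑ j, ((if i ≤ j then B.lam j else 0) + (if i < j then B.lam i else 0)) =
      (∑ i, B.lam i) * Fintype.card ι := by
    simp only [Finset.sum_add_distrib]
    rw [Finset.sum_comm, ← Finset.sum_add_distrib, Finset.sum_mul]
    refine Finset.sum_congr rfl fun i _ => ?_
    rw [← Finset.sum_add_distrib]
    have : ∀ j, ((if j ≤ i then B.lam i else 0) + if i < j then B.lam i else 0) = B.lam i := by
      intro j
      rcases le_or_gt j i with h | h
      · rw [if_pos h, if_neg (not_lt.mpr h), add_zero]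
      · rw [if_neg (not_le.mpr h), if_pos h, zero_add]
    rw [Finset.sum_congr rfl fun j _ => this j, Finset.sum_const, Finset.card_univ, smul_eq_mul,
      mul_comm]
  rw [← h2, ← Finset.sum_add_distrib, ← Finset.sum_add_distrib]
  refine Finset.sum_congr rfl fun i _ => ?_
  rw [← Finset.sum_add_distrib, ← Finset.sum_add_distrib]
  exact Finset.sum_congr rfl fun j _ => h1 i j

end AdaptedBases

theorem cardSymSq_pos (Y : BEG ℓ n) : 0 < cardSymSq Y := Nat.card_pos

end Counts

/-! ### Homomorphisms from the lattice to finite ℓ-groups -/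

section LatticeHoms

variable {ℓ : ℕ} [Fact ℓ.Prime] {g n : ℕ} {A : Type*} [AddCommGroup A]

theorem lattice_hom_ext {k : ℕ} (hk : ∀ a : A, ℓ ^ k • a = 0) {F F' : Lattice ℓ g →+ A}
    (h : ∀ i, F (Pi.single i 1) = F' (Pi.single i 1)) : F = F' := by
  refine AddMonoidHom.ext fun x => ?_
  rw [pi_eq_sum_univ' x, map_sum, map_sum]
  refine Finset.sum_congr rfl fun i _ => ?_
  obtain ⟨m, d, hm⟩ := exists_natCast_add k (x i)
  rw [hm, map_natCast_add_smul F hk, map_natCast_add_smul F' hk, h]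

/-- The homomorphism from the lattice with given values on the standard basis. -/
theorem exists_lattice_hom {k : ℕ} (hk : ∀ a : A, ℓ ^ k • a = 0) (a : Fin g ⊕ Fin g → A) :
    ∃ F : Lattice ℓ g →+ A, ∀ i, F (Pi.single i 1) = a i := by
  let L : A → ZMod (ℓ ^ k) →+ A := fun b => ZMod.lift (ℓ ^ k) ⟨zmultiplesHom A b, by
    rw [zmultiplesHom_apply, natCast_zsmul, hk]⟩
  have hL : ∀ b, L b 1 = b := by
    intro b
    have h : ((1 : ℤ) : ZMod (ℓ ^ k)) = 1 := Int.cast_one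
    rw [← h]
    change ZMod.lift _ _ _ = _
    rw [ZMod.lift_coe, zmultiplesHom_apply, one_zsmul]
  refine ⟨∑ i, ((L (a i)).comp (PadicInt.toZModPow k).toAddMonoidHom).comp
    (Pi.evalAddMonoidHom (fun _ => ℤ_[ℓ]) i), fun i => ?_⟩
  rw [AddMonoidHom.finsetSum_apply, Finset.sum_eq_single i]
  · change L (a i) (PadicInt.toZModPow k ((Pi.single i 1 : Lattice ℓ g) i)) = _
    rw [Pi.single_eq_same, map_one, hL]
  · intro j _ hj
    change L (a j) (PadicInt.toZModPow k ((Pi.single i 1 : Lattice ℓ g) j)) = _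
    rw [Pi.single_eq_of_ne hj, map_zero, map_zero]
  · simp

/-- Homomorphisms from the lattice are tuples of elements. -/
def latticeHomEquiv {k : ℕ} (hk : ∀ a : A, ℓ ^ k • a = 0) :
    (Lattice ℓ g →+ A) ≃ (Fin g ⊕ Fin g → A) :=
  Equiv.ofBijective (fun F i => F (Pi.single i 1))
    ⟨fun _ _ h => lattice_hom_ext hk (congrFun h), fun a =>
      (exists_lattice_hom hk a).imp fun _ h => funext h⟩

end LatticeHoms

/-! ### Rank-refined moments of the matrix model -/

section Moments

variable {ℓ : ℕ} [Fact ℓ.Prime] {g n : ℕ}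

/-- The surjections from the lattice carrying `∑ e_i ∧ f_i` to `ω`. -/
def OmegaSurj (g : ℕ) (Y : BEG ℓ n) : Type :=
  {F : Lattice ℓ g →+ Y.carrier // Function.Surjective F ∧ latOmega F = Y.ω}

instance (Y : BEG ℓ n) : Finite (Lattice ℓ g →+ Y.carrier) := by
  obtain ⟨k, hk⟩ := exists_uniform_pow_smul Y.isPrimary
  exact Finite.of_equiv _ (latticeHomEquiv hk).symm

instance (Y : BEG ℓ n) : Finite (OmegaSurj g Y) := Subtype.finite

instance (Y : BEG ℓ n) : Fintype (OmegaSurj g Y) := Fintype.ofFinite _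

/-- The number of surjections carrying `∑ e_i ∧ f_i` to `ω`, normalized. -/
def omegaRatio (g : ℕ) (Y : BEG ℓ n) : ℝ :=
  Nat.card (OmegaSurj g Y) * Nat.card (wedgeSq Y.carrier) / (Nat.card Y.carrier : ℝ) ^ (g + g)

open Classical in
-- For fixed F, the probability of being a morphism is multiplied by the mean of φ over a uniform
-- symmetric block. That block has size 2g - rank Y for every F, so `hv` supplies the same mean v
-- for all of them.
theorem integral_liftsMor (hℓ : ℓ ≠ 2) (hn : 0 < n) (Y : BEG ℓ n) (F : OmegaSurj g Y) (φ : ℕ → ℝ)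
    (v : ℝ) (hv : ∀ (κ : Type) [Fintype κ] [DecidableEq κ],
      homCard ℓ Y.carrier * ℓ ^ Fintype.card κ = ℓ ^ (g + g) →
      symAvg κ ℓ (fun t => φ (homCard ℓ Y.carrier * t)) = v) :
    Integrable (fun M : skewSymplectic ℓ g => if LiftsMor Y M.1 F.1 then φ (homCard ℓ (Coker n M.1)) else 0)
      (haarSkew ℓ g) ∧
    ∫ M : skewSymplectic ℓ g, (if LiftsMor Y M.1 F.1 then φ (homCard ℓ (Coker n M.1)) else 0)
      ∂(haarSkew ℓ g) = Nat.card (wedgeSq Y.carrier) / (Nat.card Y.carrier : ℝ) ^ (g + g) *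
        (cardSymSq Y : ℝ)⁻¹ * v := by
  obtain ⟨F, hF, hω⟩ := F
  obtain ⟨k, hk⟩ := exists_uniform_pow_smul Y.isPrimary
  obtain ⟨B⟩ := AdaptedBases.exists F hk
  let P : Fin (g + g) → Prop := fun i => B.lam i = 0
  have he : ∀ i j, P i → P j → B.expo n i j = 0 := by
    intro i j hi hj
    rw [AdaptedBases.expo, AdaptedBases.mu, AdaptedBases.mu, hi, hj]
    simp
  let E : symMat {i // P i} ℓ → Set (skewSymplectic ℓ g) := fun D =>
    entriesSet B.toDualBases (B.expo n) (B.symTarget hF) P D.1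
  have hE : ∀ D, MeasurableSet (E D) := fun D => measurableSet_entriesSet _ _ _ _ he D
  have hfun : (fun M : skewSymplectic ℓ g =>
      if LiftsMor Y M.1 F then φ (homCard ℓ (Coker n M.1)) else 0) = fun M =>
      ∑ D : symMat {i // P i} ℓ, (E D).indicator (fun _ => φ (homCard ℓ Y.carrier * kerCard D.1)) M := by
    funext M
    have hiff := B.liftsMor_iff_symTarget hF M.2 hω
    by_cases h : LiftsMor Y M.1 F
    · rw [if_pos h, B.homCard_coker hn hF M.2 h,
        Finset.sum_eq_single ⟨B.redMat P M.1, B.redMat_mem P M.2⟩]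
      · rw [Set.indicator_of_mem]
        exact ⟨hiff.mp h, rfl⟩
      · intro D _ hD
        rw [Set.indicator_of_notMem]
        intro hM
        exact hD (Subtype.ext hM.2.symm)
      · intro h
        exact absurd (Finset.mem_univ _) h
    · rw [if_neg h]
      refine (Finset.sum_eq_zero fun D _ => ?_).symm
      rw [Set.indicator_of_notMem]
      intro hM
      exact h (hiff.mpr hM.1)
  have hint : ∀ D, Integrable ((E D).indicator
      (fun _ => φ (homCard ℓ Y.carrier * kerCard D.1))) (haarSkew ℓ g) := fun D =>
    (integrable_const _).indicator (hE D)
  have hprod : ((∏ p : {p : Fin (g + g) × Fin (g + g) // p.1 ≤ p.2},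
      ((ℓ : ℝ≥0∞) ^ B.expo n p.1.1 p.1.2)⁻¹)).toReal =
      Nat.card (wedgeSq Y.carrier) / (Nat.card Y.carrier : ℝ) ^ (g + g) * (cardSymSq Y : ℝ)⁻¹ := by
    have h1 := B.prod_pow_expo hF hℓ
    rw [Fintype.card_fin] at h1
    rw [ENNReal.toReal_prod]
    simp only [ENNReal.toReal_inv, ENNReal.toReal_pow, ENNReal.toReal_natCast]
    rw [Finset.prod_inv_distrib]
    have h2 : (∏ p : {p : Fin (g + g) × Fin (g + g) // p.1 ≤ p.2}, (ℓ : ℝ) ^ B.expo n p.1.1 p.1.2) *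
        Nat.card (wedgeSq Y.carrier) = (Nat.card Y.carrier : ℝ) ^ (g + g) * cardSymSq Y := by
      exact_mod_cast h1
    have hl : (0 : ℝ) < ℓ := by exact_mod_cast prime_pos (ℓ := ℓ)
    have h3 : (∏ p : {p : Fin (g + g) × Fin (g + g) // p.1 ≤ p.2},
        (ℓ : ℝ) ^ B.expo n p.1.1 p.1.2) ≠ 0 := Finset.prod_ne_zero_iff.mpr fun p _ => by positivity
    have h4 : (Nat.card Y.carrier : ℝ) ≠ 0 := by exact_mod_cast Nat.card_pos.ne'
    have h5 : (cardSymSq Y : ℝ) ≠ 0 := by exact_mod_cast (cardSymSq_pos Y).ne'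
    field_simp
    linear_combination -h2
  have hκ := hv {i // P i} (B.card_lam_eq_zero hF |>.trans (by rw [Fintype.card_fin]))
  constructor
  · rw [hfun]
    exact integrable_finsetSum _ fun D _ => hint D
  · rw [hfun, integral_finsetSum _ fun D _ => hint D, ← hκ, symAvg, ← hprod, mul_div_assoc',
      Finset.mul_sum, Finset.sum_div]
    refine Finset.sum_congr rfl fun D _ => ?_
    rw [integral_indicator_const _ (hE D), smul_eq_mul, measureReal_def,
      haarSkew_entriesSet _ _ _ _ he D, ENNReal.toReal_div, ENNReal.toReal_natCast]
    ring

open Classical in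
theorem integral_sum_liftsMor (hℓ : ℓ ≠ 2) (hn : 0 < n) (Y : BEG ℓ n) (φ : ℕ → ℝ)
    (v : ℝ) (hv : ∀ (κ : Type) [Fintype κ] [DecidableEq κ],
      homCard ℓ Y.carrier * ℓ ^ Fintype.card κ = ℓ ^ (g + g) →
      symAvg κ ℓ (fun t => φ (homCard ℓ Y.carrier * t)) = v) :
    Integrable (fun M : skewSymplectic ℓ g => (Nat.card {F : OmegaSurj g Y // LiftsMor Y M.1 F.1} : ℝ) *
      φ (homCard ℓ (Coker n M.1))) (haarSkew ℓ g) ∧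
    ∫ M : skewSymplectic ℓ g, (Nat.card {F : OmegaSurj g Y // LiftsMor Y M.1 F.1} : ℝ) *
      φ (homCard ℓ (Coker n M.1)) ∂(haarSkew ℓ g) = omegaRatio g Y * (cardSymSq Y : ℝ)⁻¹ * v := by
  have hfun : (fun M : skewSymplectic ℓ g =>
      (Nat.card {F : OmegaSurj g Y // LiftsMor Y M.1 F.1} : ℝ) * φ (homCard ℓ (Coker n M.1))) =
      fun M => ∑ F : OmegaSurj g Y,
        if LiftsMor Y M.1 F.1 then φ (homCard ℓ (Coker n M.1)) else 0 := by
    funext M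
    rw [← Finset.sum_filter, Finset.sum_const, nsmul_eq_mul, Nat.card_eq_fintype_card,
      Fintype.card_subtype]
  rw [hfun]
  refine ⟨integrable_finsetSum _ fun F _ => (integral_liftsMor hℓ hn Y F φ v hv).1, ?_⟩
  rw [integral_finsetSum _ fun F _ => (integral_liftsMor hℓ hn Y F φ v hv).1,
    Finset.sum_congr rfl fun F _ => (integral_liftsMor hℓ hn Y F φ v hv).2, Finset.sum_const,
    Finset.card_univ, nsmul_eq_mul, omegaRatio, Nat.card_eq_fintype_card (α := OmegaSurj g Y)]
  ring

/-- Surjective morphisms from `G_M` are surjections from the lattice satisfying `LiftsMor`. -/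
theorem card_surj_linearBEG (hℓ : ℓ ≠ 2) (M : skewSymplectic ℓ g) (hfin : Finite (Coker n M.1))
    (Y : BEG ℓ n) : Nat.card (Surj (linearBEG n hℓ M hfin) Y) =
      Nat.card {F : OmegaSurj g Y // LiftsMor Y M.1 F.1} := by
  let π : Lattice ℓ g →+ Coker n M.1 := (proj n M.1).toAddMonoidHom
  have hπ : Function.Surjective π := Submodule.mkQ_surjective _
  have hπ0 : ∀ x, π x = 0 ↔ ∃ y, shift n M.1 y = x := fun x => Submodule.Quotient.mk_eq_zero _
  have hω : ∀ f : Coker n M.1 →+ Y.carrier,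
      TensorProduct.map f.toIntLinearMap f.toIntLinearMap (omegaM n M.1) = latOmega (f.comp π) := by
    intro f
    rw [omegaM, latOmega, map_sum]
    exact Finset.sum_congr rfl fun i _ => by rw [map_sub]; rfl
  have hmor : ∀ f : Coker n M.1 →+ Y.carrier,
      IsMor (linearBEG n hℓ M hfin) Y f ↔ LiftsMor Y M.1 (f.comp π) := by
    intro f
    constructor
    · rintro ⟨h1, h2⟩
      refine ⟨fun x => ?_, (hω f).symm.trans h1, fun γ s u hγ hu => ?_⟩
      · rw [AddMonoidHom.comp_apply, (hπ0 _).mpr ⟨x, rfl⟩, map_zero]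
      · rw [← h2 γ]
        exact congrArg f (psiM_eq M.2 (pullDual f γ) ⟨hγ, hu⟩).symm
    · intro h
      refine ⟨(hω f).trans h.omega, fun γ => ?_⟩
      obtain ⟨s, u, hsu⟩ := PsiRel.exists M.2 (pullDual f γ).1 (pullDual f γ).2
      rw [← h.psi γ s u hsu.1 hsu.2]
      exact congrArg f (psiM_eq M.2 (pullDual f γ) hsu)
  refine Nat.card_congr (Equiv.ofBijective (fun f => ⟨⟨f.1.comp π, f.2.2.comp hπ,
    ((hmor f.1).mp f.2.1).omega⟩, (hmor f.1).mp f.2.1⟩) ⟨fun f f' h => ?_, fun F => ?_⟩)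
  · apply Subtype.ext
    exact comp_injective_of_surjective π hπ (congrArg (fun F => F.1.1) h)
  · obtain ⟨f, hf⟩ := exists_comp_eq_of_ker_le π hπ F.1.1 (fun x hx => by
      obtain ⟨y, rfl⟩ := (hπ0 x).mp hx
      exact F.2.shift_eq_zero y)
    have hf' : f.comp π = F.1.1 := AddMonoidHom.ext hf
    refine ⟨⟨f, (hmor f).mpr (hf' ▸ F.2), fun y => ?_⟩, Subtype.ext (Subtype.ext hf')⟩
    obtain ⟨x, hx⟩ := F.1.2.1 y
    exact ⟨π x, (hf x).trans hx⟩

theorem surjCount_linearClass (hℓ : ℓ ≠ 2) (M : skewSymplectic ℓ g) (hfin : Finite (Coker n M.1))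
    (Y : BEG ℓ n) : surjCount (linearClass n hℓ M) Y =
      Nat.card {F : OmegaSurj g Y // LiftsMor Y M.1 F.1} := by
  rw [linearClass, dif_pos hfin, surjCount_cls, card_surj_linearBEG]

theorem rankCard_linearClass (hℓ : ℓ ≠ 2) (M : skewSymplectic ℓ g) (hfin : Finite (Coker n M.1)) :
    rankCard (linearClass n hℓ M) = homCard ℓ (Coker n M.1) := by
  rw [linearClass, dif_pos hfin, rankCard_cls]
  rfl

end Moments

/-! ### The exponent of the cokernel, uniformly in g -/

section Exponent

variable {ℓ : ℕ} [Fact ℓ.Prime] {g n : ℕ}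

theorem padic_dvd_pow_or (k : ℕ) (a : ℤ_[ℓ]) : a ∣ (ℓ : ℤ_[ℓ]) ^ k ∨ (ℓ : ℤ_[ℓ]) ^ (k + 1) ∣ a := by
  rcases eq_or_ne a 0 with rfl | ha
  · exact Or.inr (dvd_zero _)
  · have h : Associated ((ℓ : ℤ_[ℓ]) ^ a.valuation) a :=
      ⟨PadicInt.unitCoeff ha, by rw [mul_comm]; exact (PadicInt.unitCoeff_spec ha).symm⟩
    rcases le_or_gt a.valuation k with h1 | h1
    · exact Or.inl (h.dvd_iff_dvd_left.mp (pow_dvd_pow _ h1))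
    · exact Or.inr (h.dvd_iff_dvd_right.mp (pow_dvd_pow _ h1))

/-- If ℓ^k does not kill the cokernel, some primitive functional ⟨·, s⟩ is divisible by ℓ^(k+1) on
the image of M + ℓ^n. The adjoint of M + ℓ^n is -(M - ℓ^n), so s is an eigenvector modulo ℓ^(k+1).
-/
theorem exists_primitive_eigenvector {M : Mat ℓ g} (hM : M ∈ skewSymplectic ℓ g) (k : ℕ)
    (h : ¬ ∀ x : Coker n M, ℓ ^ k • x = 0) : ∃ s v u : Lattice ℓ g, sympForm v s = 1 ∧
      M.mulVec s = (ℓ : ℤ_[ℓ]) ^ n • s + (ℓ : ℤ_[ℓ]) ^ (k + 1) • u := by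
  let N := LinearMap.range (shift n M)
  obtain ⟨m, snf⟩ := N.smithNormalForm (Pi.basisFun ℤ_[ℓ] (Fin g ⊕ Fin g))
  have key : ∃ j, ∀ y : N, (ℓ : ℤ_[ℓ]) ^ (k + 1) ∣ snf.bM.coord j y := by
    by_contra H
    -- If no coordinate were divisible by ℓ^(k+1) on the image, every elementary divisor would
    -- divide ℓ^k and none would be missing: a coordinate outside the embedding is identically zero
    -- on the image.
    push Not at H
    apply h
    have h1 : ∀ j, ∃ i, snf.f i = j ∧ snf.a i ∣ (ℓ : ℤ_[ℓ]) ^ k := by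
      intro j
      obtain ⟨y, hy⟩ := H j
      by_cases hj : j ∈ Set.range snf.f
      · obtain ⟨i, rfl⟩ := hj
        refine ⟨i, rfl, (padic_dvd_pow_or k (snf.a i)).resolve_right fun hd => hy ?_⟩
        have e := LinearMap.congr_fun (snf.coord_apply_embedding_eq_smul_coord (i := i)) y
        change snf.bM.coord (snf.f i) y = snf.a i * snf.bN.coord i y at e
        rw [e]
        exact hd.mul_right _
      · exfalso
        apply hy
        have e := snf.repr_eq_zero_of_notMem_range y hj
        rw [Module.Basis.coord_apply, e]
        exact dvd_zero _
    intro x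
    obtain ⟨x, rfl⟩ := Submodule.mkQ_surjective _ x
    rw [← map_nsmul]
    refine (Submodule.Quotient.mk_eq_zero _).mpr ?_
    rw [← snf.bM.sum_repr x, Finset.smul_sum]
    refine sum_mem fun j _ => ?_
    obtain ⟨i, rfl, c, hc⟩ := h1 j
    have e : ℓ ^ k • (snf.bM.repr x (snf.f i)) • snf.bM (snf.f i) =
        (snf.bM.repr x (snf.f i) * c) • (snf.bN i : Lattice ℓ g) := by
      rw [snf.snf, ← Nat.cast_smul_eq_nsmul ℤ_[ℓ], Nat.cast_pow, hc, smul_smul, smul_smul]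
      congr 1
      ring
    rw [e]
    exact Submodule.smul_mem _ _ (snf.bN i).2
  obtain ⟨j, hj⟩ := key
  obtain ⟨s, hs⟩ := exists_sympForm_eq_linear (snf.bM.coord j)
  obtain ⟨u, hu⟩ := exists_eq_smul (k + 1) (shift n M s - (2 * (ℓ : ℤ_[ℓ]) ^ n) • s) (fun x => by
    rw [toZModPow_eq_zero]
    have e := sympForm_shift (n := n) hM x s
    have e2 : sympForm x (shift n M s - (2 * (ℓ : ℤ_[ℓ]) ^ n) • s) = - sympForm (shift n M x) s := by
      rw [sub_eq_add_neg, ← neg_smul, sympForm_add_right, sympForm_smul_right]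
      linear_combination e
    rw [e2, dvd_neg, ← hs]
    exact hj ⟨_, x, rfl⟩)
  refine ⟨s, snf.bM j, u, ?_, ?_⟩
  · rw [← hs, Module.Basis.coord_apply, Module.Basis.repr_self, Finsupp.single_eq_same]
  · rw [← hu, shift_apply]
    module

/-- Reduction of lattice vectors modulo `ℓ^m`. -/
def redVec (m : ℕ) : Lattice ℓ g →+ (Fin g ⊕ Fin g → ZMod (ℓ ^ m)) where
  toFun x i := PadicInt.toZModPow m (x i)
  map_zero' := funext fun _ => map_zero _
  map_add' _ _ := funext fun _ => map_add _ _ _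

theorem redVec_apply (m : ℕ) (x : Lattice ℓ g) (i : Fin g ⊕ Fin g) :
    redVec m x i = PadicInt.toZModPow m (x i) := rfl

theorem redVec_surjective (m : ℕ) : Function.Surjective (redVec (ℓ := ℓ) (g := g) m) := by
  intro y
  choose c hc using fun i => ZMod.ringHom_surjective (PadicInt.toZModPow m) (y i)
  exact ⟨c, funext hc⟩

theorem redVec_smul (m : ℕ) (c : ℤ_[ℓ]) (x : Lattice ℓ g) :
    redVec m (c • x) = PadicInt.toZModPow m c • redVec m x :=
  funext fun i => map_mul (PadicInt.toZModPow m) c (x i)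

theorem redVec_eq_iff (m : ℕ) (x y : Lattice ℓ g) :
    redVec m x = redVec m y ↔ ∃ u, x = y + (ℓ : ℤ_[ℓ]) ^ m • u := by
  constructor
  · intro h
    have h1 : ∀ i, (ℓ : ℤ_[ℓ]) ^ m ∣ x i - y i := by
      intro i
      rw [← toZModPow_eq_zero, map_sub, sub_eq_zero]
      exact congrFun h i
    choose u hu using h1
    refine ⟨u, funext fun i => ?_⟩
    rw [Pi.add_apply, Pi.smul_apply, smul_eq_mul, ← hu]
    ring
  · rintro ⟨u, rfl⟩
    rw [map_add, redVec_smul, (toZModPow_eq_zero m _).mpr dvd_rfl, zero_smul, add_zero]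

/-- `s` is primitive modulo `ℓ^m` and an eigenvector of `M` modulo `ℓ^m`. -/
def IsEigen (n m : ℕ) (M : Mat ℓ g) (s : Lattice ℓ g) : Prop :=
  (∃ v, PadicInt.toZModPow m (sympForm v s) = 1) ∧
    redVec m (M.mulVec s) = redVec m ((ℓ : ℤ_[ℓ]) ^ n • s)

theorem IsEigen.congr {m : ℕ} {M : Mat ℓ g} {s s' : Lattice ℓ g} (h : IsEigen n m M s)
    (hs : redVec m s' = redVec m s) : IsEigen n m M s' := by
  obtain ⟨⟨v, hv⟩, h2⟩ := h
  obtain ⟨u, rfl⟩ := (redVec_eq_iff m _ _).mp hs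
  have h0 : PadicInt.toZModPow m ((ℓ : ℤ_[ℓ]) ^ m) = 0 := (toZModPow_eq_zero m _).mpr dvd_rfl
  refine ⟨⟨v, ?_⟩, ?_⟩
  · rw [sympForm_add_right, sympForm_smul_right, map_add, hv, map_mul, h0, zero_mul, add_zero]
  · rw [Matrix.mulVec_add, Matrix.mulVec_smul, smul_add, map_add, map_add, h2, redVec_smul m _ (M.mulVec u),
      smul_comm, redVec_smul m _ ((ℓ : ℤ_[ℓ]) ^ n • u), h0, zero_smul, zero_smul]

theorem IsEigen.smul {m : ℕ} {M : Mat ℓ g} {s : Lattice ℓ g} (h : IsEigen n m M s) {c d : ℤ_[ℓ]}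
    (hcd : PadicInt.toZModPow m (d * c) = 1) : IsEigen n m M (c • s) := by
  obtain ⟨⟨v, hv⟩, h2⟩ := h
  refine ⟨⟨d • v, ?_⟩, ?_⟩
  · rw [sympForm_smul_right, sympForm_smul_left, ← mul_assoc, map_mul, hv, mul_one, mul_comm, hcd]
  · rw [Matrix.mulVec_smul, redVec_smul, h2, ← redVec_smul, smul_comm]

/-- The map `M ↦ M s mod ℓ^m`. -/
def mulVecMod (m : ℕ) (s : Lattice ℓ g) :
    skewSymplectic ℓ g →+ (Fin g ⊕ Fin g → ZMod (ℓ ^ m)) where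
  toFun M := redVec m (M.1.mulVec s)
  map_zero' := by
    change redVec m ((0 : Mat ℓ g).mulVec s) = 0
    rw [Matrix.zero_mulVec, map_zero]
  map_add' M M' := by
    change redVec m ((M.1 + M'.1).mulVec s) = _
    rw [Matrix.add_mulVec, map_add]

/-- Hence M s is uniform modulo ℓ^m for every primitive s. -/
theorem mulVecMod_surjective (m : ℕ) {s v : Lattice ℓ g}
    (hv : PadicInt.toZModPow m (sympForm v s) = 1) : Function.Surjective (mulVecMod m s) := by
  intro y
  obtain ⟨t, rfl⟩ := redVec_surjective m y
  obtain ⟨w, hw⟩ : ∃ w, PadicInt.toZModPow m (sympForm s w) = 1 := by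
    refine ⟨(-1 : ℤ_[ℓ]) • v, ?_⟩
    rw [sympForm_smul_right, sympForm_swap]
    simpa using hv
  -- The symmetric rank-two construction again: with ⟨s, w⟩ ≡ 1, the first term sends s to t, and
  -- the third cancels the multiple of w produced by the second.
  let L : Lattice ℓ g →ₗ[ℤ_[ℓ]] Lattice ℓ g :=
    { toFun := fun x => sympForm x w • t + sympForm x t • w -
        (sympForm s t * sympForm x w) • w
      map_add' := fun x y => by
        simp only [sympForm_add_left, mul_add, add_smul]
        abel
      map_smul' := fun c x => by
        simp only [sympForm_smul_left, RingHom.id_apply]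
        module }
  have hL : ∀ x, L x = sympForm x w • t + sympForm x t • w - (sympForm s t * sympForm x w) • w :=
    fun _ => rfl
  have hmul : ∀ x, (LinearMap.toMatrix' L).mulVec x = L x := fun x => by
    rw [← Matrix.mulVecLin_apply, ← Matrix.toLin'_apply', Matrix.toLin'_toMatrix']
  refine ⟨⟨LinearMap.toMatrix' L, fun x y => ?_⟩, ?_⟩
  · rw [hmul, hmul, sympForm_swap x (L y), neg_neg, hL, hL, sympForm_sub_left, sympForm_sub_left,
      sympForm_add_left, sympForm_add_left]
    simp only [sympForm_smul_left]
    rw [sympForm_swap t y, sympForm_swap w y, sympForm_swap t x, sympForm_swap w x]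
    ring
  · change redVec m ((LinearMap.toMatrix' L).mulVec s) = _
    rw [hmul, hL, map_sub, map_add, redVec_smul, redVec_smul, redVec_smul, map_mul, hw, mul_one,
      one_smul, add_sub_cancel_right]

theorem measurableSet_mulVecMod (m : ℕ) (s : Lattice ℓ g) (a : Fin g ⊕ Fin g → ZMod (ℓ ^ m)) :
    MeasurableSet (mulVecMod m s ⁻¹' {a}) := by
  have : mulVecMod m s ⁻¹' {a} = ⋂ i, {M : skewSymplectic ℓ g |
      PadicInt.toZModPow m (M.1.mulVec s i) = a i} := by
    ext M
    rw [Set.mem_preimage, Set.mem_singleton_iff, funext_iff, Set.mem_iInter]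
    rfl
  rw [this]
  refine MeasurableSet.iInter fun i => ?_
  have hc : Continuous fun M : skewSymplectic ℓ g => M.1.mulVec s i := by
    have h : Continuous fun M : Mat ℓ g => M.mulVec s i := by
      unfold Matrix.mulVec dotProduct
      fun_prop
    exact h.comp continuous_subtype_val
  exact ((isOpen_toZModPow_preimage m _).preimage hc).measurableSet

open Classical in
-- Each vector modulo ℓ^m is a primitive eigenvector with probability at most one over the number of
-- vectors, so the expected number of them is at most 1. Units modulo ℓ^m act freely on them, so
-- they come φ(ℓ^m) at a time; apply Markov's inequality.
theorem haarSkew_exists_isEigen_le (n m : ℕ) :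
    haarSkew ℓ g {M | ∃ s, IsEigen n m M.1 s} ≤ ((ℓ ^ m).totient : ℝ≥0∞)⁻¹ := by
  choose lift hlift using redVec_surjective (ℓ := ℓ) (g := g) m
  let S := Fin g ⊕ Fin g → ZMod (ℓ ^ m)
  let E : S → Set (skewSymplectic ℓ g) := fun z => {M | IsEigen n m M.1 (lift z)}
  have hE : ∀ z, (∃ v, PadicInt.toZModPow m (sympForm v (lift z)) = 1) →
      E z = mulVecMod m (lift z) ⁻¹' {redVec m ((ℓ : ℤ_[ℓ]) ^ n • lift z)} := fun z hz =>
    Set.ext fun M => ⟨fun h => h.2, fun h => ⟨hz, h⟩⟩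
  have hE0 : ∀ z, (¬ ∃ v, PadicInt.toZModPow m (sympForm v (lift z)) = 1) → E z = ∅ := fun z hz =>
    Set.eq_empty_of_forall_notMem fun M h => hz h.1
  have hmeas : ∀ z, MeasurableSet (E z) := by
    intro z
    by_cases hz : ∃ v, PadicInt.toZModPow m (sympForm v (lift z)) = 1
    · rw [hE z hz]
      exact measurableSet_mulVecMod _ _ _
    · rw [hE0 z hz]
      exact MeasurableSet.empty
  have hle : ∀ z, haarSkew ℓ g (E z) ≤ (Nat.card S : ℝ≥0∞)⁻¹ := by
    intro z
    by_cases hz : ∃ v, PadicInt.toZModPow m (sympForm v (lift z)) = 1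
    · obtain ⟨v, hv⟩ := hz
      rw [hE z ⟨v, hv⟩, haarSkew_fiber _ (mulVecMod_surjective m hv)
        (fun a => measurableSet_mulVecMod _ _ _)]
    · rw [hE0 z hz, measure_empty]
      exact zero_le
  have hint : ∫⁻ M, ∑ z : S, (E z).indicator 1 M ∂(haarSkew ℓ g) ≤ 1 := by
    rw [lintegral_finsetSum _ fun z _ => measurable_one.indicator (hmeas z)]
    calc ∑ z : S, ∫⁻ M, (E z).indicator 1 M ∂(haarSkew ℓ g)
        ≤ ∑ _z : S, (Nat.card S : ℝ≥0∞)⁻¹ := Finset.sum_le_sum fun z _ => by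
          rw [lintegral_indicator_one (hmeas z)]
          exact hle z
      _ = 1 := by
          rw [Finset.sum_const, Finset.card_univ, nsmul_eq_mul, Nat.card_eq_fintype_card]
          exact ENNReal.mul_inv_cancel (by exact_mod_cast Fintype.card_ne_zero)
            (ENNReal.natCast_ne_top _)
  have hsub : {M : skewSymplectic ℓ g | ∃ s, IsEigen n m M.1 s} ⊆
      {M | ((ℓ ^ m).totient : ℝ≥0∞) ≤ ∑ z : S, (E z).indicator 1 M} := by
    rintro M ⟨s, hs⟩
    choose c hc using ZMod.ringHom_surjective (PadicInt.toZModPow (p := ℓ) m)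
    have h1 : ∀ u : (ZMod (ℓ ^ m))ˣ, M ∈ E (redVec m (c u • s)) := by
      intro u
      refine (hs.smul (c := c u) (d := c (u⁻¹ : (ZMod (ℓ ^ m))ˣ)) ?_).congr (hlift _)
      rw [map_mul, hc, hc, Units.inv_mul]
    obtain ⟨v, hv⟩ := hs.1
    have h2 : Function.Injective fun u : (ZMod (ℓ ^ m))ˣ => redVec m (c u • s) := by
      intro u u' h
      obtain ⟨t, ht⟩ := (redVec_eq_iff m _ _).mp h
      have h3 := congrArg (fun x => PadicInt.toZModPow m (sympForm v x)) ht
      rw [sympForm_add_right, sympForm_smul_right, sympForm_smul_right, sympForm_smul_right, map_add,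
        map_mul, map_mul, map_mul, hv, hc, hc, (toZModPow_eq_zero m _).mpr dvd_rfl] at h3
      apply Units.ext
      simpa using h3
    change ((ℓ ^ m).totient : ℝ≥0∞) ≤ _
    calc ((ℓ ^ m).totient : ℝ≥0∞) = ∑ z ∈ Finset.univ.image
          (fun u : (ZMod (ℓ ^ m))ˣ => redVec m (c u • s)), 1 := by
          rw [Finset.sum_const, Finset.card_image_of_injective _ h2, Finset.card_univ,
            ZMod.card_units_eq_totient, nsmul_eq_mul, mul_one]
      _ ≤ ∑ z ∈ Finset.univ.image (fun u : (ZMod (ℓ ^ m))ˣ => redVec m (c u • s)),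
          (E z).indicator 1 M := Finset.sum_le_sum fun z hz => by
          obtain ⟨u, -, rfl⟩ := Finset.mem_image.mp hz
          rw [Set.indicator_of_mem (h1 u)]
          rfl
      _ ≤ ∑ z : S, (E z).indicator 1 M :=
          Finset.sum_le_sum_of_subset (Finset.subset_univ _)
  refine (measure_mono hsub).trans ?_
  have hmk := mul_meas_ge_le_lintegral (μ := haarSkew ℓ g) (f := fun M => ∑ z : S, (E z).indicator 1 M)
    (Finset.measurable_sum _ fun z _ => measurable_one.indicator (hmeas z)) ((ℓ ^ m).totient : ℝ≥0∞)
  rw [ENNReal.le_inv_iff_mul_le, mul_comm]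
  exact hmk.trans hint

/-- Since φ(ℓ^(k+1)) = ℓ^k (ℓ - 1) ≥ ℓ^k. Independence of g makes this a tightness statement;
letting k grow shows that the cokernel is almost surely finite. -/
theorem haarSkew_not_killed_le (k : ℕ) :
    haarSkew ℓ g {M | ¬ ∀ x : Coker n M.1, ℓ ^ k • x = 0} ≤ ((ℓ : ℝ≥0∞) ^ k)⁻¹ := by
  refine (measure_mono fun M hM => ?_).trans ((haarSkew_exists_isEigen_le n (k + 1)).trans ?_)
  · obtain ⟨s, v, u, hv, hs⟩ := exists_primitive_eigenvector M.2 k hM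
    exact ⟨s, ⟨v, by rw [hv, map_one]⟩, (redVec_eq_iff _ _ _).mpr ⟨u, hs⟩⟩
  · rw [ENNReal.inv_le_inv, Nat.totient_prime_pow_succ Fact.out]
    have h : ℓ ^ k ≤ ℓ ^ k * (ℓ - 1) :=
      Nat.le_mul_of_pos_right _ (Nat.sub_pos_of_lt (Fact.out : ℓ.Prime).one_lt)
    exact_mod_cast h

theorem finite_coker_of_killed {M : Mat ℓ g} {k : ℕ} (h : ∀ x : Coker n M, ℓ ^ k • x = 0) :
    Finite (Coker n M) := by
  refine Finite.of_surjective (fun z : Fin g ⊕ Fin g → ZMod (ℓ ^ k) =>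
    proj n M (fun i => ((z i).val : ℤ_[ℓ]))) fun x => ?_
  obtain ⟨x, rfl⟩ := Submodule.mkQ_surjective _ x
  refine ⟨redVec k x, ?_⟩
  obtain ⟨u, hu⟩ := (redVec_eq_iff k x (fun i => ((redVec k x i).val : ℤ_[ℓ]))).mp (by
    funext i
    rw [redVec_apply _ (fun i => ((redVec k x i).val : ℤ_[ℓ])), map_natCast, ZMod.natCast_zmod_val])
  conv_rhs => rw [hu]
  rw [map_add, map_smul, ← Nat.cast_pow, Nat.cast_smul_eq_nsmul, h, add_zero]

theorem tendsto_inv_pow_prime : Tendsto (fun k : ℕ => ((ℓ : ℝ≥0∞) ^ k)⁻¹) atTop (𝓝 0) := by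
  have h : ((ℓ : ℝ≥0∞)⁻¹) < 1 := by
    rw [ENNReal.inv_lt_one]
    exact_mod_cast (Fact.out : ℓ.Prime).one_lt
  simpa [ENNReal.inv_pow] using ENNReal.tendsto_pow_atTop_nhds_zero_of_lt_one h

theorem ae_finite_coker (n : ℕ) : ∀ᵐ M ∂(haarSkew ℓ g), Finite (Coker n M.1) := by
  rw [ae_iff]
  refine le_antisymm ?_ zero_le
  refine ge_of_tendsto (tendsto_inv_pow_prime (ℓ := ℓ)) (Eventually.of_forall fun k => ?_)
  refine (measure_mono fun M hM h => ?_).trans (haarSkew_not_killed_le (n := n) k)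
  exact hM (finite_coker_of_killed h)

end Exponent

/-! ### The law of the random enhanced group -/

section LinearLaw

variable {ℓ : ℕ} [Fact ℓ.Prime] {g n : ℕ}

/-- If ℓ^n u = (M + ℓ^n) s, the identity for ⟨(M + ℓ^n)·, ·⟩ makes ⟨·, s⟩ divisible by ℓ^n on the
image, so s/ℓ^n defines a character whose ψ_M is u. Comparing orders then gives bijectivity. -/
theorem psiM_surjective {M : Mat ℓ g} (hM : M ∈ skewSymplectic ℓ g) :
    Function.Surjective (psiM n hM) := by
  rintro ⟨x, hx⟩
  obtain ⟨u, rfl⟩ := Submodule.mkQ_surjective _ x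
  have hπ0 : ∀ x, proj n M x = 0 ↔ ∃ y, shift n M y = x := fun x => Submodule.Quotient.mk_eq_zero _
  rw [mem_torsionBy_natCast, ← map_nsmul, ← Nat.cast_smul_eq_nsmul ℤ_[ℓ], Nat.cast_pow] at hx
  obtain ⟨s, hs⟩ := (hπ0 _).mp hx
  have hdvd : ∀ x, (proj n M).toAddMonoidHom x = 0 → (ℓ : ℤ_[ℓ]) ^ n ∣ sympForm x s := by
    intro x hx0
    obtain ⟨y, rfl⟩ := (hπ0 _).mp hx0
    have e := sympForm_shift (n := n) hM y s
    rw [hs, sympForm_smul_right] at e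
    exact ⟨2 * sympForm y s - sympForm y u, by linear_combination e⟩
  have hsurj : Function.Surjective (proj n M).toAddMonoidHom := Submodule.mkQ_surjective _
  refine ⟨charOf n hsurj s hdvd, Subtype.ext ?_⟩
  exact psiM_eq hM _ ⟨fun x => charOf_apply hsurj s hdvd x, hs⟩

theorem card_dual_torsion_le (A : Type*) [AddCommGroup A] [Finite A] :
    Nat.card (AddSubgroup.torsionBy (Dual A) ((ℓ ^ n : ℕ) : ℤ)) ≤
      Nat.card (AddSubgroup.torsionBy A ((ℓ ^ n : ℕ) : ℤ)) := by
  rw [card_torsionBy_eq_card_hom A]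
  have h : ∀ γ : AddSubgroup.torsionBy (Dual A) ((ℓ ^ n : ℕ) : ℤ),
      ∃ a : A →+ ZMod (ℓ ^ n), (toQZ (ℓ ^ n)).comp a = γ.1 := fun γ =>
    exists_hom_zmod (ℓ ^ n) (pow_pos prime_pos n) γ.1 (fun x =>
      DFunLike.congr_fun (mem_torsionBy_natCast.mp γ.2) x)
  choose a ha using h
  refine Nat.card_le_card_of_injective a fun γ γ' h => Subtype.ext ?_
  rw [← ha, ← ha, h]

theorem psiBijective_linearClass (hℓ : ℓ ≠ 2) (M : skewSymplectic ℓ g) (hfin : Finite (Coker n M.1)) :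
    psiBijective (linearClass n hℓ M) := by
  rw [linearClass, dif_pos hfin, psiBijective_cls]
  have := finite_dual_torsion (ℓ := ℓ) (n := n) (A := Coker n M.1)
  exact (psiM_surjective M.2).bijective_of_nat_card_le (card_dual_torsion_le _)

theorem killedBy_linearClass (hℓ : ℓ ≠ 2) (M : skewSymplectic ℓ g) {k : ℕ}
    (h : ∀ x : Coker n M.1, ℓ ^ k • x = 0) : KilledBy k (linearClass n hℓ M) := by
  rw [linearClass, dif_pos (finite_coker_of_killed h), killedBy_cls]
  exact h

/-- The rank of `Y`. -/
def rk (Y : BEG ℓ n) : ℕ := Nat.log ℓ (homCard ℓ Y.carrier)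

theorem homCard_eq_pow_rk (Y : BEG ℓ n) : homCard ℓ Y.carrier = ℓ ^ rk Y := by
  obtain ⟨w, hw⟩ := exists_homCard_eq_pow (ℓ := ℓ) Y.carrier
  rw [rk, hw, Nat.log_pow (Fact.out : ℓ.Prime).one_lt]

theorem rk_add_eq {Y : BEG ℓ n} {m N : ℕ} (h : homCard ℓ Y.carrier * ℓ ^ m = ℓ ^ N) : m = N - rk Y := by
  rw [homCard_eq_pow_rk, ← pow_add] at h
  have := Nat.pow_right_injective (Fact.out : ℓ.Prime).two_le h
  omega

theorem three_le (hℓ : ℓ ≠ 2) : 3 ≤ ℓ := by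
  have := (Fact.out : ℓ.Prime).two_le
  omega

theorem symAvg_ite_eq (hℓ : ℓ ≠ 2) (Y : BEG ℓ n) (κ : Type) [Fintype κ] [DecidableEq κ]
    (h : homCard ℓ Y.carrier * ℓ ^ Fintype.card κ = ℓ ^ (g + g)) :
    symAvg κ ℓ (fun t => if homCard ℓ Y.carrier * t = homCard ℓ Y.carrier then 1 else 0) =
      invProb ℓ (g + g - rk Y) := by
  have h0 : 0 < homCard ℓ Y.carrier := homCard_pos _
  rw [← rk_add_eq h, ← symAvg_eq_one (three_le hℓ)]
  congr 1
  funext t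
  have : homCard ℓ Y.carrier * t = homCard ℓ Y.carrier ↔ t = 1 := by
    rw [Nat.mul_eq_left h0.ne']
  simp only [this]

open Classical in
-- The classes are countable, so it suffices to treat fibres. Those with ψ not bijective are null.
theorem aemeasurable_linearClass (hℓ : ℓ ≠ 2) (hn : 0 < n) :
    AEMeasurable (linearClass (g := g) n hℓ) (haarSkew ℓ g) := by
  have hsing : ∀ c : BEGClass ℓ n,
      NullMeasurableSet (linearClass (g := g) n hℓ ⁻¹' {c}) (haarSkew ℓ g) := by
    intro c
    obtain ⟨Y, rfl⟩ : ∃ Y : BEG ℓ n, Y.cls = c := ⟨_, cls_out c⟩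
    by_cases hY : Function.Bijective Y.ψ
    · obtain ⟨hint, -⟩ := integral_sum_liftsMor (g := g) hℓ hn Y
        (fun t => if t = homCard ℓ Y.carrier then 1 else 0) _
        (fun κ _ _ h => symAvg_ite_eq hℓ Y κ h)
      -- Up to a null set, the fibre over Y is where the surjection count restricted to equal rank
      -- is nonzero, and that function is already known to be integrable.
      have hset := hint.1.aemeasurable.nullMeasurable (measurableSet_singleton (0 : ℝ)).compl
      refine hset.congr ?_
      filter_upwards [ae_finite_coker n] with M hM
      have e := surjCount_ite_rankCard hn (linearClass n hℓ M) Y (psiBijective_linearClass hℓ M hM) hY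
      rw [surjCount_linearClass hℓ M hM, rankCard_linearClass hℓ M hM] at e
      rw [eq_iff_iff]
      change ¬ ((Nat.card {F : OmegaSurj g Y // LiftsMor Y M.1 F.1} : ℝ) *
        (if homCard ℓ (Coker n M.1) = homCard ℓ Y.carrier then 1 else 0) = 0) ↔
        linearClass n hℓ M = Y.cls
      generalize Nat.card {F : OmegaSurj g Y // LiftsMor Y M.1 F.1} = N at e ⊢
      have hA := cardAut_pos Y
      by_cases h1 : linearClass n hℓ M = Y.cls
      · rw [if_pos h1] at e
        split_ifs at e ⊢ with h2
        · rw [e]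
          simp [h1, hA.ne']
        · omega
      · rw [if_neg h1] at e
        split_ifs at e ⊢ with h2
        · rw [e]
          simp [h1]
        · simp [h1]
    · refine NullMeasurableSet.of_null ?_
      refine measure_mono_null (show _ ⊆ {M : skewSymplectic ℓ g | ¬ Finite (Coker n M.1)} from
        fun M hM h => ?_) (ae_iff.mp (ae_finite_coker (ℓ := ℓ) (g := g) n))
      apply hY
      rw [← psiBijective_cls, ← show linearClass n hℓ M = Y.cls from hM]
      exact psiBijective_linearClass hℓ M h
  have hnull : NullMeasurable (linearClass (g := g) n hℓ) (haarSkew ℓ g) := by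
    intro s _
    have : linearClass (g := g) n hℓ ⁻¹' s = ⋃ c : s, linearClass (g := g) n hℓ ⁻¹' {c.1} := by
      ext M
      simp
    rw [this]
    exact NullMeasurableSet.iUnion fun c => hsing c.1
  have hcg : MeasurableSpace.CountablyGenerated (BEGClass ℓ n) := by
    have : DiscreteMeasurableSpace (BEGClass ℓ n) := ⟨fun _ => trivial⟩
    infer_instance
  exact hnull.aemeasurable

theorem isProbabilityMeasure_linearMeasure (hℓ : ℓ ≠ 2) (hn : 0 < n) (g : ℕ) :
    IsProbabilityMeasure (linearMeasure n hℓ g) :=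
  Measure.isProbabilityMeasure_map (aemeasurable_linearClass hℓ hn)

instance : DiscreteMeasurableSpace (BEGClass ℓ n) := ⟨fun _ => trivial⟩

theorem ae_linearMeasure (hℓ : ℓ ≠ 2) (hn : 0 < n) {p : BEGClass ℓ n → Prop}
    (h : ∀ᵐ M ∂(haarSkew ℓ g), p (linearClass n hℓ M)) : ∀ᵐ c ∂(linearMeasure n hℓ g), p c :=
  (ae_map_iff (aemeasurable_linearClass hℓ hn) (MeasurableSet.of_discrete)).mpr h

theorem ae_psiBijective (hℓ : ℓ ≠ 2) (hn : 0 < n) (g : ℕ) :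
    ∀ᵐ c ∂(linearMeasure n hℓ g), psiBijective c := by
  apply ae_linearMeasure hℓ hn
  filter_upwards [ae_finite_coker n] with M hM using psiBijective_linearClass hℓ M hM

theorem linearMeasure_not_killedBy_le (hℓ : ℓ ≠ 2) (hn : 0 < n) (g k : ℕ) :
    linearMeasure n hℓ g {c | ¬ KilledBy k c} ≤ ((ℓ : ℝ≥0∞) ^ k)⁻¹ := by
  rw [linearMeasure, Measure.map_apply_of_aemeasurable (aemeasurable_linearClass hℓ hn)
    MeasurableSet.of_discrete]
  refine (measure_mono fun M hM h => ?_).trans (haarSkew_not_killed_le (n := n) k)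
  exact hM (killedBy_linearClass hℓ M h)

theorem integral_surjCount_mul (hℓ : ℓ ≠ 2) (hn : 0 < n) (g : ℕ) (Y : BEG ℓ n) (φ : ℕ → ℝ)
    (v : ℝ) (hv : ∀ (κ : Type) [Fintype κ] [DecidableEq κ],
      homCard ℓ Y.carrier * ℓ ^ Fintype.card κ = ℓ ^ (g + g) →
      symAvg κ ℓ (fun t => φ (homCard ℓ Y.carrier * t)) = v) :
    Integrable (fun c => (surjCount c Y : ℝ) * φ (rankCard c)) (linearMeasure n hℓ g) ∧
    ∫ c, (surjCount c Y : ℝ) * φ (rankCard c) ∂(linearMeasure n hℓ g) =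
      omegaRatio g Y * (cardSymSq Y : ℝ)⁻¹ * v := by
  have h := integral_sum_liftsMor (g := g) hℓ hn Y φ v hv
  have hm := aemeasurable_linearClass (g := g) hℓ hn
  have hs : AEStronglyMeasurable (fun c : BEGClass ℓ n => (surjCount c Y : ℝ) * φ (rankCard c))
      (linearMeasure n hℓ g) := (Measurable.of_discrete).aestronglyMeasurable
  have hae : (fun M : skewSymplectic ℓ g => (Nat.card {F : OmegaSurj g Y // LiftsMor Y M.1 F.1} : ℝ) *
      φ (homCard ℓ (Coker n M.1))) =ᵐ[haarSkew ℓ g]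
      (fun c : BEGClass ℓ n => (surjCount c Y : ℝ) * φ (rankCard c)) ∘ linearClass n hℓ := by
    filter_upwards [ae_finite_coker n] with M hM
    rw [Function.comp_apply, surjCount_linearClass hℓ M hM, rankCard_linearClass hℓ M hM]
  refine ⟨?_, ?_⟩
  · rw [linearMeasure, integrable_map_measure hs hm]
    exact h.1.congr hae
  · rw [← h.2, linearMeasure, integral_map hm hs, integral_congr_ae hae]
    rfl

end LinearLaw

/-! ### Equidistribution of sums of bilinear values -/

section Equidistribution

theorem two_mul_card_le {A : Type*} [AddCommGroup A] [Finite A] {H : AddSubgroup A} (hH : H ≠ ⊤) :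
    2 * Nat.card H ≤ Nat.card A := by
  have h1 : H.index ≠ 1 := fun h => hH (AddSubgroup.index_eq_one.mp h)
  have h2 : H.index ≠ 0 := AddSubgroup.index_ne_zero_of_finite
  rw [← AddSubgroup.card_mul_index H, mul_comm]
  exact Nat.mul_le_mul_left _ (by omega)

theorem addChar_map_sum {W κ : Type*} [AddCommGroup W] (χ : AddChar W ℂ) (s : Finset κ) (f : κ → W) :
    χ (∑ i ∈ s, f i) = ∏ i ∈ s, χ (f i) := by
  classical
  induction s using Finset.induction_on with
  | empty => simp
  | insert a s ha ih => rw [Finset.sum_insert ha, Finset.prod_insert ha, χ.map_add_eq_mul, ih]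

variable {A W : Type*} [AddCommGroup A] [AddCommGroup W] [Fintype A] [Fintype W]

/-- The sum over y vanishes unless x lies in the left radical of χ ∘ β, a proper subgroup and so of
at most half the order. -/
theorem norm_sum_char_le (β : A →+ A →+ W) (χ : AddChar W ℂ) (hχ : ∃ x y, χ (β x y) ≠ 1) :
    ‖∑ p : A × A, χ (β p.1 p.2)‖ ≤ (Fintype.card A : ℝ) ^ 2 / 2 := by
  classical
  let K : AddSubgroup A :=
    { carrier := {x | ∀ y, χ (β x y) = 1}
      zero_mem' := fun y => by rw [map_zero, AddMonoidHom.zero_apply, AddChar.map_zero_eq_one]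
      add_mem' := fun {x x'} h h' y => by
        rw [map_add, AddMonoidHom.add_apply, AddChar.map_add_eq_mul, h, h', one_mul]
      neg_mem' := fun {x} h y => by
        rw [map_neg, AddMonoidHom.neg_apply, AddChar.map_neg_eq_inv, h, inv_one] }
  have hK : K ≠ ⊤ := by
    obtain ⟨x, y, hxy⟩ := hχ
    intro h
    have hx : x ∈ K := h ▸ AddSubgroup.mem_top x
    exact hxy (hx y)
  have hmem : ∀ x, x ∈ K ↔ χ.compAddMonoidHom (β x) = 0 := by
    intro x
    rw [AddChar.eq_zero_iff]
    rfl
  have hsum : ∑ p : A × A, χ (β p.1 p.2) = Nat.card K * Fintype.card A := by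
    rw [Fintype.sum_prod_type]
    have h1 : ∀ x, ∑ y, χ (β x y) = if x ∈ K then (Fintype.card A : ℂ) else 0 := by
      intro x
      have := AddChar.sum_eq_ite (χ.compAddMonoidHom (β x))
      simp only [hmem]
      exact this
    rw [Finset.sum_congr rfl fun x _ => h1 x, ← Finset.sum_filter, Finset.sum_const, nsmul_eq_mul,
      Nat.card_eq_fintype_card, Fintype.card_subtype]
  rw [hsum, ← Nat.cast_mul, Complex.norm_natCast, Nat.cast_mul]
  have h2 := two_mul_card_le hK
  rw [Nat.card_eq_fintype_card (α := A)] at h2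
  have h3 : (2 : ℝ) * Nat.card K ≤ Fintype.card A := by exact_mod_cast h2
  have h4 : (0 : ℝ) ≤ Fintype.card A := Nat.cast_nonneg _
  nlinarith

/-- Equidistribution of sums of values of a bilinear map. -/
theorem card_sum_bilin (β : A →+ A →+ W)
    (hβ : ∀ χ : AddChar W ℂ, (∀ x y, χ (β x y) = 1) → χ = 0) (g : ℕ) (w : W) :
    |(Nat.card {p : Fin g → A × A // ∑ i, β (p i).1 (p i).2 = w} : ℝ) * Fintype.card W -
      (Fintype.card A : ℝ) ^ (g + g)| ≤ Fintype.card W * ((Fintype.card A : ℝ) ^ 2 / 2) ^ g := by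
  classical
  -- Fourier inversion on W; the g summands are independent, whence the g-th power. The trivial
  -- character gives the main term.
  have h1 : ((Nat.card {p : Fin g → A × A // ∑ i, β (p i).1 (p i).2 = w} : ℂ)) * Fintype.card W =
      ∑ χ : AddChar W ℂ, χ (-w) * (∑ q : A × A, χ (β q.1 q.2)) ^ g := by
    have h2 : ∀ χ : AddChar W ℂ, χ (-w) * (∑ q : A × A, χ (β q.1 q.2)) ^ g =
        ∑ p : Fin g → A × A, χ (∑ i, β (p i).1 (p i).2 - w) := by
      intro χ
      rw [Fintype.sum_pow, Finset.mul_sum]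
      refine Finset.sum_congr rfl fun p _ => ?_
      rw [sub_eq_neg_add, AddChar.map_add_eq_mul, addChar_map_sum]
    rw [Finset.sum_congr rfl fun χ _ => h2 χ, Finset.sum_comm]
    simp only [AddChar.sum_apply_eq_ite, sub_eq_zero]
    rw [← Finset.sum_filter, Finset.sum_const, nsmul_eq_mul, Nat.card_eq_fintype_card,
      Fintype.card_subtype]
  have h3 : ((Nat.card {p : Fin g → A × A // ∑ i, β (p i).1 (p i).2 = w} : ℂ)) * Fintype.card W -
      (Fintype.card A : ℂ) ^ (g + g) = ∑ χ ∈ Finset.univ.erase (0 : AddChar W ℂ),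
        χ (-w) * (∑ q : A × A, χ (β q.1 q.2)) ^ g := by
    rw [h1, ← Finset.add_sum_erase _ _ (Finset.mem_univ (0 : AddChar W ℂ))]
    have : (0 : AddChar W ℂ) (-w) * (∑ q : A × A, (0 : AddChar W ℂ) (β q.1 q.2)) ^ g =
        (Fintype.card A : ℂ) ^ (g + g) := by
      simp only [AddChar.zero_apply, Finset.sum_const, Finset.card_univ, Fintype.card_prod,
        nsmul_eq_mul, mul_one, one_mul, Nat.cast_mul]
      rw [mul_pow, pow_add]
    rw [this, add_sub_cancel_left]
  have h4 : ‖((Nat.card {p : Fin g → A × A // ∑ i, β (p i).1 (p i).2 = w} : ℂ)) * Fintype.card W -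
      (Fintype.card A : ℂ) ^ (g + g)‖ ≤ Fintype.card W * ((Fintype.card A : ℝ) ^ 2 / 2) ^ g := by
    rw [h3]
    refine (norm_sum_le _ _).trans ?_
    calc ∑ χ ∈ Finset.univ.erase (0 : AddChar W ℂ), ‖χ (-w) * (∑ q : A × A, χ (β q.1 q.2)) ^ g‖
        ≤ ∑ χ ∈ Finset.univ.erase (0 : AddChar W ℂ), ((Fintype.card A : ℝ) ^ 2 / 2) ^ g := by
          refine Finset.sum_le_sum fun χ hχ => ?_
          rw [norm_mul, AddChar.norm_apply, one_mul, norm_pow]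
          refine pow_le_pow_left₀ (norm_nonneg _) (norm_sum_char_le β χ ?_) g
          by_contra h
          push Not at h
          exact Finset.ne_of_mem_erase hχ (hβ χ h)
      _ ≤ Fintype.card W * ((Fintype.card A : ℝ) ^ 2 / 2) ^ g := by
          rw [Finset.sum_const, nsmul_eq_mul]
          refine mul_le_mul_of_nonneg_right ?_ (by positivity)
          rw [← AddChar.card_eq (α := W)]
          exact_mod_cast Finset.card_le_univ _
  have h5 : ((((Nat.card {p : Fin g → A × A // ∑ i, β (p i).1 (p i).2 = w} : ℝ) * Fintype.card W -
      (Fintype.card A : ℝ) ^ (g + g) : ℝ)) : ℂ) =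
      ((Nat.card {p : Fin g → A × A // ∑ i, β (p i).1 (p i).2 = w} : ℂ)) * Fintype.card W -
      (Fintype.card A : ℂ) ^ (g + g) := by
    push_cast
    rfl
  rw [← h5, Complex.norm_real, Real.norm_eq_abs] at h4
  exact h4

end Equidistribution

/-! ### The number of surjections carrying ∑ e_i ∧ f_i to ω -/

section Ratio

variable {ℓ : ℕ} [Fact ℓ.Prime] {n : ℕ}

theorem addChar_wedgeSq_eq_zero {A : Type*} [AddCommGroup A] (χ : AddChar (wedgeSq A) ℂ)
    (h : ∀ x y, χ (wedgeHom A x y) = 1) : χ = 0 := by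
  rw [AddChar.eq_zero_iff]
  intro t
  induction t using wedgeSq_induction with
  | hw x y => exact h x y
  | h0 => exact χ.map_zero_eq_one
  | hadd a b ha hb => rw [χ.map_add_eq_mul, ha, hb, one_mul]
  | hneg a ha => rw [χ.map_neg_eq_inv, ha, inv_one]

theorem card_latOmega_eq (g : ℕ) (Y : BEG ℓ n) :
    Nat.card {F : Lattice ℓ g →+ Y.carrier // latOmega F = Y.ω} =
      Nat.card {p : Fin g → Y.carrier × Y.carrier //
        ∑ i, wedgeHom Y.carrier (p i).1 (p i).2 = ⟨Y.ω, Y.ω_mem⟩} := by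
  obtain ⟨k, hk⟩ := exists_uniform_pow_smul Y.isPrimary
  let e : (Lattice ℓ g →+ Y.carrier) ≃ (Fin g → Y.carrier × Y.carrier) :=
    (latticeHomEquiv hk).trans ((Equiv.sumArrowEquivProdArrow _ _ _).trans
      (Equiv.arrowProdEquivProdArrow _ _ _).symm)
  refine Nat.card_congr (e.subtypeEquiv fun F => ?_)
  rw [Subtype.ext_iff, AddSubgroup.val_finsetSum]
  rfl

/-- A non-surjective map lands in a proper subgroup, which has at most half the order. -/
theorem card_not_surjective_le (g : ℕ) (Y : BEG ℓ n) :
    (Nat.card {F : Lattice ℓ g →+ Y.carrier // ¬ Function.Surjective F} : ℝ) ≤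
      Nat.card (AddSubgroup Y.carrier) * ((Nat.card Y.carrier : ℝ) / 2) ^ (g + g) := by
  classical
  obtain ⟨k, hk⟩ := exists_uniform_pow_smul Y.isPrimary
  have : Finite (AddSubgroup Y.carrier) := Finite.of_injective _ SetLike.coe_injective
  have : Fintype (AddSubgroup Y.carrier) := Fintype.ofFinite _
  let T := Σ H : {H : AddSubgroup Y.carrier // H ≠ ⊤}, (Fin g ⊕ Fin g → H.1)
  have h1 : Nat.card {F : Lattice ℓ g →+ Y.carrier // ¬ Function.Surjective F} ≤ Nat.card T := by
    refine Nat.card_le_card_of_injective (fun F => (⟨⟨F.1.range, fun h =>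
      F.2 (AddMonoidHom.range_eq_top.mp h)⟩, fun i => ⟨F.1 (Pi.single i 1), ⟨_, rfl⟩⟩⟩ : T)) ?_
    intro F F' h
    apply Subtype.ext
    apply lattice_hom_ext hk
    intro i
    exact congrArg (fun t : T => ((t.2 i : t.1.1) : Y.carrier)) h
  have h2 : (Nat.card T : ℝ) ≤ Nat.card (AddSubgroup Y.carrier) *
      ((Nat.card Y.carrier : ℝ) / 2) ^ (g + g) := by
    rw [Nat.card_sigma, Nat.cast_sum]
    calc ∑ H : {H : AddSubgroup Y.carrier // H ≠ ⊤}, (Nat.card (Fin g ⊕ Fin g → H.1) : ℝ)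
        ≤ ∑ _H : {H : AddSubgroup Y.carrier // H ≠ ⊤}, ((Nat.card Y.carrier : ℝ) / 2) ^ (g + g) := by
          refine Finset.sum_le_sum fun H _ => ?_
          rw [Nat.card_fun, Nat.card_sum, Nat.card_fin, Nat.cast_pow]
          refine pow_le_pow_left₀ (Nat.cast_nonneg _) ?_ _
          rw [le_div_iff₀ (by norm_num), mul_comm]
          exact_mod_cast two_mul_card_le H.2
      _ ≤ _ := by
          rw [Finset.sum_const, nsmul_eq_mul, Finset.card_univ]
          refine mul_le_mul_of_nonneg_right ?_ (by positivity)
          rw [Nat.card_eq_fintype_card]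
          exact_mod_cast Fintype.card_subtype_le _
  exact (Nat.cast_le.mpr h1).trans h2

theorem abs_omegaRatio_sub_one_le (g : ℕ) (Y : BEG ℓ n) : |omegaRatio g Y - 1| ≤
    (Nat.card (wedgeSq Y.carrier) + Nat.card (wedgeSq Y.carrier) * Nat.card (AddSubgroup Y.carrier)) *
      (1 / 2 : ℝ) ^ g := by
  have : Fintype Y.carrier := Fintype.ofFinite _
  have : Fintype (wedgeSq Y.carrier) := Fintype.ofFinite _
  have h1 := card_sum_bilin (wedgeHom Y.carrier) addChar_wedgeSq_eq_zero g ⟨Y.ω, Y.ω_mem⟩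
  rw [← card_latOmega_eq, ← Nat.card_eq_fintype_card, ← Nat.card_eq_fintype_card] at h1
  have h2 := card_not_surjective_le g Y
  have h3 : Nat.card (OmegaSurj g Y) ≤
      Nat.card {F : Lattice ℓ g →+ Y.carrier // latOmega F = Y.ω} :=
    Nat.card_le_card_of_injective (fun F => ⟨F.1, F.2.2⟩) fun F F' h =>
      Subtype.ext (congrArg (fun F => F.1) h)
  have h4 : Nat.card {F : Lattice ℓ g →+ Y.carrier // latOmega F = Y.ω} ≤
      Nat.card (OmegaSurj g Y) +
        Nat.card {F : Lattice ℓ g →+ Y.carrier // ¬ Function.Surjective F} := by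
    classical
    rw [← Nat.card_sum]
    refine Nat.card_le_card_of_injective (fun F => if h : Function.Surjective F.1 then
      Sum.inl ⟨F.1, h, F.2⟩ else Sum.inr ⟨F.1, h⟩) fun F F' h => ?_
    dsimp only at h
    split_ifs at h with ha hb hb
    · exact Subtype.ext (congrArg (fun F => F.1) (Sum.inl_injective h))
    · exact Subtype.ext (congrArg (fun F => F.1) (Sum.inr_injective h))
  have h3' : (Nat.card (OmegaSurj g Y) : ℝ) ≤
      Nat.card {F : Lattice ℓ g →+ Y.carrier // latOmega F = Y.ω} := by exact_mod_cast h3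
  have h4' : (Nat.card {F : Lattice ℓ g →+ Y.carrier // latOmega F = Y.ω} : ℝ) ≤
      Nat.card (OmegaSurj g Y) +
        Nat.card {F : Lattice ℓ g →+ Y.carrier // ¬ Function.Surjective F} := by exact_mod_cast h4
  rw [omegaRatio]
  have hN : (0 : ℝ) < Nat.card Y.carrier := by exact_mod_cast Nat.card_pos
  have hW : (0 : ℝ) ≤ Nat.card (wedgeSq Y.carrier) := Nat.cast_nonneg _
  generalize (Nat.card Y.carrier : ℝ) = N at *
  generalize (Nat.card (wedgeSq Y.carrier) : ℝ) = w at *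
  generalize (Nat.card (OmegaSurj g Y) : ℝ) = a at *
  generalize (Nat.card {F : Lattice ℓ g →+ Y.carrier // latOmega F = Y.ω} : ℝ) = b at *
  generalize (Nat.card {F : Lattice ℓ g →+ Y.carrier // ¬ Function.Surjective F} : ℝ) = c at *
  have hs0 : (0 : ℝ) ≤ Nat.card (AddSubgroup Y.carrier) := Nat.cast_nonneg _
  generalize (Nat.card (AddSubgroup Y.carrier) : ℝ) = s at *
  have hNg : (0 : ℝ) < N ^ (g + g) := by positivity
  have e1 : (N ^ 2 / 2) ^ g = N ^ (g + g) * (1 / 2) ^ g := by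
    rw [div_eq_mul_one_div, mul_pow, ← pow_mul, two_mul]
  have e2 : (N / 2) ^ (g + g) ≤ N ^ (g + g) * (1 / 2) ^ g := by
    rw [div_eq_mul_one_div, mul_pow]
    refine mul_le_mul_of_nonneg_left ?_ hNg.le
    exact pow_le_pow_of_le_one (by norm_num) (by norm_num) (Nat.le_add_left _ _)
  rw [e1] at h1
  have e3 : a * w / N ^ (g + g) - 1 = (a * w - N ^ (g + g)) / N ^ (g + g) := by
    field_simp
  rw [e3, abs_div, abs_of_pos hNg, div_le_iff₀ hNg]
  have e4 : |a * w - N ^ (g + g)| ≤ |b * w - N ^ (g + g)| + |a * w - b * w| := by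
    have := abs_add_le (b * w - N ^ (g + g)) (a * w - b * w)
    rwa [show b * w - N ^ (g + g) + (a * w - b * w) = a * w - N ^ (g + g) by ring] at this
  have e5 : |a * w - b * w| ≤ w * (s * (N ^ (g + g) * (1 / 2) ^ g)) := by
    rw [← sub_mul, abs_mul, abs_of_nonneg hW, mul_comm]
    refine mul_le_mul_of_nonneg_left ?_ hW
    rw [abs_sub_comm, abs_of_nonneg (by linarith)]
    have := mul_le_mul_of_nonneg_left e2 hs0
    linarith
  calc _ ≤ _ := e4
    _ ≤ _ := add_le_add h1 e5
    _ = _ := by ring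

theorem tendsto_omegaRatio (Y : BEG ℓ n) : Tendsto (fun g => omegaRatio g Y) atTop (𝓝 1) := by
  rw [tendsto_iff_dist_tendsto_zero]
  have h : Tendsto (fun g : ℕ => ((Nat.card (wedgeSq Y.carrier) +
      Nat.card (wedgeSq Y.carrier) * Nat.card (AddSubgroup Y.carrier)) : ℝ) *
      (1 / 2 : ℝ) ^ g) atTop (𝓝 0) := by
    have := (tendsto_pow_atTop_nhds_zero_of_lt_one (r := (1 / 2 : ℝ)) (by norm_num)
      (by norm_num)).const_mul ((Nat.card (wedgeSq Y.carrier) +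
      Nat.card (wedgeSq Y.carrier) * Nat.card (AddSubgroup Y.carrier)) : ℝ)
    rwa [mul_zero] at this
  refine squeeze_zero (fun _ => dist_nonneg) (fun g => ?_) h
  rw [Real.dist_eq]
  exact abs_omegaRatio_sub_one_le g Y

end Ratio

/-! ### Functions whose means are determined by the moments -/

section MomentSpan

variable {ℓ : ℕ} [Fact ℓ.Prime] {n : ℕ}

variable (ℓ n) in
/-- The span of the functions `c ↦ #Surj(c, Y)`. -/
def momentSpan : Submodule ℝ (BEGClass ℓ n → ℝ) :=
  Submodule.span ℝ (Set.range fun Y : BEG ℓ n => fun c => (surjCount c Y : ℝ))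

theorem surjCount_mem_momentSpan (Y : BEG ℓ n) : (fun c => (surjCount c Y : ℝ)) ∈ momentSpan ℓ n :=
  Submodule.subset_span ⟨Y, rfl⟩

theorem surjCount_mul_card_hom_mem (Z : BEG ℓ n) (B : Type) [AddCommGroup B] [Finite B]
    (hB : ∀ x : B, ∃ k : ℕ, ℓ ^ k • x = 0) :
    (fun c => (surjCount c Z : ℝ) * (Nat.card ((Quotient.out c).carrier →+ B) : ℝ)) ∈
      momentSpan ℓ n := by
  obtain ⟨I, _, W, hW⟩ := exists_surjCount_mul_card_hom Z B hB
  have : (fun c : BEGClass ℓ n =>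
      (surjCount c Z : ℝ) * (Nat.card ((Quotient.out c).carrier →+ B) : ℝ)) =
      ∑ i, fun c => (surjCount c (W i) : ℝ) := by
    funext c
    have h := hW (Quotient.out c)
    simp_rw [← surjCount_cls, cls_out] at h
    rw [Finset.sum_apply]
    exact_mod_cast h
  rw [this]
  exact Submodule.sum_mem _ fun i _ => surjCount_mem_momentSpan _

/-- The power #Hom(X, 𝔽_ℓ)^d is the single count #Hom(X, 𝔽_ℓ^d). -/
theorem surjCount_mul_rankCard_pow_mem (Z : BEG ℓ n) (d : ℕ) :
    (fun c => (surjCount c Z : ℝ) * (rankCard c : ℝ) ^ d) ∈ momentSpan ℓ n := by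
  have h := surjCount_mul_card_hom_mem Z (Fin d → ZMod ℓ) (fun x => ⟨1, by
    rw [pow_one, nsmul_eq_mul]
    funext i
    simp⟩)
  convert h using 3 with c
  rw [homCard_pow, ← rankCard_cls, cls_out, Nat.cast_pow]

theorem surjCount_mul_eval_mem (Z : BEG ℓ n) (P : Polynomial ℝ) :
    (fun c => (surjCount c Z : ℝ) * P.eval (rankCard c : ℝ)) ∈ momentSpan ℓ n := by
  induction P using Polynomial.induction_on' with
  | add p q hp hq =>
    convert Submodule.add_mem _ hp hq using 1
    funext c
    simp [mul_add]
  | monomial d a =>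
    convert Submodule.smul_mem _ a (surjCount_mul_rankCard_pow_mem Z d) using 1
    funext c
    simp only [Polynomial.eval_monomial, Pi.smul_apply, smul_eq_mul]
    ring

theorem integrable_of_mem_momentSpan {ν : Measure (BEGClass ℓ n)}
    (h : ∀ Y : BEG ℓ n, Integrable (fun c => (surjCount c Y : ℝ)) ν) {f : BEGClass ℓ n → ℝ}
    (hf : f ∈ momentSpan ℓ n) : Integrable f ν := by
  induction hf using Submodule.span_induction with
  | mem f hf => obtain ⟨Y, rfl⟩ := hf; exact h Y
  | zero => exact integrable_zero _ _ _
  | add f f' _ _ h1 h2 => exact h1.add h2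
  | smul a f _ h1 => exact h1.smul a

theorem tendsto_integral_of_mem_momentSpan {ν : ℕ → Measure (BEGClass ℓ n)}
    {ν' : Measure (BEGClass ℓ n)}
    (h : ∀ g, ∀ Y : BEG ℓ n, Integrable (fun c => (surjCount c Y : ℝ)) (ν g))
    (h' : ∀ Y : BEG ℓ n, Integrable (fun c => (surjCount c Y : ℝ)) ν')
    (hlim : ∀ Y : BEG ℓ n, Tendsto (fun g => ∫ c, (surjCount c Y : ℝ) ∂(ν g)) atTop
      (𝓝 (∫ c, (surjCount c Y : ℝ) ∂ν'))) {f : BEGClass ℓ n → ℝ}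
    (hf : f ∈ momentSpan ℓ n) :
    Tendsto (fun g => ∫ c, f c ∂(ν g)) atTop (𝓝 (∫ c, f c ∂ν')) := by
  induction hf using Submodule.span_induction with
  | mem f hf => obtain ⟨Y, rfl⟩ := hf; exact hlim Y
  | zero => simp
  | add f f' hf hf' h1 h2 =>
    have e : ∀ ν'' : Measure (BEGClass ℓ n),
        (∀ Y : BEG ℓ n, Integrable (fun c => (surjCount c Y : ℝ)) ν'') →
        ∫ c, (f + f') c ∂ν'' = ∫ c, f c ∂ν'' + ∫ c, f' c ∂ν'' := fun ν'' H =>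
      integral_add (integrable_of_mem_momentSpan H hf) (integrable_of_mem_momentSpan H hf')
    simp_rw [e _ h', fun g => e _ (h g)]
    exact h1.add h2
  | smul a f _ h1 =>
    have e : ∀ ν'' : Measure (BEGClass ℓ n), ∫ c, (a • f) c ∂ν'' = a * ∫ c, f c ∂ν'' :=
      fun ν'' => integral_const_mul a f
    simp_rw [e]
    exact h1.const_mul a

theorem exists_integral_le_of_mem_momentSpan {ν : ℕ → Measure (BEGClass ℓ n)}
    (h : ∀ g, ∀ Y : BEG ℓ n, Integrable (fun c => (surjCount c Y : ℝ)) (ν g)) {m : BEG ℓ n → ℝ}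
    (hlim : ∀ Y : BEG ℓ n, Tendsto (fun g => ∫ c, (surjCount c Y : ℝ) ∂(ν g)) atTop (𝓝 (m Y)))
    {f : BEGClass ℓ n → ℝ} (hf : f ∈ momentSpan ℓ n) : ∃ C, ∀ g, ∫ c, f c ∂(ν g) ≤ C := by
  suffices ∃ L, Tendsto (fun g => ∫ c, f c ∂(ν g)) atTop (𝓝 L) by
    obtain ⟨L, hL⟩ := this
    obtain ⟨C, hC⟩ := hL.bddAbove_range
    exact ⟨C, fun g => hC ⟨g, rfl⟩⟩
  induction hf using Submodule.span_induction with
  | mem f hf => obtain ⟨Y, rfl⟩ := hf; exact ⟨_, hlim Y⟩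
  | zero => exact ⟨0, by simp⟩
  | add f f' hf hf' h1 h2 =>
    obtain ⟨L, hL⟩ := h1
    obtain ⟨L', hL'⟩ := h2
    refine ⟨L + L', (hL.add hL').congr fun g => ?_⟩
    exact (integral_add (integrable_of_mem_momentSpan (h g) hf)
      (integrable_of_mem_momentSpan (h g) hf')).symm
  | smul a f _ h1 =>
    obtain ⟨L, hL⟩ := h1
    exact ⟨a * L, (hL.const_mul a).congr fun g => (integral_const_mul a f).symm⟩

theorem integrable_surjCount {ν : Measure (BEGClass ℓ n)}
    (h : ∀ Y : BEG ℓ n, moment ν Y = (cardSymSq Y : ℝ≥0∞)⁻¹) (Y : BEG ℓ n) :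
    Integrable (fun c => (surjCount c Y : ℝ)) ν := by
  refine ⟨(Measurable.of_discrete).aestronglyMeasurable, ?_⟩
  have e : ∫⁻ c, ‖(surjCount c Y : ℝ)‖ₑ ∂ν = moment ν Y := lintegral_congr fun c => by
    rw [← ofReal_norm, Real.norm_natCast, ENNReal.ofReal_natCast]
  rw [hasFiniteIntegral_iff_enorm, e, h]
  simpa using cardSymSq_pos Y

theorem ofReal_integral_surjCount {ν : Measure (BEGClass ℓ n)} {Y : BEG ℓ n}
    (h : Integrable (fun c => (surjCount c Y : ℝ)) ν) :
    ENNReal.ofReal (∫ c, (surjCount c Y : ℝ) ∂ν) = moment ν Y := by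
  rw [ofReal_integral_eq_lintegral_ofReal h (Eventually.of_forall fun c => Nat.cast_nonneg _)]
  exact lintegral_congr fun c => ENNReal.ofReal_natCast _

theorem integral_surjCount {ν : Measure (BEGClass ℓ n)}
    (h : ∀ Y : BEG ℓ n, moment ν Y = (cardSymSq Y : ℝ≥0∞)⁻¹) (Y : BEG ℓ n) :
    ∫ c, (surjCount c Y : ℝ) ∂ν = (cardSymSq Y : ℝ)⁻¹ := by
  have e := ofReal_integral_surjCount (integrable_surjCount h Y)
  rw [h] at e
  rw [← ENNReal.toReal_ofReal (integral_nonneg fun c => Nat.cast_nonneg _), e]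
  simp

theorem surjCount_trivialBEG (c : BEGClass ℓ n) : surjCount c (trivialBEG ℓ n) = 1 := by
  obtain ⟨X, rfl⟩ : ∃ X : BEG ℓ n, X.cls = c := ⟨_, cls_out c⟩
  rw [surjCount_cls]
  have hsub : Subsingleton (trivialBEG ℓ n).carrier := inferInstanceAs (Subsingleton PUnit)
  have hs2 : Subsingleton ((trivialBEG ℓ n).carrier ⊗[ℤ] (trivialBEG ℓ n).carrier) := by
    refine ⟨fun a b => ?_⟩
    have : ∀ a : (trivialBEG ℓ n).carrier ⊗[ℤ] (trivialBEG ℓ n).carrier, a = 0 := by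
      intro a
      induction a with
      | zero => rfl
      | tmul x y => rw [Subsingleton.elim x 0, TensorProduct.zero_tmul]
      | add x y hx hy => rw [hx, hy, add_zero]
    rw [this a, this b]
  rw [Nat.card_eq_one_iff_unique]
  constructor
  · refine ⟨fun f f' => Subtype.ext (AddMonoidHom.ext fun x => Subsingleton.elim _ _)⟩
  · refine ⟨⟨0, ⟨Subsingleton.elim _ _, fun γ => ?_⟩, fun y => ⟨0, Subsingleton.elim _ _⟩⟩⟩
    exact Subsingleton.elim _ _

theorem cardSymSq_trivialBEG : cardSymSq (trivialBEG ℓ n) = 1 := by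
  have hsub : Subsingleton (trivialBEG ℓ n).carrier := inferInstanceAs (Subsingleton PUnit)
  have h0 : AddMonoidHom.id (SymmetricPower ℤ (Fin 2) (trivialBEG ℓ n).carrier) = 0 :=
    symPower_hom_ext fun m => (SymmetricPower.tprod ℤ).map_coord_zero (m := m) 0
      (Subsingleton.elim _ _)
  have hs : Subsingleton (SymmetricPower ℤ (Fin 2) (trivialBEG ℓ n).carrier) :=
    ⟨fun a b => (DFunLike.congr_fun h0 a).trans (DFunLike.congr_fun h0 b).symm⟩
  rw [cardSymSq, Nat.card_eq_one_iff_unique]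
  exact ⟨inferInstance, inferInstance⟩

/-- The moment of the trivial group is the total mass, so finiteness need not be assumed for
uniqueness. -/
theorem isProbabilityMeasure_of_moment {ν : Measure (BEGClass ℓ n)}
    (h : ∀ Y : BEG ℓ n, moment ν Y = (cardSymSq Y : ℝ≥0∞)⁻¹) : IsProbabilityMeasure ν := by
  have := h (trivialBEG ℓ n)
  rw [cardSymSq_trivialBEG, moment] at this
  simp_rw [surjCount_trivialBEG] at this
  exact ⟨by simpa using this⟩

end MomentSpan

/-! ### Restricting a moment to groups of equal rank -/

section Moments

variable {ℓ : ℕ} [Fact ℓ.Prime] {n : ℕ}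

theorem integral_surjCount_linearMeasure (hℓ : ℓ ≠ 2) (hn : 0 < n) (g : ℕ) (Y : BEG ℓ n) :
    Integrable (fun c => (surjCount c Y : ℝ)) (linearMeasure n hℓ g) ∧
    ∫ c, (surjCount c Y : ℝ) ∂(linearMeasure n hℓ g) = omegaRatio g Y * (cardSymSq Y : ℝ)⁻¹ := by
  have h := integral_surjCount_mul hℓ hn g Y (fun _ => 1) 1 (fun κ _ _ _ => by
    have : (Nat.card (symMat κ ℓ) : ℝ) ≠ 0 := Nat.cast_ne_zero.mpr Nat.card_pos.ne'
    rw [symAvg, Finset.sum_const, nsmul_one, Finset.card_univ, ← Nat.card_eq_fintype_card,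
      div_self this])
  simpa using h

theorem tendsto_integral_surjCount (hℓ : ℓ ≠ 2) (hn : 0 < n) (Y : BEG ℓ n) :
    Tendsto (fun g => ∫ c, (surjCount c Y : ℝ) ∂(linearMeasure n hℓ g)) atTop
      (𝓝 (cardSymSq Y : ℝ)⁻¹) := by
  simp_rw [fun g => (integral_surjCount_linearMeasure hℓ hn g Y).2]
  simpa using (tendsto_omegaRatio Y).mul_const (cardSymSq Y : ℝ)⁻¹

theorem ofReal_inv_natCast {m : ℕ} (hm : 0 < m) : ENNReal.ofReal (m : ℝ)⁻¹ = (m : ℝ≥0∞)⁻¹ := by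
  rw [ENNReal.ofReal_inv_of_pos (by exact_mod_cast hm), ENNReal.ofReal_natCast]

theorem tendsto_moment (hℓ : ℓ ≠ 2) (hn : 0 < n) (Y : BEG ℓ n) :
    Tendsto (fun g => moment (linearMeasure n hℓ g) Y) atTop (𝓝 (cardSymSq Y : ℝ≥0∞)⁻¹) := by
  rw [← ofReal_inv_natCast (cardSymSq_pos Y)]
  refine (ENNReal.tendsto_ofReal (tendsto_integral_surjCount hℓ hn Y)).congr fun g => ?_
  exact ofReal_integral_surjCount (integral_surjCount_linearMeasure hℓ hn g Y).1

variable (ℓ) in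
/-- The polynomial `∏_{i < d} (t/a - ℓ^i)`. -/
def injPoly (a d : ℕ) : Polynomial ℝ :=
  ∏ i ∈ Finset.range d, (Polynomial.C (a : ℝ)⁻¹ * Polynomial.X - Polynomial.C ((ℓ : ℝ) ^ i))

theorem eval_injPoly {a : ℕ} (ha : 0 < a) (d t : ℕ) :
    (injPoly ℓ a d).eval ((a * t : ℕ) : ℝ) = ∏ i ∈ Finset.range d, ((t : ℝ) - (ℓ : ℝ) ^ i) := by
  have : (a : ℝ) ≠ 0 := by exact_mod_cast ha.ne'
  rw [injPoly, Polynomial.eval_prod]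
  refine Finset.prod_congr rfl fun i _ => ?_
  rw [Polynomial.eval_sub, Polynomial.eval_mul, Polynomial.eval_C, Polynomial.eval_X,
    Polynomial.eval_C, Nat.cast_mul, inv_mul_cancel_left₀ this]

theorem exists_eval_injPoly {c : BEGClass ℓ n} {Z : BEG ℓ n} (h : surjCount c Z ≠ 0) : ∃ w : ℕ,
    (rankCard c = homCard ℓ Z.carrier ↔ w = 0) ∧
    ∀ d, (injPoly ℓ (homCard ℓ Z.carrier) d).eval (rankCard c : ℝ) = injNum ℓ w d := by
  obtain ⟨w, hw⟩ := exists_rankCard_eq_mul_pow h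
  have h0 : 0 < homCard ℓ Z.carrier := homCard_pos _
  refine ⟨w, ?_, fun d => ?_⟩
  · rw [hw, Nat.mul_eq_left h0.ne', Nat.pow_eq_one]
    exact or_iff_right (Fact.out : ℓ.Prime).one_lt.ne'
  · rw [hw, eval_injPoly h0, injNum, Nat.cast_pow]

/-- The integrand is a finite combination of surjection counts, so its mean under ν is the limit of
its means under μ_g, which averages over symmetric matrices compute. -/
theorem integral_surjCount_mul_injPoly (hℓ : ℓ ≠ 2) (hn : 0 < n) {ν : Measure (BEGClass ℓ n)}
    (h : ∀ Y : BEG ℓ n, moment ν Y = (cardSymSq Y : ℝ≥0∞)⁻¹) (Z : BEG ℓ n) (d : ℕ) :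
    ∫ c, (surjCount c Z : ℝ) * (injPoly ℓ (homCard ℓ Z.carrier) d).eval (rankCard c : ℝ) ∂ν =
      (cardSymSq Z : ℝ)⁻¹ * (ℓ : ℝ) ^ d.choose 2 := by
  have hℓ0 : (ℓ : ℝ) ≠ 0 := by exact_mod_cast (prime_pos (ℓ := ℓ)).ne'
  have h1 := tendsto_integral_of_mem_momentSpan
    (fun g Y => (integral_surjCount_linearMeasure hℓ hn g Y).1) (integrable_surjCount h)
    (fun Y => by rw [integral_surjCount h]; exact tendsto_integral_surjCount hℓ hn Y)
    (surjCount_mul_eval_mem Z (injPoly ℓ (homCard ℓ Z.carrier) d))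
  refine tendsto_nhds_unique h1 ?_
  have h2 := fun g => (integral_surjCount_mul hℓ hn g Z
    (fun t => (injPoly ℓ (homCard ℓ Z.carrier) d).eval (t : ℝ))
    ((injNum ℓ (g + g - rk Z) d / ((ℓ : ℝ) ^ (g + g - rk Z)) ^ d) * (ℓ : ℝ) ^ d.choose 2)
    (fun κ _ _ hκ => by
      simp_rw [eval_injPoly (homCard_pos Z.carrier)]
      rw [symAvg_prod_sub, ← rk_add_eq hκ, injNum]
      ring)).2
  simp_rw [h2]
  have h3 : Tendsto (fun g : ℕ => g + g - rk Z) atTop atTop :=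
    tendsto_atTop_mono (fun g => show g - rk Z ≤ g + g - rk Z by omega) (tendsto_sub_atTop_nat _)
  have h4 := ((tendsto_omegaRatio Z).mul_const (cardSymSq Z : ℝ)⁻¹).mul
    (((tendsto_injNum_div (three_le hℓ) d).comp h3).mul_const ((ℓ : ℝ) ^ d.choose 2))
  simpa using h4

open Classical in
-- Möbius inversion in the rank excess w, pointwise a finite sum. Sum and integral may be exchanged
-- because the d-th term has absolute mean proportional to |`invTerm` ℓ d|, which is summable.
theorem integral_surjCount_rank_eq (hℓ : ℓ ≠ 2) (hn : 0 < n) {ν : Measure (BEGClass ℓ n)}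
    (h : ∀ Y : BEG ℓ n, moment ν Y = (cardSymSq Y : ℝ≥0∞)⁻¹) (Z : BEG ℓ n) :
    ∫ c, (if rankCard c = homCard ℓ Z.carrier then (surjCount c Z : ℝ) else 0) ∂ν =
      cConst ℓ * (cardSymSq Z : ℝ)⁻¹ := by
  have h3 := three_le hℓ
  set F : ℕ → BEGClass ℓ n → ℝ := fun d c => mobCoeff ℓ d *
    ((surjCount c Z : ℝ) * (injPoly ℓ (homCard ℓ Z.carrier) d).eval (rankCard c : ℝ)) with hF
  have hnonneg : ∀ d c, 0 ≤
      (surjCount c Z : ℝ) * (injPoly ℓ (homCard ℓ Z.carrier) d).eval (rankCard c : ℝ) := by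
    intro d c
    by_cases hz : surjCount c Z = 0
    · simp [hz]
    obtain ⟨w, -, hw⟩ := exists_eval_injPoly hz
    rw [hw]
    exact mul_nonneg (Nat.cast_nonneg _) (injNum_nonneg h3 w d)
  have hint : ∀ d, Integrable (F d) ν := fun d =>
    (integrable_of_mem_momentSpan (integrable_surjCount h) (surjCount_mul_eval_mem Z _)).const_mul _
  have hnorm : ∀ d, ∫ c, ‖F d c‖ ∂ν = (cardSymSq Z : ℝ)⁻¹ * ‖invTerm ℓ d‖ := by
    intro d
    have e : ∀ c, ‖F d c‖ = ‖mobCoeff ℓ d‖ *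
        ((surjCount c Z : ℝ) * (injPoly ℓ (homCard ℓ Z.carrier) d).eval (rankCard c : ℝ)) := fun c => by
      rw [hF, norm_mul, Real.norm_of_nonneg (hnonneg d c)]
    simp_rw [e]
    rw [integral_const_mul, integral_surjCount_mul_injPoly hℓ hn h, invTerm, norm_mul, norm_pow,
      Real.norm_natCast]
    ring
  have hsum := hasSum_integral_of_summable_integral_norm hint (by
    simp_rw [hnorm]
    exact (summable_norm_invTerm h3).mul_left _)
  have h1 : ∀ c, ∑' d, F d c = if rankCard c = homCard ℓ Z.carrier then (surjCount c Z : ℝ) else 0 := by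
    intro c
    by_cases hz : surjCount c Z = 0
    · simp [hF, hz]
    obtain ⟨w, hw0, hw⟩ := exists_eval_injPoly hz
    have e : ∀ d, F d c = surjCount c Z * (mobCoeff ℓ d * injNum ℓ w d) := fun d => by
      rw [hF]
      simp only
      rw [hw]
      ring
    simp_rw [e]
    rw [tsum_mul_left, tsum_eq_sum (s := Finset.range (w + 1)) (fun d hd => by
      rw [injNum_of_lt ℓ (by simpa using hd), mul_zero]), sum_mobCoeff h3]
    simp [hw0]
  have h2 : ∑' d, ∫ c, F d c ∂ν = cConst ℓ * (cardSymSq Z : ℝ)⁻¹ := by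
    rw [← tsum_invTerm h3, ← tsum_mul_right]
    refine tsum_congr fun d => ?_
    rw [hF]
    simp only
    rw [integral_const_mul, integral_surjCount_mul_injPoly hℓ hn h, invTerm]
    ring
  rw [← h2, hsum.tsum_eq]
  exact integral_congr_ae (Eventually.of_forall fun c => (h1 c).symm)

end Moments

/-! ### Uniqueness of the measure with the given moments -/

section Uniqueness

/-- If x does not vanish, take d of maximal N with x d ≠ 0: in the equation indexed by d only the
diagonal term survives. -/
theorem eq_zero_of_triangular {α : Type*} (S : Finset α) (N : α → ℕ) (a : α → α → ℝ) (x : α → ℝ)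
    (hdiag : ∀ d ∈ S, a d d ≠ 0) (htri : ∀ d ∈ S, ∀ d' ∈ S, d' ≠ d → N d' ≤ N d → a d' d = 0)
    (hsum : ∀ d ∈ S, ∑ d' ∈ S, a d' d * x d' = 0) : ∀ d ∈ S, x d = 0 := by
  classical
  by_contra! hne
  obtain ⟨d₀, hd₀, hx₀⟩ := hne
  obtain ⟨d, hd, hmax⟩ := Finset.exists_max_image (S.filter fun d => x d ≠ 0) N
    ⟨d₀, Finset.mem_filter.mpr ⟨hd₀, hx₀⟩⟩
  rw [Finset.mem_filter] at hd
  have h := hsum d hd.1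
  rw [Finset.sum_eq_single_of_mem d hd.1] at h
  · exact (mul_ne_zero (hdiag d hd.1) hd.2) h
  · intro d' hd' hne
    by_cases hx : x d' = 0
    · rw [hx, mul_zero]
    · rw [htri d hd.1 d' hd' hne (hmax d' (Finset.mem_filter.mpr ⟨hd', hx⟩)), zero_mul]

variable {ℓ : ℕ} [Fact ℓ.Prime] {n : ℕ}

theorem finite_killedBy_rank_le (k R : ℕ) :
    {c : BEGClass ℓ n | KilledBy k c ∧ rankCard c ≤ R}.Finite :=
  (finite_classCard_le (R ^ k)).subset fun _ hc =>
    (classCard_le_of_killedBy hc.1).trans (Nat.pow_le_pow_left hc.2 k)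

open Classical in
-- Both the rank and the count of surjections to Z depend only on the truncation at ℓ^(k+1), which
-- takes finitely many values once the rank is fixed.
theorem integral_surjCount_rank_eq_sum (ν : Measure (BEGClass ℓ n)) [IsFiniteMeasure ν] (k : ℕ)
    (Z : BEG ℓ n) (hZ : ∀ x : Z.carrier, ℓ ^ (k + 1) • x = 0) (S : Finset (BEGClass ℓ n))
    (hS : ∀ c, c ∈ S ↔ KilledBy (k + 1) c ∧ rankCard c = homCard ℓ Z.carrier) :
    ∫ c, (if rankCard c = homCard ℓ Z.carrier then (surjCount c Z : ℝ) else 0) ∂ν =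
      ∑ d ∈ S, (surjCount d Z : ℝ) * ν.real {c | truncClass (k + 1) c = d} := by
  have hpt : ∀ c, (if rankCard c = homCard ℓ Z.carrier then (surjCount c Z : ℝ) else 0) =
      ∑ d ∈ S, (surjCount d Z : ℝ) *
        Set.indicator {c | truncClass (k + 1) c = d} (fun _ => (1 : ℝ)) c := by
    intro c
    split_ifs with h
    · rw [Finset.sum_eq_single_of_mem (truncClass (k + 1) c)
        ((hS _).mpr ⟨killedBy_truncClass _ _, by rw [rankCard_truncClass, h]⟩),
        surjCount_truncClass _ _ _ hZ, Set.indicator_of_mem (by exact rfl), mul_one]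
      intro d _ hd
      rw [Set.indicator_of_notMem, mul_zero]
      exact fun h' => hd (Eq.symm h')
    · symm
      refine Finset.sum_eq_zero fun d hd => ?_
      rw [Set.indicator_of_notMem, mul_zero]
      intro h'
      apply h
      rw [← ((hS d).mp hd).2, ← rankCard_truncClass k c, show truncClass (k + 1) c = d from h']
  simp_rw [hpt]
  rw [integral_finsetSum _ fun d _ =>
    ((integrable_const (1 : ℝ)).indicator MeasurableSet.of_discrete).const_mul _]
  refine Finset.sum_congr rfl fun d _ => ?_
  rw [integral_const_mul]
  congr 1
  exact integral_indicator_one MeasurableSet.of_discrete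

/-- The differences of the two laws of the truncation solve a homogeneous triangular system over the
classes of the given rank killed by ℓ^(k+1). A class killed by ℓ^k is its own fibre under
truncation, so its masses agree. -/
theorem eq_of_moment_eq (hℓ : ℓ ≠ 2) (hn : 0 < n) {ν ν' : Measure (BEGClass ℓ n)}
    (h : ∀ Y : BEG ℓ n, moment ν Y = (cardSymSq Y : ℝ≥0∞)⁻¹)
    (h' : ∀ Y : BEG ℓ n, moment ν' Y = (cardSymSq Y : ℝ≥0∞)⁻¹) : ν = ν' := by
  classical
  have hp := isProbabilityMeasure_of_moment h
  have hp' := isProbabilityMeasure_of_moment h'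
  refine Measure.ext_of_singleton fun d => ?_
  obtain ⟨k, hk⟩ := exists_killedBy d
  have hfin : {c : BEGClass ℓ n | KilledBy (k + 1) c ∧ rankCard c = rankCard d}.Finite :=
    (finite_killedBy_rank_le (k + 1) (rankCard d)).subset fun c hc => ⟨hc.1, hc.2.le⟩
  have hkey := eq_zero_of_triangular hfin.toFinset classCard
    (fun d' d => (surjCount d' (Quotient.out d) : ℝ))
    (fun d => ν.real {c | truncClass (k + 1) c = d} - ν'.real {c | truncClass (k + 1) c = d})
    (fun d _ => by
      rw [surjCount_eq_ite_of_classCard_eq d _ (by rw [← classCard_cls, cls_out]),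
        if_pos (cls_out d).symm]
      exact_mod_cast (cardAut_pos _).ne')
    (fun d _ d' _ hne hle => by
      by_contra hc
      have hc' : surjCount d' (Quotient.out d) ≠ 0 := by exact_mod_cast hc
      have hge := classCard_le_of_surjCount_ne_zero hc'
      rw [← classCard_cls, cls_out] at hge
      rw [surjCount_eq_ite_of_classCard_eq d' _
        (by rw [← classCard_cls, cls_out]; exact le_antisymm hle hge), cls_out, if_neg hne] at hc'
      exact hc' rfl)
    (fun d₁ hd₁ => by
      have hd₁' : KilledBy (k + 1) d₁ ∧ rankCard d₁ = rankCard d := by simpa using hd₁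
      have hZ : ∀ x : (Quotient.out d₁).carrier, ℓ ^ (k + 1) • x = 0 := by
        rw [← killedBy_cls, cls_out]
        exact hd₁'.1
      have hR : homCard ℓ (Quotient.out d₁).carrier = rankCard d := by
        rw [← rankCard_cls, cls_out, hd₁'.2]
      have hS : ∀ c, c ∈ hfin.toFinset ↔
          KilledBy (k + 1) c ∧ rankCard c = homCard ℓ (Quotient.out d₁).carrier := by
        intro c
        rw [hR]
        simp
      have e := integral_surjCount_rank_eq_sum ν k _ hZ _ hS
      have e' := integral_surjCount_rank_eq_sum ν' k _ hZ _ hS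
      rw [integral_surjCount_rank_eq hℓ hn h] at e
      rw [integral_surjCount_rank_eq hℓ hn h'] at e'
      simp_rw [mul_sub, Finset.sum_sub_distrib]
      rw [← e, ← e', sub_self])
    d (by
      obtain ⟨X, rfl, hX⟩ := hk
      have : KilledBy (k + 1) X.cls := killedBy_cls.mpr fun x => by
        rw [pow_succ', mul_smul, hX, smul_zero]
      simpa using this)
  have hset : {c : BEGClass ℓ n | truncClass (k + 1) c = d} = {d} := by
    ext c
    exact truncClass_eq_iff hk
  rw [hset, sub_eq_zero, measureReal_eq_measureReal_iff] at hkey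
  exact hkey

end Uniqueness

/-! ### Convergence of measures on a countable set -/

section DiscreteConvergence

variable {α : Type*} [MeasurableSpace α] [Countable α] [DiscreteMeasurableSpace α]

theorem hasSum_measureReal_singleton (ν : Measure α) [IsProbabilityMeasure ν] :
    HasSum (fun c => ν.real {c}) 1 := by
  have h : ∑' c, ν {c} = 1 := by
    have := lintegral_countable' (μ := ν) (fun _ => 1)
    simpa using this.symm
  have hs : Summable fun c => ν.real {c} := ENNReal.summable_toReal (by rw [h]; simp)
  have ht : ∑' c, ν.real {c} = 1 := by
    have := ENNReal.tsum_toReal_eq (f := fun c => ν {c}) (fun c => measure_ne_top ν _)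
    rw [h] at this
    simpa [Measure.real] using this.symm
  exact ht ▸ hs.hasSum

/-- Scheffé's argument: the total variation sum is 2 - 2 ∑ min(ν_g, μ), and dominated convergence
sends the sum of minima to 1. -/
theorem tendsto_integral_of_tendsto_singleton (ν : ℕ → Measure α) (μ : Measure α)
    [∀ g, IsProbabilityMeasure (ν g)] [IsProbabilityMeasure μ]
    (h : ∀ c, Tendsto (fun g => (ν g).real {c}) atTop (𝓝 (μ.real {c}))) (f : α → ℝ) (B : ℝ)
    (hf : ∀ c, |f c| ≤ B) :
    Tendsto (fun g => ∫ c, f c ∂(ν g)) atTop (𝓝 (∫ c, f c ∂μ)) := by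
  have hint : ∀ κ : Measure α, IsProbabilityMeasure κ → Integrable f κ := fun κ _ =>
    Integrable.of_bound (Measurable.of_discrete).aestronglyMeasurable B (Eventually.of_forall hf)
  have hμ := hasSum_measureReal_singleton μ
  have hν := fun g => hasSum_measureReal_singleton (ν g)
  have hmin : ∀ g, Summable fun c => min ((ν g).real {c}) (μ.real {c}) := fun g =>
    Summable.of_nonneg_of_le (fun c => le_min measureReal_nonneg measureReal_nonneg)
      (fun c => min_le_right _ _) hμ.summable
  have hlim : Tendsto (fun g => ∑' c, min ((ν g).real {c}) (μ.real {c})) atTop (𝓝 1) := by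
    rw [← hμ.tsum_eq]
    refine tendsto_tsum_of_dominated_convergence hμ.summable (fun c => ?_)
      (Eventually.of_forall fun g c => ?_)
    · simpa using (h c).min (tendsto_const_nhds (x := μ.real {c}))
    · rw [Real.norm_of_nonneg (le_min measureReal_nonneg measureReal_nonneg)]
      exact min_le_right _ _
  have habs : ∀ g, HasSum (fun c => |(ν g).real {c} - μ.real {c}|)
      (1 + 1 - 2 * ∑' c, min ((ν g).real {c}) (μ.real {c})) := by
    intro g
    have := ((hν g).add hμ).sub ((hmin g).hasSum.mul_left 2)
    suffices e : (fun c => |(ν g).real {c} - μ.real {c}|) = fun c =>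
        (ν g).real {c} + μ.real {c} - 2 * min ((ν g).real {c}) (μ.real {c}) by
      rw [e]
      exact this
    funext c
    rcases le_total ((ν g).real {c}) (μ.real {c}) with hc | hc
    · rw [min_eq_left hc, abs_of_nonpos (sub_nonpos.mpr hc)]
      ring
    · rw [min_eq_right hc, abs_of_nonneg (sub_nonneg.mpr hc)]
      ring
  have hzero : Tendsto (fun g => B * (1 + 1 - 2 * ∑' c, min ((ν g).real {c}) (μ.real {c}))) atTop
      (𝓝 0) := by
    have := ((hlim.const_mul 2).const_sub (1 + 1)).const_mul B
    norm_num at this ⊢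
    exact this
  rw [tendsto_iff_dist_tendsto_zero]
  refine squeeze_zero (fun g => dist_nonneg) (fun g => ?_) hzero
  have hsf : ∀ κ : Measure α, IsProbabilityMeasure κ → Summable fun c => κ.real {c} • f c := by
    intro κ _
    refine Summable.of_norm_bounded ((hasSum_measureReal_singleton κ).summable.mul_right B) fun c => ?_
    rw [norm_smul, Real.norm_of_nonneg measureReal_nonneg]
    exact mul_le_mul_of_nonneg_left (hf c) measureReal_nonneg
  rw [integral_countable (hint _ inferInstance), integral_countable (hint μ inferInstance),
    Real.dist_eq, ← (hsf _ inferInstance).tsum_sub (hsf μ inferInstance), ← (habs g).tsum_eq,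
    ← tsum_mul_left, ← Real.norm_eq_abs]
  refine tsum_of_norm_bounded ((habs g).summable.mul_left B).hasSum fun c => ?_
  rw [← sub_smul, norm_smul, mul_comm]
  exact mul_le_mul_of_nonneg_right (hf c) (norm_nonneg _)

/-- Uniformly small tails let the means pass to the limit; without them Fatou's inequality would
give only an upper bound. -/
theorem hasSum_of_tendsto_of_tail (ν : ℕ → Measure α) (w h : α → ℝ) (m : ℝ)
    (hw : ∀ c, Tendsto (fun g => (ν g).real {c}) atTop (𝓝 (w c)))
    (h0 : ∀ c, 0 ≤ h c) (hint : ∀ g, Integrable h (ν g))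
    (hm : Tendsto (fun g => ∫ c, h c ∂(ν g)) atTop (𝓝 m))
    (htail : ∀ ε > 0, ∃ S : Finset α, ∀ g, ∫ c in (↑S : Set α)ᶜ, h c ∂(ν g) ≤ ε) :
    HasSum (fun c => w c * h c) m := by
  have hfin : ∀ (S : Finset α) g, ∫ c in (↑S : Set α), h c ∂(ν g) = ∑ c ∈ S, (ν g).real {c} * h c :=
    fun S g => setIntegral_finset S (hint g).integrableOn
  have hlim : ∀ S : Finset α, Tendsto (fun g => ∑ c ∈ S, (ν g).real {c} * h c) atTop
      (𝓝 (∑ c ∈ S, w c * h c)) := fun S => tendsto_finsetSum S fun c _ => (hw c).mul_const _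
  have hw0 : ∀ c, 0 ≤ w c := fun c => ge_of_tendsto' (hw c) fun g => measureReal_nonneg
  refine hasSum_of_isLUB_of_nonneg _ (fun c => mul_nonneg (hw0 c) (h0 c)) ⟨?_, ?_⟩
  · rintro _ ⟨S, rfl⟩
    refine le_of_tendsto_of_tendsto' (hlim S) hm fun g => ?_
    rw [← hfin]
    exact setIntegral_le_integral (hint g) (Eventually.of_forall h0)
  · intro b hb
    refine le_of_forall_pos_le_add fun ε hε => ?_
    obtain ⟨S, hS⟩ := htail ε hε
    refine (le_of_tendsto_of_tendsto' hm ((hlim S).add_const ε) fun g => ?_).trans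
      (add_le_add_left (hb ⟨S, rfl⟩) ε)
    rw [← hfin, ← integral_add_compl S.measurableSet (hint g)]
    exact add_le_add_right (hS g) _

end DiscreteConvergence

/-! ### Uniform control of the tails of the moments -/

section Tail

variable {ℓ : ℕ} [Fact ℓ.Prime] {n : ℕ}

theorem exists_pos_integral_le (hℓ : ℓ ≠ 2) (hn : 0 < n) {f : BEGClass ℓ n → ℝ}
    (hf : f ∈ momentSpan ℓ n) : ∃ C > 0, ∀ g, ∫ c, f c ∂(linearMeasure n hℓ g) ≤ C := by
  obtain ⟨C, hC⟩ := exists_integral_le_of_mem_momentSpan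
    (fun g Y => (integral_surjCount_linearMeasure hℓ hn g Y).1)
    (tendsto_integral_surjCount hℓ hn) hf
  exact ⟨max C 1, by positivity, fun g => (hC g).trans (le_max_left _ _)⟩

theorem surjCount_le_card_hom (c : BEGClass ℓ n) (Y : BEG ℓ n) :
    surjCount c Y ≤ Nat.card ((Quotient.out c).carrier →+ Y.carrier) := by
  conv_lhs => rw [← cls_out c, surjCount_cls]
  exact Nat.card_le_card_of_injective (fun f => f.1) Subtype.val_injective

theorem le_mul_sq_add_inv {δ h : ℝ} (hδ : 0 < δ) : h ≤ δ * (h * h) + δ⁻¹ := by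
  have e : δ * (h * h) + δ⁻¹ - h = δ⁻¹ * ((δ * h) ^ 2 - δ * h + 1) := by
    field_simp
    ring
  have : 0 ≤ δ⁻¹ * ((δ * h) ^ 2 - δ * h + 1) :=
    mul_nonneg (inv_nonneg.mpr hδ.le) (by nlinarith [sq_nonneg (δ * h - 1), sq_nonneg (δ * h)])
  linarith

/-- The finite set consists of the classes killed by ℓ^k of bounded rank. Large rank is handled by
the mean of #Surj times ℓ^rank. For large exponent, the count h satisfies h ≤ δh² + 1/δ, where h² ≤
#Surj · #Hom has bounded mean and the failure of ℓ^k to kill the group has small probability. -/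
theorem exists_finset_setIntegral_le (hℓ : ℓ ≠ 2) (hn : 0 < n) (Y : BEG ℓ n) (ε : ℝ) (hε : 0 < ε) :
    ∃ S : Finset (BEGClass ℓ n), ∀ g,
      ∫ c in (↑S : Set (BEGClass ℓ n))ᶜ, (surjCount c Y : ℝ) ∂(linearMeasure n hℓ g) ≤ ε := by
  classical
  have hmem₁ := surjCount_mul_rankCard_pow_mem Y 1
  have hmem₂ := surjCount_mul_card_hom_mem Y Y.carrier Y.isPrimary
  obtain ⟨C₁, hC₁, h₁⟩ := exists_pos_integral_le hℓ hn hmem₁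
  obtain ⟨C₂, hC₂, h₂⟩ := exists_pos_integral_le hℓ hn hmem₂
  -- The three contributions are C₁/R, δC₂ and δ⁻¹ℓ^(-k); δ, R and k are chosen in this order to
  -- make each at most ε/3.
  set δ := ε / (3 * C₂) with hδ
  have hδ0 : 0 < δ := by positivity
  obtain ⟨R, hR⟩ := exists_nat_gt (3 * C₁ / ε)
  have hR0 : (0 : ℝ) < R := lt_trans (by positivity) hR
  obtain ⟨k, hk⟩ := ((tendsto_inv_pow (three_le hℓ)).eventually_lt_const
    (show 0 < δ * (ε / 3) by positivity)).exists
  have hfin := finite_killedBy_rank_le (ℓ := ℓ) (n := n) k R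
  refine ⟨hfin.toFinset, fun g => ?_⟩
  have hprob := isProbabilityMeasure_linearMeasure (n := n) hℓ hn g
  set ν := linearMeasure n hℓ g
  have hintY := fun Y => (integral_surjCount_linearMeasure hℓ hn g (n := n) Y).1
  have hi₁ := (integrable_of_mem_momentSpan hintY hmem₁).mul_const (R : ℝ)⁻¹
  have hi₂ := (integrable_of_mem_momentSpan hintY hmem₂).const_mul δ
  have hi₃ : Integrable (fun c => δ⁻¹ * Set.indicator {c | ¬ KilledBy k c} (fun _ => (1 : ℝ)) c) ν :=
    ((integrable_const (1 : ℝ)).indicator MeasurableSet.of_discrete).const_mul _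
  have hind : ∀ c : BEGClass ℓ n, 0 ≤ Set.indicator {c | ¬ KilledBy k c} (fun _ => (1 : ℝ)) c :=
    fun c => Set.indicator_nonneg (fun _ _ => zero_le_one) c
  have hle : ∫ c in (↑hfin.toFinset : Set (BEGClass ℓ n))ᶜ, (surjCount c Y : ℝ) ∂ν ≤
      ∫ c in (↑hfin.toFinset : Set (BEGClass ℓ n))ᶜ,
        ((surjCount c Y : ℝ) * (rankCard c : ℝ) ^ 1 * (R : ℝ)⁻¹ +
        δ * ((surjCount c Y : ℝ) * (Nat.card ((Quotient.out c).carrier →+ Y.carrier) : ℝ)) +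
        δ⁻¹ * Set.indicator {c | ¬ KilledBy k c} (fun _ => (1 : ℝ)) c) ∂ν := by
    refine setIntegral_mono_on (hintY Y).integrableOn ((hi₁.add hi₂).add hi₃).integrableOn
      MeasurableSet.of_discrete fun c hc => ?_
    have hc' : KilledBy k c → R < rankCard c := by simpa using hc
    have hn₁ : 0 ≤ (surjCount c Y : ℝ) * (rankCard c : ℝ) ^ 1 * (R : ℝ)⁻¹ := by positivity
    have hn₂ : 0 ≤ δ * ((surjCount c Y : ℝ) *
      (Nat.card ((Quotient.out c).carrier →+ Y.carrier) : ℝ)) := by positivity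
    have hn₃ := mul_nonneg (inv_nonneg.mpr hδ0.le) (hind c)
    by_cases hkc : KilledBy k c
    · have : (surjCount c Y : ℝ) ≤ (surjCount c Y : ℝ) * (rankCard c : ℝ) ^ 1 * (R : ℝ)⁻¹ := by
        rw [pow_one, mul_assoc]
        refine le_mul_of_one_le_right (Nat.cast_nonneg _) ?_
        rw [← div_eq_mul_inv, one_le_div hR0]
        exact_mod_cast (hc' hkc).le
      linarith
    · have e : Set.indicator {c : BEGClass ℓ n | ¬ KilledBy k c} (fun _ => (1 : ℝ)) c = 1 :=
        Set.indicator_of_mem (by exact hkc) _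
      rw [e, mul_one]
      have h1 := le_mul_sq_add_inv (h := (surjCount c Y : ℝ)) hδ0
      have h2 : δ * ((surjCount c Y : ℝ) * (surjCount c Y : ℝ)) ≤ δ * ((surjCount c Y : ℝ) *
          (Nat.card ((Quotient.out c).carrier →+ Y.carrier) : ℝ)) := by
        gcongr
        exact surjCount_le_card_hom c Y
      linarith
  refine hle.trans ((setIntegral_le_integral ((hi₁.add hi₂).add hi₃)
    (Eventually.of_forall fun c => ?_)).trans ?_)
  · have := mul_nonneg (inv_nonneg.mpr hδ0.le) (hind c)
    have hn₁ : 0 ≤ (surjCount c Y : ℝ) * (rankCard c : ℝ) ^ 1 * (R : ℝ)⁻¹ := by positivity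
    have hn₂ : 0 ≤ δ * ((surjCount c Y : ℝ) *
      (Nat.card ((Quotient.out c).carrier →+ Y.carrier) : ℝ)) := by positivity
    exact add_nonneg (add_nonneg hn₁ hn₂) this
  have hsum := integral_add (hi₁.add hi₂) hi₃
  have hsum' := integral_add hi₁ hi₂
  simp only [Pi.add_apply] at hsum hsum' ⊢
  rw [hsum, hsum', integral_mul_const, integral_const_mul, integral_const_mul]
  have e₃ : ∫ c, Set.indicator {c : BEGClass ℓ n | ¬ KilledBy k c} (fun _ => (1 : ℝ)) c ∂ν =
      ν.real {c | ¬ KilledBy k c} := integral_indicator_one MeasurableSet.of_discrete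
  have b₃ : ν.real {c | ¬ KilledBy k c} ≤ δ * (ε / 3) := by
    refine le_trans ?_ hk.le
    have h := linearMeasure_not_killedBy_le (n := n) hℓ hn g k
    have h' := ENNReal.toReal_mono (by simp [(prime_pos (ℓ := ℓ)).ne']) h
    rw [ENNReal.toReal_inv, ENNReal.toReal_pow, ENNReal.toReal_natCast, ← inv_pow] at h'
    exact h'
  have b₁ : (∫ c, (surjCount c Y : ℝ) * (rankCard c : ℝ) ^ 1 ∂ν) * (R : ℝ)⁻¹ ≤ ε / 3 := by
    refine (mul_le_mul_of_nonneg_right (h₁ g) (by positivity)).trans ?_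
    rw [← div_eq_mul_inv, div_le_iff₀ hR0]
    rw [div_lt_iff₀ hε] at hR
    linarith
  have b₂ : δ * ∫ c, (surjCount c Y : ℝ) *
      (Nat.card ((Quotient.out c).carrier →+ Y.carrier) : ℝ) ∂ν ≤ ε / 3 := by
    refine (mul_le_mul_of_nonneg_left (h₂ g) hδ0.le).trans (le_of_eq ?_)
    rw [hδ]
    field_simp
  have b₃' : δ⁻¹ * ν.real {c | ¬ KilledBy k c} ≤ ε / 3 := by
    rw [inv_mul_le_iff₀ hδ0]
    exact b₃
  rw [e₃]
  linarith

end Tail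

/-! ### The limiting measure and its moments -/

section Limit

variable {ℓ : ℕ} [Fact ℓ.Prime] {n : ℕ}

/-- Almost surely ψ is bijective, so the moment of Y restricted to equal rank is |Aut Y| times the
mass of Y. On the matrix side it is the moment times the probability that the free block is
invertible modulo ℓ. -/
theorem tendsto_linearMeasure_cls (hℓ : ℓ ≠ 2) (hn : 0 < n) (Y : BEG ℓ n)
    (hY : Function.Bijective Y.ψ) :
    Tendsto (fun g => (linearMeasure n hℓ g).real {Y.cls}) atTop
      (𝓝 (cConst ℓ / (cardAut Y * cardSymSq Y))) := by
  classical
  have hA : (cardAut Y : ℝ) ≠ 0 := by exact_mod_cast (cardAut_pos Y).ne'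
  have key : ∀ g, (linearMeasure n hℓ g).real {Y.cls} =
      omegaRatio g Y * (cardSymSq Y : ℝ)⁻¹ * invProb ℓ (g + g - rk Y) * (cardAut Y : ℝ)⁻¹ := by
    intro g
    have h := (integral_surjCount_mul hℓ hn g Y (fun t => if t = homCard ℓ Y.carrier then 1 else 0) _
      (fun κ _ _ h => symAvg_ite_eq hℓ Y κ h)).2
    have hae : (fun c => (surjCount c Y : ℝ) * if rankCard c = homCard ℓ Y.carrier then 1 else 0)
        =ᵐ[linearMeasure n hℓ g] fun c =>
          (cardAut Y : ℝ) * Set.indicator {Y.cls} (fun _ => (1 : ℝ)) c := by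
      filter_upwards [ae_psiBijective hℓ hn g] with c hc
      have e : ((if rankCard c = homCard ℓ Y.carrier then surjCount c Y else 0 : ℕ) : ℝ) =
          ((if c = Y.cls then cardAut Y else 0 : ℕ) : ℝ) :=
        congrArg _ (surjCount_ite_rankCard hn c Y hc hY)
      simpa [Set.indicator_apply] using e
    have e₁ : ∫ c, Set.indicator {Y.cls} (fun _ => (1 : ℝ)) c ∂(linearMeasure n hℓ g) =
        (linearMeasure n hℓ g).real {Y.cls} := integral_indicator_one MeasurableSet.of_discrete
    rw [integral_congr_ae hae, integral_const_mul, e₁] at h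
    rw [← h]
    field_simp
  have h3 : Tendsto (fun g : ℕ => g + g - rk Y) atTop atTop :=
    tendsto_atTop_mono (fun g => show g - rk Y ≤ g + g - rk Y by omega) (tendsto_sub_atTop_nat _)
  have h4 := ((((tendsto_omegaRatio Y).mul_const (cardSymSq Y : ℝ)⁻¹).mul
    ((tendsto_invProb (three_le hℓ)).comp h3))).mul_const (cardAut Y : ℝ)⁻¹
  have e : cConst ℓ / (cardAut Y * cardSymSq Y) =
      1 * (cardSymSq Y : ℝ)⁻¹ * cConst ℓ * (cardAut Y : ℝ)⁻¹ := by
    rw [div_eq_mul_inv, mul_inv]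
    ring
  rw [e]
  exact h4.congr fun g => (key g).symm

theorem linearMeasure_cls_eq_zero (hℓ : ℓ ≠ 2) (hn : 0 < n) (g : ℕ) (Y : BEG ℓ n)
    (hY : ¬ Function.Bijective Y.ψ) : linearMeasure n hℓ g {Y.cls} = 0 := by
  refine measure_mono_null ?_ (ae_iff.mp (ae_psiBijective hℓ hn g))
  rintro c rfl
  exact fun h => hY (psiBijective_cls.mp h)

variable (ℓ n) in
open Classical in
/-- The limiting probabilities of the classes. -/
def limitMass (c : BEGClass ℓ n) : ℝ :=
  if psiBijective c then cConst ℓ / (cardAut (Quotient.out c) * cardSymSq (Quotient.out c)) else 0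

theorem tendsto_linearMeasure_singleton (hℓ : ℓ ≠ 2) (hn : 0 < n) (c : BEGClass ℓ n) :
    Tendsto (fun g => (linearMeasure n hℓ g).real {c}) atTop (𝓝 (limitMass ℓ n c)) := by
  rw [limitMass]
  split_ifs with h
  · rw [← cls_out c, psiBijective_cls] at h
    have := tendsto_linearMeasure_cls hℓ hn _ h
    rwa [cls_out] at this
  · rw [← cls_out c, psiBijective_cls] at h
    have e := fun g => linearMeasure_cls_eq_zero hℓ hn g _ h
    simp_rw [cls_out] at e
    simp_rw [measureReal_def, e]
    simp

theorem limitMass_cls (hℓ : ℓ ≠ 2) (hn : 0 < n) (Y : BEG ℓ n) (hY : Function.Bijective Y.ψ) :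
    limitMass ℓ n Y.cls = cConst ℓ / (cardAut Y * cardSymSq Y) :=
  tendsto_nhds_unique (tendsto_linearMeasure_singleton hℓ hn _) (tendsto_linearMeasure_cls hℓ hn Y hY)

variable (ℓ n) in
/-- The limiting measure. -/
def limitMeasure : Measure (BEGClass ℓ n) :=
  Measure.count.withDensity fun c => ENNReal.ofReal (limitMass ℓ n c)

theorem limitMeasure_singleton (c : BEGClass ℓ n) :
    limitMeasure ℓ n {c} = ENNReal.ofReal (limitMass ℓ n c) := by
  rw [limitMeasure, withDensity_apply _ MeasurableSet.of_discrete, lintegral_singleton,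
    Measure.count_singleton, mul_one]

theorem limitMass_nonneg (hℓ : ℓ ≠ 2) (hn : 0 < n) (c : BEGClass ℓ n) : 0 ≤ limitMass ℓ n c :=
  ge_of_tendsto' (tendsto_linearMeasure_singleton hℓ hn c) fun _ => measureReal_nonneg

/-- The masses and the moments of μ_g converge, and the uniform tail bound keeps any part of the
moment from escaping. The case of trivial Y says that no mass is lost. -/
theorem moment_limitMeasure (hℓ : ℓ ≠ 2) (hn : 0 < n) (Y : BEG ℓ n) :
    moment (limitMeasure ℓ n) Y = (cardSymSq Y : ℝ≥0∞)⁻¹ := by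
  have hsum := hasSum_of_tendsto_of_tail (fun g => linearMeasure n hℓ g) (limitMass ℓ n)
    (fun c => (surjCount c Y : ℝ)) _ (tendsto_linearMeasure_singleton hℓ hn)
    (fun c => Nat.cast_nonneg _) (fun g => (integral_surjCount_linearMeasure hℓ hn g Y).1)
    (tendsto_integral_surjCount hℓ hn Y) (exists_finset_setIntegral_le hℓ hn Y)
  have h0 := limitMass_nonneg (n := n) hℓ hn
  rw [moment, lintegral_countable', ← ofReal_inv_natCast (cardSymSq_pos Y), ← hsum.tsum_eq,
    ENNReal.ofReal_tsum_of_nonneg (fun c => mul_nonneg (h0 c) (Nat.cast_nonneg _)) hsum.summable]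
  refine tsum_congr fun c => ?_
  rw [limitMeasure_singleton, ENNReal.ofReal_mul (h0 c), ENNReal.ofReal_natCast, mul_comm]

end Limit

end BilinEnh

end

theorem theorem2p4 (ℓ : ℕ) [Fact ℓ.Prime] (hℓ : ℓ ≠ 2) (n : ℕ) (hn : 0 < n) :
    -- the random matrix model is well defined
    (∀ g : ℕ, (∀ᵐ M ∂(haarSkew ℓ g), Finite (Coker n M.1)) ∧
      IsProbabilityMeasure (linearMeasure n hℓ g)) ∧
    ∃ μ : Measure (BEGClass ℓ n), IsProbabilityMeasure μ ∧
      -- moments of `μ`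
      (∀ Y : BEG ℓ n, moment μ Y = (cardSymSq Y : ℝ≥0∞)⁻¹) ∧
      -- `μ` is determined by its moments
      (∀ ν : Measure (BEGClass ℓ n),
        (∀ Y : BEG ℓ n, moment ν Y = (cardSymSq Y : ℝ≥0∞)⁻¹) → ν = μ) ∧
      -- `μ_g → μ` weakly (all functions on the discrete set of classes are continuous)
      (∀ f : BEGClass ℓ n → ℝ, (∃ B : ℝ, ∀ c, |f c| ≤ B) →
        Tendsto (fun g : ℕ => ∫ c, f c ∂(linearMeasure n hℓ g)) atTop (𝓝 (∫ c, f c ∂μ))) ∧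
      -- `μ_g → μ` pointwise
      (∀ c : BEGClass ℓ n,
        Tendsto (fun g : ℕ => linearMeasure n hℓ g {c}) atTop (𝓝 (μ {c}))) ∧
      -- the moments of `μ_g` converge
      (∀ Y : BEG ℓ n, Tendsto (fun g : ℕ => moment (linearMeasure n hℓ g) Y) atTop
        (𝓝 (cardSymSq Y : ℝ≥0∞)⁻¹)) ∧
      -- the support of `μ`
      (∀ Y : BEG ℓ n, μ {Y.cls} ≠ 0 ↔ Function.Bijective Y.ψ) ∧
      -- the values of `μ` on its support
      (∀ Y : BEG ℓ n, Function.Bijective Y.ψ →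
        μ {Y.cls} = ENNReal.ofReal (cConst ℓ) / ((cardAut Y : ℝ≥0∞) * (cardSymSq Y : ℝ≥0∞))) := by
  have hprob := isProbabilityMeasure_linearMeasure (n := n) hℓ hn
  have hmom := moment_limitMeasure (n := n) hℓ hn
  have hμ := isProbabilityMeasure_of_moment hmom
  have hsing := fun c : BEGClass ℓ n => tendsto_linearMeasure_singleton hℓ hn c
  have hval : ∀ Y : BEG ℓ n, Function.Bijective Y.ψ → limitMeasure ℓ n {Y.cls} =
      ENNReal.ofReal (cConst ℓ) / ((cardAut Y : ℝ≥0∞) * (cardSymSq Y : ℝ≥0∞)) := by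
    intro Y hY
    have hA : (0 : ℝ) < cardAut Y := by exact_mod_cast cardAut_pos Y
    have hS : (0 : ℝ) < cardSymSq Y := by exact_mod_cast cardSymSq_pos Y
    rw [limitMeasure_singleton, limitMass_cls hℓ hn Y hY, ENNReal.ofReal_div_of_pos (mul_pos hA hS),
      ENNReal.ofReal_mul hA.le, ENNReal.ofReal_natCast, ENNReal.ofReal_natCast]
  refine ⟨fun g => ⟨ae_finite_coker n, hprob g⟩, limitMeasure ℓ n, hμ, hmom,
    fun ν hν => eq_of_moment_eq hℓ hn hν hmom, ?_, ?_, tendsto_moment hℓ hn, ?_, hval⟩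
  · rintro f ⟨B, hB⟩
    refine tendsto_integral_of_tendsto_singleton _ _ (fun c => ?_) f B hB
    rw [measureReal_def, limitMeasure_singleton,
      ENNReal.toReal_ofReal (limitMass_nonneg hℓ hn c)]
    exact hsing c
  · intro c
    rw [limitMeasure_singleton]
    exact (ENNReal.tendsto_ofReal (hsing c)).congr fun g => ofReal_measureReal
  · intro Y
    constructor
    · intro h
      by_contra hY
      apply h
      rw [limitMeasure_singleton, limitMass, if_neg (by rwa [psiBijective_cls]), ENNReal.ofReal_zero]
    · intro hY
      rw [hval Y hY]
      refine ENNReal.div_ne_zero.mpr ⟨?_, ENNReal.mul_ne_top (ENNReal.natCast_ne_top _)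
        (ENNReal.natCast_ne_top _)⟩
      rw [ne_eq, ENNReal.ofReal_eq_zero, not_le]
      exact cConst_pos (three_le hℓ)
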